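/- Let $n\ge 2$, let $-1\le d_0\le d_\infty<\frac1{n-1}$, and for $j\in\{0,\infty\}$ and $i=1,\dots,n+1$ put $r_{j,i}=1-(n-i)d_j$. Let $\kappa_i,\theta_i>0$ ($i=1,\dots,n$), and let $\Delta\ge 0$, with $\Delta=0$ if $d_0\neq-1$. Write $\lceil s\rfloor^{p}=|s|^p\,\mathrm{sign}(s)$ and set $$\varphi_i(s)=\kappa_i\lceil s\rfloor^{r_{0,i+1}/r_{0,i}}+\theta_i\lceil s\rfloor^{r_{\infty,i+1}/r_{\infty,i}},\qquad \phi_i=\varphi_i\circ\cdots\circ\varphi_1 .$$ For gains $k_1,\dots,k_n>0$ put $k_0=1$, $\tilde k_i=k_i/k_{i-1}$, and consider the noise-free error dynamics $$\dot z_i=-\tilde k_i\big(\phi_i(z_1)-z_{i+1}\big)\ (1\le i\le n-1),\qquad \dot z_n=-\tilde k_n\big(\phi_n(z_1)-\delta(t)/k_n\big),\qquad |\delta(t)|\le\Delta,$$ whose solutions are understood in the sense of Filippov (when an exponent of $\varphi_n$ is $0$, the sign function takes the set value $[-1,1]$ at $0$). Let $p_0,p_\infty>0$ satisfy $$p_0\ge\max_{1\le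 i\le n}\frac{r_{0,i}}{r_{\infty,i}}\,(2r_{\infty,i}+d_\infty),\qquad p_\infty\ge 2\max_{1\le i\le n}r_{\infty,i}+d_\infty,\qquad \frac{p_0}{r_{0,i}}<\frac{p_\infty}{r_{\infty,i}}\ \ (1\le i\le n),$$ let $\beta_{0,i},\beta_{\infty,i}>0$ be arbitrary, and define $V(z)=\sum_{i=1}^n Z_i$, where $$Z_i=\sum_{j\in\{0,\infty\}}\beta_{j,i}\Big[\tfrac{r_{j,i}}{p_j}|z_i|^{p_j/r_{j,i}}-z_i\lceil\xi_i\rfloor^{(p_j-r_{j,i})/r_{j,i}}+\tfrac{p_j-r_{j,i}}{p_j}|\xi_i|^{p_j/r_{j,i}}\Big],$$ with $\xi_i=\varphi_i^{-1}(z_{i+1})$ for $i<n$ and $\xi_n=0$. Then there exist gains $k_1,\dots,k_n>0$ such that the following hold. 1. $V$ is a $\mathcal C^1$ Lyapunov function for the error dynamics: it is positive definite and radially unbounded, and $\dot V<0$ for all $z\ne0$, all admissible perturbation values and all velocities of the inclusion. Moreover $V$ is homogeneous in the bi-limit, with weights $(r_{0,1},\dots,r_{0,n})$ and degree $p_0$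 in the $0$-limit and with weights $(r_{\infty,1},\dots,r_{\infty,n})$ and degree $p_\infty$ in the $\infty$-limit. 2. If $d_0\le 0$, or if $d_0>0$ and $\frac{d_0}{p_0}\le\frac{d_\infty}{p_\infty}$, then there are constants $\eta_0,\eta_\infty>0$ such that, along the error dynamics, $$\dot V\le-\eta_0V^{(p_0+d_0)/p_0}-\eta_\infty V^{(p_\infty+d_\infty)/p_\infty}.\tag{$*$}$$ 3. The origin $z=0$ is a globally asymptotically stable equilibrium of the error dynamics, uniformly in the perturbations $\delta$ with $|\delta|\le\Delta$. 4. If $d_0<0<d_\infty$, then the origin is fixed-time stable: it is globally finite-time stable, and its settling-time function $T$ satisfies $T(z_0)\le\bar T$ for all $z_0\in\mathbb R^n$, with a constant $\bar T$ independent of $z_0$. The function $T$ is continuous at $0$ and locally bounded. For all $\eta_0,\eta_\infty>0$ for which $(*)$ holds, one may take $$\bar T=\frac{p_0}{d_0\eta_\infty}\Big(\frac{p_\infty d_0}{p_0d_\infty}-1\Big)\Big(\frac{\eta_0}{\eta_\infty}\Big)^{1/\left(\frac{p_\infty d_0}{p_0d_\infty}-1\right)} .$$ -/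

import Mathlib

open Set Filter Topology MeasureTheory
open scoped ENNReal

noncomputable section

namespace BlDiff

/-! ### Signed powers and homogeneity in the bi-limit -/

/-- The signed power `|s|^p * sign s` (value `0` at `s = 0`). -/
def spow (s p : ℝ) : ℝ := |s| ^ p * Real.sign s

/-- The signed power as a set-valued map: the single value `spow s p`, except that the
discontinuous case `p = 0` (the sign function) takes the whole interval `[-1, 1]` at `s = 0`. -/
def spowSet (s p : ℝ) : Set ℝ := if p = 0 ∧ s = 0 then Icc (-1) 1 else {spow s p}

/-- The dilation `x ↦ (ε^{r_1} x_1, …, ε^{r_n} x_n)`. -/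
def dilation {n : ℕ} (r : Fin n → ℝ) (ε : ℝ) (x : Fin n → ℝ) : Fin n → ℝ :=
  fun i => ε ^ r i * x i

/-- `f` is `r`-homogeneous of degree `l`. -/
def IsHomogeneous {n : ℕ} (r : Fin n → ℝ) (l : ℝ) (f : (Fin n → ℝ) → ℝ) : Prop :=
  ∀ ε : ℝ, 0 < ε → ∀ x : Fin n → ℝ, x ≠ 0 → f (dilation r ε x) = ε ^ l * f x

/-- `f` is approximated along the filter `F` of dilation parameters by the continuous, not
identically vanishing, `(r, l)`-homogeneous function `g`, uniformly on the compact sets that do not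
contain the origin. -/
def IsLimitHomogeneous {n : ℕ} (F : Filter ℝ) (r : Fin n → ℝ) (l : ℝ)
    (f g : (Fin n → ℝ) → ℝ) : Prop :=
  (∀ i, 0 < r i) ∧ Continuous g ∧ (∃ x, x ≠ 0 ∧ g x ≠ 0) ∧ IsHomogeneous r l g ∧
    ∀ C : Set (Fin n → ℝ), IsCompact C → (0 : Fin n → ℝ) ∉ C →
      TendstoUniformlyOn (fun ε x => f (dilation r ε x) / ε ^ l) g F C

/-- `f` is homogeneous in the bi-limit, with weights and degree `(r₀, l₀)` in the `0`-limit and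
`(r₁, l₁)` in the `∞`-limit. -/
def IsBlHomogeneous {n : ℕ} (r₀ : Fin n → ℝ) (l₀ : ℝ) (r₁ : Fin n → ℝ) (l₁ : ℝ)
    (f : (Fin n → ℝ) → ℝ) : Prop :=
  (∃ g, IsLimitHomogeneous (𝓝[>] 0) r₀ l₀ f g) ∧ (∃ g, IsLimitHomogeneous atTop r₁ l₁ f g)

/-! ### The differentiation error dynamics

All sequences (`κ`, `θ`, `k`, `β`, …) are indexed by `1, …, n`; other values are never used. -/

/-- The coordinate `z_i`, `i = 1, …, n`, of `z ∈ ℝⁿ`, with the convention `z_i = 0` otherwise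
(in particular `z_{n+1} = 0`). -/
def coord {n : ℕ} (z : Fin n → ℝ) (i : ℕ) : ℝ :=
  if h : 1 ≤ i ∧ i ≤ n then z ⟨i - 1, by omega⟩ else 0

/-- The weight `r_i = 1 - (n - i) d`. -/
def wt (n : ℕ) (d : ℝ) (i : ℕ) : ℝ := 1 - ((n : ℝ) - (i : ℝ)) * d

/-- The vector of weights `(r_1, …, r_n)`. -/
def wtVec (n : ℕ) (d : ℝ) : Fin n → ℝ := fun i => wt n d (i + 1)

/-- `φ_i(s) = κ_i ⌈s⌋^{r_{0,i+1}/r_{0,i}} + θ_i ⌈s⌋^{r_{∞,i+1}/r_{∞,i}}`. -/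
def varphi (n : ℕ) (d0 dinf : ℝ) (κ θ : ℕ → ℝ) (i : ℕ) (s : ℝ) : ℝ :=
  κ i * spow s (wt n d0 (i + 1) / wt n d0 i) + θ i * spow s (wt n dinf (i + 1) / wt n dinf i)

/-- The composition `φ_i ∘ ⋯ ∘ φ_1` (the identity for `i = 0`). -/
def phi (n : ℕ) (d0 dinf : ℝ) (κ θ : ℕ → ℝ) : ℕ → ℝ → ℝ
  | 0 => id
  | i + 1 => varphi n d0 dinf κ θ (i + 1) ∘ phi n d0 dinf κ θ i

/-- The (Filippov) set-valued version of the injection term `φ_i ∘ ⋯ ∘ φ_1`. It is single-valued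
and equal to `phi` unless `i = n` and `d0 = -1`. -/
def phiSet (n : ℕ) (d0 dinf : ℝ) (κ θ : ℕ → ℝ) (i : ℕ) (s : ℝ) : Set ℝ :=
  {w | ∃ a ∈ spowSet (phi n d0 dinf κ θ (i - 1) s) (wt n d0 (i + 1) / wt n d0 i),
    ∃ b ∈ spowSet (phi n d0 dinf κ θ (i - 1) s) (wt n dinf (i + 1) / wt n dinf i),
      w = κ i * a + θ i * b}

/-- `k̃_i = k_i / k_{i-1}` with `k_0 = 1`. -/
def ktilde (k : ℕ → ℝ) (i : ℕ) : ℝ := k i / (if i = 1 then 1 else k (i - 1))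

/-- The set of admissible velocities of the noise-free error dynamics at the state `z`, for the
value `δ` of the perturbation `-f₀⁽ⁿ⁾`:
`ż_i = -k̃_i (φ_i(z_1) - z_{i+1})` for `i < n` and `ż_n ∈ -k̃_n (φ_n(z_1) - δ / k_n)`. -/
def errorField (n : ℕ) (d0 dinf : ℝ) (κ θ k : ℕ → ℝ) (δ : ℝ) (z : Fin n → ℝ) :
    Set (Fin n → ℝ) :=
  {v | ∀ i ∈ Finset.Icc 1 n, ∃ w ∈ phiSet n d0 dinf κ θ i (coord z 1),
    coord v i = -ktilde k i * (w - if i = n then δ / k n else coord z (i + 1))}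

/-! ### Solutions and stability of perturbed differential inclusions

`F δ z` is the set of velocities at the state `z` for the value `δ` of the perturbation, and
perturbations are functions of time with essential bound `Δ`. -/

/-- The function of time `δ` is bounded by `Δ` at almost all nonnegative times. -/
def Admissible (Δ : ℝ) (δ : ℝ → ℝ) : Prop := ∀ᵐ t ∂(volume.restrict (Ici (0 : ℝ))), |δ t| ≤ Δ

/-- `z` is a (Filippov / Carathéodory) solution of `ż ∈ F (δ t) z` on `[0, T]`. -/
def IsSolutionOn {n : ℕ} (F : ℝ → (Fin n → ℝ) → Set (Fin n → ℝ)) (δ : ℝ → ℝ) (T : ℝ)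
    (z : ℝ → Fin n → ℝ) : Prop :=
  AbsolutelyContinuousOnInterval z 0 T ∧
    ∀ᵐ t ∂(volume.restrict (Icc (0 : ℝ) T)), ∃ v ∈ F (δ t) (z t), HasDerivAt z v t

/-- The origin is a globally asymptotically stable equilibrium of `ż ∈ F (δ t) z`, in the strong
sense (all solutions, uniformly in the perturbations bounded by `Δ`). Solutions on compact
intervals `[0, T]` are used throughout, so that finite escape times are excluded too. -/
structure IsGAS {n : ℕ} (F : ℝ → (Fin n → ℝ) → Set (Fin n → ℝ)) (Δ : ℝ) : Prop where
  equilibrium : ∀ d : ℝ, |d| ≤ Δ → (0 : Fin n → ℝ) ∈ F d 0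
  stable : ∀ ε > 0, ∃ ρ > 0, ∀ (δ : ℝ → ℝ) (T : ℝ) (z : ℝ → Fin n → ℝ), Admissible Δ δ → 0 ≤ T →
    IsSolutionOn F δ T z → ‖z 0‖ < ρ → ∀ t ∈ Icc 0 T, ‖z t‖ < ε
  bounded : ∀ R : ℝ, ∃ M : ℝ, ∀ (δ : ℝ → ℝ) (T : ℝ) (z : ℝ → Fin n → ℝ), Admissible Δ δ → 0 ≤ T →
    IsSolutionOn F δ T z → ‖z 0‖ ≤ R → ∀ t ∈ Icc 0 T, ‖z t‖ ≤ M
  attractive : ∀ R : ℝ, ∀ ε > 0, ∃ S ≥ 0, ∀ (δ : ℝ → ℝ) (T : ℝ) (z : ℝ → Fin n → ℝ),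
    Admissible Δ δ → 0 ≤ T → IsSolutionOn F δ T z → ‖z 0‖ ≤ R → ∀ t ∈ Icc 0 T, S ≤ t → ‖z t‖ < ε

/-- The time after which the trajectory `z` stays at the origin (`∞` if there is none). -/
def arrivalTime {n : ℕ} (z : ℝ → Fin n → ℝ) : ℝ≥0∞ :=
  sInf {τ : ℝ≥0∞ | ∀ t : ℝ, 0 ≤ t → τ ≤ ENNReal.ofReal t → z t = 0}

/-- The settling-time function: the largest arrival time at the origin of the solutions on
`[0, ∞)` that start at `z₀`, over all admissible perturbations. -/
def settlingTime {n : ℕ} (F : ℝ → (Fin n → ℝ) → Set (Fin n → ℝ)) (Δ : ℝ) (z₀ : Fin n → ℝ) :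
    ℝ≥0∞ :=
  sSup {τ : ℝ≥0∞ | ∃ (δ : ℝ → ℝ) (z : ℝ → Fin n → ℝ), Admissible Δ δ ∧
    (∀ T : ℝ, 0 ≤ T → IsSolutionOn F δ T z) ∧ z 0 = z₀ ∧ τ = arrivalTime z}

/-- Global finite-time stability. -/
def IsGlobalFTS {n : ℕ} (F : ℝ → (Fin n → ℝ) → Set (Fin n → ℝ)) (Δ : ℝ) : Prop :=
  IsGAS F Δ ∧ ∀ z₀, settlingTime F Δ z₀ < ∞

/-- Fixed-time stability: global finite-time stability with a settling time that is bounded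
independently of the initial state. -/
def IsFxTS {n : ℕ} (F : ℝ → (Fin n → ℝ) → Set (Fin n → ℝ)) (Δ : ℝ) : Prop :=
  IsGlobalFTS F Δ ∧ ∃ Tbar : ℝ, 0 < Tbar ∧ ∀ z₀, settlingTime F Δ z₀ ≤ ENNReal.ofReal Tbar

/-! ### The Lyapunov function -/

/-- `β (r/p |z|^{p/r} - z ⌈ξ⌋^{(p-r)/r} + (p-r)/p |ξ|^{p/r})`. -/
def youngTerm (β r p z ξ : ℝ) : ℝ :=
  β * (r / p * |z| ^ (p / r) - z * spow ξ ((p - r) / r) + (p - r) / p * |ξ| ^ (p / r))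

/-- `ξ_i = φ_i⁻¹(z_{i+1})` for `i < n` (there `φ_i` is a bijection of the real line), and
`ξ_n = 0`. -/
def xi (n : ℕ) (d0 dinf : ℝ) (κ θ : ℕ → ℝ) (i : ℕ) (z : Fin n → ℝ) : ℝ :=
  if i < n then Function.invFun (varphi n d0 dinf κ θ i) (coord z (i + 1)) else 0

/-- `V(z) = ∑_{i=1}^{n} Z_i(z_i, z_{i+1})`. -/
def lyapV (n : ℕ) (d0 dinf : ℝ) (κ θ : ℕ → ℝ) (p0 pinf : ℝ) (β0 βinf : ℕ → ℝ)
    (z : Fin n → ℝ) : ℝ :=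
  ∑ i ∈ Finset.Icc 1 n,
    (youngTerm (β0 i) (wt n d0 i) p0 (coord z i) (xi n d0 dinf κ θ i z) +
      youngTerm (βinf i) (wt n dinf i) pinf (coord z i) (xi n d0 dinf κ θ i z))

/-- `V` is a `C¹` strict global Lyapunov function for `ż ∈ F (δ t) z`, `|δ| ≤ Δ`. -/
structure IsLyapunov {n : ℕ} (F : ℝ → (Fin n → ℝ) → Set (Fin n → ℝ)) (Δ : ℝ)
    (V : (Fin n → ℝ) → ℝ) : Prop where
  contDiff : ContDiff ℝ 1 V
  zero : V 0 = 0
  pos : ∀ z, z ≠ 0 → 0 < V z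
  radiallyUnbounded : Tendsto V (cocompact (Fin n → ℝ)) atTop
  decreasing : ∀ d : ℝ, |d| ≤ Δ → ∀ z, z ≠ 0 → ∀ v ∈ F d z, fderiv ℝ V z v < 0

/-- The differential inequality `V̇ ≤ -η₀ V^{(p₀+d₀)/p₀} - η_∞ V^{(p_∞+d_∞)/p_∞}`, for all
perturbations `|d| ≤ Δ` and all velocities of the inclusion. -/
def DecayIneq {n : ℕ} (F : ℝ → (Fin n → ℝ) → Set (Fin n → ℝ)) (Δ : ℝ) (V : (Fin n → ℝ) → ℝ)
    (d0 dinf p0 pinf η0 ηinf : ℝ) : Prop :=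
  ∀ d : ℝ, |d| ≤ Δ → ∀ z, ∀ v ∈ F d z,
    fderiv ℝ V z v ≤ -η0 * V z ^ ((p0 + d0) / p0) - ηinf * V z ^ ((pinf + dinf) / pinf)

end BlDiff

end

noncomputable section

namespace BlDiff

/-! ### Signed powers -/

/-! Each term of `V` is a sum of Young gaps between `z_i` and `ξ_i`, hence nonnegative and zero only
if `z_i = ξ_i`. Since `ξ_n = 0`, the equalities for all `i` force `z = 0`, so `V` is positive
definite. A gap differentiated in `z_i` gives an increment of an increasing function between `ξ_i`
and `z_i`; differentiated in `z_{i+1}` it gives a multiple of `ξ_i - z_i`.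

This makes `V̇` triangular. On the set where `z_j = ξ_j` for all `j < i`, the cross term from index
`i - 1` vanishes and the injection term collapses to `φ_i(z_i)`. The contribution of `ż_i` to `-V̇`
is then a product of increments of two increasing functions: it is nonnegative and vanishes only if
`z_i = ξ_i` (`gT_sign`). Once all these equalities hold, the last component decreases `V` strictly,
because its gain lets the injection dominate the perturbation (`gLast_neg`). On a compact set the
gains can therefore be chosen one after the other, from the last to the first, each large compared
with those after it (`exists_gain`, `exists_gains`). The set-valued last component is first replaced
by a continuous upper bound (`gLast`, `neg_mul_le_of_sign`), so that compactness applies.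

The system is not homogeneous, so one unit sphere does not cover all states. However, a dilation by
`r ≤ 1` with the `0`-weights turns it into a system of the same form whose `θ_i`, `β_{∞,i}` are
multiplied by powers of `r`. A dilation by `r ≥ 1` with the `∞`-weights does the same to `κ_i`,
`β_{0,i}`, `Δ` with powers of `1/r`. Adding the two homogeneous limits gives a family with a
parameter `t` in `[0, 2]`, continuous up to its end points, and every nonzero state of the
differentiator is a dilated unit vector of some member (`Hyp.exists_rescale`). Gains chosen by
compactness on `[0, 2] × sphere` work for all members at once.

The scaling laws (`Rescale.gV_mul`, `Rescale.gRate_mul`) then give the rest: radial unboundedness,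
the bi-limit homogeneity of `V` as continuity in `t`, and the differential inequality, by comparing
powers of `r`. Stability and the settling time follow by integrating functions of `V` along
absolutely continuous solutions (`decrease_along`). -/

@[simp] theorem spow_zero_left (p : ℝ) : spow 0 p = 0 := by simp [spow]

theorem spow_of_pos {s : ℝ} (hs : 0 < s) (p : ℝ) : spow s p = s ^ p := by
  simp [spow, Real.sign_of_pos hs, abs_of_pos hs]

theorem spow_neg_left (s p : ℝ) : spow (-s) p = -spow s p := by
  simp [spow, Real.sign_neg]

theorem abs_spow {s : ℝ} (hs : s ≠ 0) (p : ℝ) : |spow s p| = |s| ^ p := by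
  have h : |Real.sign s| = 1 := by
    rcases Real.sign_apply_eq_of_ne_zero s hs with h | h <;> simp [h]
  rw [spow, abs_mul, h, mul_one, abs_of_nonneg (by positivity)]

theorem spow_mul_self (s p : ℝ) : spow s p * s = |s| ^ p * |s| := by
  rw [spow, mul_assoc]
  congr 1
  rcases lt_trichotomy s 0 with h | h | h
  · rw [Real.sign_of_neg h, abs_of_neg h]; ring
  · simp [h]
  · rw [Real.sign_of_pos h, abs_of_pos h]; ring

theorem abs_spow_le (s p : ℝ) : |spow s p| ≤ |s| ^ p := by
  rcases eq_or_ne s 0 with rfl | hs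
  · simp only [spow_zero_left, abs_zero]; positivity
  · rw [abs_spow hs]

theorem spow_mul_left {l : ℝ} (hl : 0 < l) (s p : ℝ) : spow (l * s) p = l ^ p * spow s p := by
  have h : Real.sign (l * s) = Real.sign s := by
    rcases lt_trichotomy s 0 with h | h | h
    · rw [Real.sign_of_neg h, Real.sign_of_neg (mul_neg_of_pos_of_neg hl h)]
    · simp [h]
    · rw [Real.sign_of_pos h, Real.sign_of_pos (mul_pos hl h)]
  rw [spow, spow, h, abs_mul, abs_of_pos hl, Real.mul_rpow hl.le (abs_nonneg _), mul_assoc]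

theorem spow_strictMono {p : ℝ} (hp : 0 < p) : StrictMono fun s => spow s p := by
  apply strictMono_of_odd_strictMonoOn_nonneg (fun x => spow_neg_left x p)
  intro x hx y _ hxy
  have hx : 0 ≤ x := hx
  have hy : 0 < y := lt_of_le_of_lt hx hxy
  simp only
  rw [spow_of_pos hy]
  rcases hx.eq_or_lt with rfl | hx'
  · simp only [spow_zero_left]; positivity
  · rw [spow_of_pos hx']; exact Real.rpow_lt_rpow hx hxy hp

/-- Positive and negative parts avoid the discontinuous sign factor, so continuity reduces to that
of `rpow`. -/
theorem spow_eq_max {p : ℝ} (hp : 0 < p) (s : ℝ) :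
    spow s p = max s 0 ^ p - max (-s) 0 ^ p := by
  have h0 : (0 : ℝ) ^ p = 0 := Real.zero_rpow hp.ne'
  rcases lt_trichotomy s 0 with h | h | h
  · rw [max_eq_right h.le, max_eq_left (by linarith), h0, ← neg_neg s, spow_neg_left,
      spow_of_pos (by linarith)]
    simp
  · simp [h]
  · rw [max_eq_left h.le, max_eq_right (by linarith), h0, spow_of_pos h]; simp

theorem continuous_spow {p : ℝ} (hp : 0 < p) : Continuous fun s => spow s p := by
  simp_rw [spow_eq_max hp]
  have := Real.continuous_rpow_const hp.le
  fun_prop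

theorem continuous_abs_rpow {p : ℝ} (hp : 0 ≤ p) : Continuous fun s : ℝ => |s| ^ p := by
  have := Real.continuous_rpow_const hp
  fun_prop

theorem hasDerivAt_spow {s : ℝ} (hs : s ≠ 0) (p : ℝ) :
    HasDerivAt (fun s => spow s p) (p * |s| ^ (p - 1)) s := by
  rcases lt_or_gt_of_ne hs with h | h
  · have h1 : HasDerivAt (fun x : ℝ => -(-x) ^ p) (p * |s| ^ (p - 1)) s := by
      have := ((hasDerivAt_neg s).rpow_const (p := p) (Or.inl (by linarith : -s ≠ 0))).neg
      rw [abs_of_neg h]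
      exact this.congr_deriv (by ring)
    apply h1.congr_of_eventuallyEq
    filter_upwards [gt_mem_nhds h] with x hx
    rw [← neg_neg x, spow_neg_left, spow_of_pos (by linarith), neg_neg]
  · have h1 : HasDerivAt (fun x : ℝ => x ^ p) (p * |s| ^ (p - 1)) s := by
      rw [abs_of_pos h]
      exact Real.hasDerivAt_rpow_const (Or.inl hs)
    apply h1.congr_of_eventuallyEq
    filter_upwards [lt_mem_nhds h] with x hx
    rw [spow_of_pos hx]

theorem hasDerivAt_abs_rpow_spow (s : ℝ) {q : ℝ} (hq : 1 < q) :
    HasDerivAt (fun s : ℝ => |s| ^ q) (q * spow s (q - 1)) s := by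
  refine (hasDerivAt_abs_rpow s hq).congr_deriv ?_
  rw [mul_assoc]
  congr 1
  rcases eq_or_ne s 0 with rfl | hs
  · simp
  · have h : |s| ≠ 0 := abs_ne_zero.2 hs
    apply mul_right_cancel₀ hs
    rw [spow_mul_self, mul_assoc, ← abs_mul_abs_self s, ← mul_assoc]
    congr 1
    rw [← Real.rpow_add_one h]
    congr 1
    ring

/-! ### Sums of two signed powers and their inverses -/

/-- `A ⌈s⌋^a + B ⌈s⌋^b`. -/
def bin (A B a b s : ℝ) : ℝ := A * spow s a + B * spow s b

/-- The inverse of `bin A B a b`. -/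
def binInv (A B a b : ℝ) : ℝ → ℝ := Function.invFun (bin A B a b)

/-- One coefficient may vanish: this happens in the homogeneous limits. -/
theorem bin_strictMono {A B a b : ℝ} (hA : 0 ≤ A) (hB : 0 ≤ B) (hAB : 0 < A + B)
    (ha : 0 < a) (hb : 0 < b) : StrictMono (bin A B a b) := by
  intro x y hxy
  have h1 := spow_strictMono ha hxy
  have h2 := spow_strictMono hb hxy
  simp only at h1 h2
  unfold bin
  rcases hA.eq_or_lt with rfl | hA'
  · have : 0 < B := by linarith
    nlinarith
  · nlinarith

@[simp] theorem bin_zero (A B a b : ℝ) : bin A B a b 0 = 0 := by simp [bin]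

theorem bin_neg (A B a b s : ℝ) : bin A B a b (-s) = -bin A B a b s := by
  simp [bin, spow_neg_left]; ring

theorem continuous_bin {X : Type*} [TopologicalSpace X] {A B f : X → ℝ} {a b : ℝ}
    (hA : Continuous A) (hB : Continuous B) (hf : Continuous f) (ha : 0 < a) (hb : 0 < b) :
    Continuous fun x => bin (A x) (B x) a b (f x) := by
  unfold bin
  have h1 := (continuous_spow ha).comp hf
  have h2 := (continuous_spow hb).comp hf
  simp only [Function.comp_def] at h1 h2
  fun_prop

theorem bin_tendsto_atTop {A B a b : ℝ} (hA : 0 ≤ A) (hB : 0 ≤ B) (hAB : 0 < A + B)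
    (ha : 0 < a) (hb : 0 < b) : Tendsto (bin A B a b) atTop atTop := by
  have key : ∀ p : ℝ, 0 < p → Tendsto (fun s => spow s p) atTop atTop := fun p hp =>
    (tendsto_rpow_atTop hp).congr' (by
      filter_upwards [eventually_gt_atTop 0] with s hs using (spow_of_pos hs p).symm)
  have nn : ∀ p : ℝ, ∀ᶠ s : ℝ in atTop, 0 ≤ spow s p := fun p => by
    filter_upwards [eventually_gt_atTop 0] with s hs
    rw [spow_of_pos hs]; positivity
  rcases hA.eq_or_lt with rfl | hA'
  · have hB' : 0 < B := by linarith
    exact ((key b hb).const_mul_atTop hB').congr (fun s => by simp [bin])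
  · refine tendsto_atTop_mono' _ ?_ ((key a ha).const_mul_atTop hA')
    filter_upwards [nn b] with s hs
    have := mul_nonneg hB hs
    simp only [bin]; linarith

theorem bin_surjective {A B a b : ℝ} (hA : 0 ≤ A) (hB : 0 ≤ B) (hAB : 0 < A + B)
    (ha : 0 < a) (hb : 0 < b) : Function.Surjective (bin A B a b) := by
  have h := bin_tendsto_atTop hA hB hAB ha hb
  refine (continuous_bin continuous_const continuous_const continuous_id ha hb).surjective h ?_
  have h2 := tendsto_neg_atTop_atBot.comp (h.comp tendsto_neg_atBot_atTop)
  refine h2.congr fun s => ?_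
  simp [bin_neg]

theorem bin_binInv {A B a b : ℝ} (hA : 0 ≤ A) (hB : 0 ≤ B) (hAB : 0 < A + B)
    (ha : 0 < a) (hb : 0 < b) (y : ℝ) : bin A B a b (binInv A B a b y) = y :=
  Function.rightInverse_invFun (bin_surjective hA hB hAB ha hb) y

theorem binInv_bin {A B a b : ℝ} (hA : 0 ≤ A) (hB : 0 ≤ B) (hAB : 0 < A + B)
    (ha : 0 < a) (hb : 0 < b) (s : ℝ) : binInv A B a b (bin A B a b s) = s :=
  Function.leftInverse_invFun (bin_strictMono hA hB hAB ha hb).injective s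

theorem binInv_zero {A B a b : ℝ} (hA : 0 ≤ A) (hB : 0 ≤ B) (hAB : 0 < A + B)
    (ha : 0 < a) (hb : 0 < b) : binInv A B a b 0 = 0 := by
  simpa using binInv_bin hA hB hAB ha hb 0

/-- The inverse of a strictly monotone family that depends continuously on a parameter is jointly
continuous. -/
theorem continuous_inverse_family {X : Type*} [TopologicalSpace X] {f g : X → ℝ → ℝ}
    (hf : ∀ x, StrictMono (f x)) (hg : ∀ x y, f x (g x y) = y) (hc : ∀ s, Continuous fun x => f x s) :
    Continuous fun p : X × ℝ => g p.1 p.2 := by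
  -- By monotonicity, `l < g x y` is equivalent to `f x l < y`, an open condition on `(x, y)` for
  -- fixed `l`; no uniformity in `s` is needed.
  refine continuous_iff_continuousAt.2 fun p => tendsto_order.2 ⟨fun l hl => ?_, fun u hu => ?_⟩
  · have h : f p.1 l < p.2 := by rw [← hg p.1 p.2]; exact hf _ hl
    have ho : IsOpen {q : X × ℝ | f q.1 l < q.2} :=
      isOpen_lt ((hc l).comp continuous_fst) continuous_snd
    filter_upwards [ho.mem_nhds h] with q hq
    exact (hf q.1).lt_iff_lt.1 (by rw [hg]; exact hq)
  · have h : p.2 < f p.1 u := by rw [← hg p.1 p.2]; exact hf _ hu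
    have ho : IsOpen {q : X × ℝ | q.2 < f q.1 u} :=
      isOpen_lt continuous_snd ((hc u).comp continuous_fst)
    filter_upwards [ho.mem_nhds h] with q hq
    exact (hf q.1).lt_iff_lt.1 (by rw [hg]; exact hq)

theorem continuous_binInv {X : Type*} [TopologicalSpace X] {A B f : X → ℝ} {a b : ℝ}
    (hA : Continuous A) (hB : Continuous B) (hf : Continuous f)
    (hA0 : ∀ x, 0 ≤ A x) (hB0 : ∀ x, 0 ≤ B x) (hAB : ∀ x, 0 < A x + B x)
    (ha : 0 < a) (hb : 0 < b) :
    Continuous fun x => binInv (A x) (B x) a b (f x) :=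
  (continuous_inverse_family (f := fun x => bin (A x) (B x) a b)
    (fun x => bin_strictMono (hA0 x) (hB0 x) (hAB x) ha hb)
    (fun x y => bin_binInv (hA0 x) (hB0 x) (hAB x) ha hb y)
    (fun _ => continuous_bin hA hB continuous_const ha hb)).comp (continuous_id.prodMk hf)

/-- The derivative of `⌈ξ⌋^{q-1}` with respect to `y`, where `y = A ⌈ξ⌋^a + B ⌈ξ⌋^b`. -/
def invSlope (A B a b q ξ : ℝ) : ℝ :=
  (q - 1) * |ξ| ^ (q - 1 - a) / (A * a + B * b * |ξ| ^ (b - a))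

theorem hasDerivAt_binInv {A B a b : ℝ} (hA : 0 < A) (hB : 0 ≤ B)
    (ha : 0 < a) (hb : 0 < b) {y : ℝ} (hy : binInv A B a b y ≠ 0) :
    HasDerivAt (binInv A B a b)
      (A * (a * |binInv A B a b y| ^ (a - 1)) + B * (b * |binInv A B a b y| ^ (b - 1)))⁻¹ y := by
  have hAB : 0 < A + B := by linarith
  refine HasDerivAt.of_local_left_inverse (f := bin A B a b) ?_ ?_ ?_
    (Eventually.of_forall (bin_binInv hA.le hB hAB ha hb))
  · exact (continuous_binInv (X := ℝ) (A := fun _ => A) (B := fun _ => B) continuous_const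
      continuous_const continuous_id (fun _ => hA.le) (fun _ => hB) (fun _ => hAB) ha hb).continuousAt
  · exact ((hasDerivAt_spow hy a).const_mul A).add ((hasDerivAt_spow hy b).const_mul B)
  · have : 0 < |binInv A B a b y| := abs_pos.2 hy
    positivity

theorem continuous_invSlope {A B a b q : ℝ} (hA : 0 < A) (hB : 0 ≤ B)
    (ha : 0 < a) (hab : a ≤ b) (hq : a ≤ q - 1) : Continuous (invSlope A B a b q) := by
  unfold invSlope
  have h1 := continuous_abs_rpow (p := q - 1 - a) (by linarith)
  have h2 := continuous_abs_rpow (p := b - a) (by linarith)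
  refine Continuous.div (by fun_prop) (by fun_prop) fun x => ?_
  have : 0 < b := by linarith
  positivity

/-- The inverse itself may have a vertical tangent at `0` (when `a > 1`). Raising it to the power `q
- 1 ≥ a` cancels the singularity: the derivative away from `0` extends continuously, and so is the
derivative at `0` too. -/
theorem hasDerivAt_spow_binInv {A B a b q : ℝ} (hA : 0 < A) (hB : 0 ≤ B)
    (ha : 0 < a) (hab : a ≤ b) (hq : a ≤ q - 1) (y : ℝ) :
    HasDerivAt (fun y => spow (binInv A B a b y) (q - 1))
      (invSlope A B a b q (binInv A B a b y)) y := by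
  have hb : 0 < b := by linarith
  have hAB : 0 < A + B := by linarith
  have hc : Continuous (binInv A B a b) :=
    continuous_binInv (X := ℝ) (A := fun _ => A) (B := fun _ => B) continuous_const
      continuous_const continuous_id (fun _ => hA.le) (fun _ => hB) (fun _ => hAB) ha hb
  have h0 := binInv_zero hA.le hB hAB ha hb
  refine hasDerivAt_of_hasDerivAt_of_ne' (x := 0)
    (g := fun y => invSlope A B a b q (binInv A B a b y)) (fun y hy => ?_)
    ((continuous_spow (by linarith)).comp hc).continuousAt
    ((continuous_invSlope hA hB ha hab hq).comp hc).continuousAt y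
  have hξ : binInv A B a b y ≠ 0 := fun h => hy (by
    rw [← bin_binInv hA.le hB hAB ha hb y, h, bin_zero])
  refine ((hasDerivAt_spow hξ (q - 1)).comp y (hasDerivAt_binInv hA hB ha hb hξ)).congr_deriv ?_
  set ξ := binInv A B a b y
  have hp : 0 < |ξ| := abs_pos.2 hξ
  rw [invSlope, ← div_eq_mul_inv]
  have e1 : |ξ| ^ (q - 1 - 1) = |ξ| ^ (q - 1 - a) * |ξ| ^ (a - 1) := by
    rw [← Real.rpow_add hp]; ring_nf
  have e2 : |ξ| ^ (b - 1) = |ξ| ^ (b - a) * |ξ| ^ (a - 1) := by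
    rw [← Real.rpow_add hp]; ring_nf
  rw [e1, e2, div_eq_div_iff (by positivity) (by positivity)]
  ring

/-- This is `d((q-1)/q |ξ|^q) = ξ d⌈ξ⌋^{q-1}`. With the term `-z ⌈ξ⌋^{q-1}` of the gap it leaves the
factor `ξ - z`, which is why the cross terms vanish where `z = ξ`. -/
theorem hasDerivAt_abs_binInv_rpow {A B a b q : ℝ} (hA : 0 < A) (hB : 0 ≤ B)
    (ha : 0 < a) (hab : a ≤ b) (hq : a ≤ q - 1) (y : ℝ) :
    HasDerivAt (fun y => (q - 1) / q * |binInv A B a b y| ^ q)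
      (binInv A B a b y * invSlope A B a b q (binInv A B a b y)) y := by
  have hb : 0 < b := by linarith
  have hAB : 0 < A + B := by linarith
  have hc : Continuous (binInv A B a b) :=
    continuous_binInv (X := ℝ) (A := fun _ => A) (B := fun _ => B) continuous_const
      continuous_const continuous_id (fun _ => hA.le) (fun _ => hB) (fun _ => hAB) ha hb
  have h0 := binInv_zero hA.le hB hAB ha hb
  have hq1 : 1 < q := by linarith
  have hs := (continuous_invSlope hA hB ha hab hq).comp hc
  refine hasDerivAt_of_hasDerivAt_of_ne' (x := 0)
    (g := fun y => binInv A B a b y * invSlope A B a b q (binInv A B a b y)) (fun y hy => ?_)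
    (((continuous_abs_rpow (by linarith)).comp hc).const_mul _).continuousAt
    (hc.mul hs).continuousAt y
  have hξ : binInv A B a b y ≠ 0 := fun h => hy (by
    rw [← bin_binInv hA.le hB hAB ha hb y, h, bin_zero])
  refine (((hasDerivAt_abs_rpow_spow (binInv A B a b y) hq1).comp y
    (hasDerivAt_binInv hA hB ha hb hξ)).const_mul ((q - 1) / q)).congr_deriv ?_
  set ξ := binInv A B a b y
  have hp : 0 < |ξ| := abs_pos.2 hξ
  have e0 : spow ξ (q - 1) = ξ * |ξ| ^ (q - 1 - 1) := by
    apply mul_right_cancel₀ hξ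
    rw [spow_mul_self, mul_right_comm, ← abs_mul_abs_self ξ, mul_comm (|ξ| * |ξ|), ← mul_assoc]
    congr 1
    rw [← Real.rpow_add_one hp.ne']
    ring_nf
  have e1 : |ξ| ^ (q - 1 - 1) = |ξ| ^ (q - 1 - a) * |ξ| ^ (a - 1) := by
    rw [← Real.rpow_add hp]; ring_nf
  have e2 : |ξ| ^ (b - 1) = |ξ| ^ (b - a) * |ξ| ^ (a - 1) := by
    rw [← Real.rpow_add hp]; ring_nf
  rw [invSlope, e0, e1, e2]
  have hq0 : q ≠ 0 := by linarith
  have hd : A * a + B * b * |ξ| ^ (b - a) ≠ 0 := by positivity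
  have hd' : A * (a * |ξ| ^ (a - 1)) + B * (b * (|ξ| ^ (b - a) * |ξ| ^ (a - 1)))
    = (A * a + B * b * |ξ| ^ (b - a)) * |ξ| ^ (a - 1) := by ring
  have hr : |ξ| ^ (a - 1) ≠ 0 := by positivity
  rw [hd']
  field_simp

/-! ### A family of systems containing the differentiator and its two homogeneous limits -/

/-- The only danger is `A → 0` together with `f → 0`. There both quotients are dominated by those
with the `A` term dropped, with powers `q0 - 1 - b ≥ 0` and `q1 - 1 - b > 0` of `|f|`. The second
tends to `0`; the first may only stay bounded, and `hdeg` supplies the vanishing factor `C0`. -/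
theorem continuous_add_invSlope {Y : Type*} [TopologicalSpace Y] {A B C0 C1 f : Y → ℝ}
    {a b q0 q1 : ℝ} (hA : Continuous A) (hB : Continuous B) (hC0 : Continuous C0)
    (hC1 : Continuous C1) (hf : Continuous f) (hA0 : ∀ y, 0 ≤ A y) (hB0 : ∀ y, 0 ≤ B y)
    (hAB : ∀ y, 0 < A y + B y) (hC0' : ∀ y, 0 ≤ C0 y) (hC1' : ∀ y, 0 ≤ C1 y)
    (hdeg : ∀ y, A y = 0 → C0 y = 0) (ha : 0 < a) (hab : a ≤ b) (hbq : b ≤ q0 - 1)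
    (hq : q0 < q1) :
    Continuous fun y => C0 y * invSlope (A y) (B y) a b q0 (f y) +
      C1 y * invSlope (A y) (B y) a b q1 (f y) := by
  have hb : 0 < b := by linarith
  have c1 := (continuous_abs_rpow (p := q0 - 1 - a) (by linarith)).comp hf
  have c2 := (continuous_abs_rpow (p := q1 - 1 - a) (by linarith)).comp hf
  have c3 := (continuous_abs_rpow (p := b - a) (by linarith)).comp hf
  have c4 := (continuous_abs_rpow (p := q0 - 1 - b) (by linarith)).comp hf
  have c5 := (continuous_abs_rpow (p := q1 - 1 - b) (by linarith)).comp hf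
  simp only [Function.comp_def] at c1 c2 c3 c4 c5
  have hden : Continuous fun y => A y * a + B y * b * |f y| ^ (b - a) := by fun_prop
  unfold invSlope
  refine continuous_iff_continuousAt.2 fun y => ?_
  by_cases hd : A y * a + B y * b * |f y| ^ (b - a) = 0
  · have p1 : 0 ≤ A y * a := mul_nonneg (hA0 y) ha.le
    have p2 : 0 ≤ B y * b * |f y| ^ (b - a) := by have := hB0 y; positivity
    have hAy : A y = 0 := by
      have : A y * a = 0 := by linarith
      exact (mul_eq_zero.1 this).resolve_right ha.ne'
    have hBy : 0 < B y := by have := hAB y; linarith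
    have hf0 : |f y| ^ (b - a) = 0 := by
      have : B y * b * |f y| ^ (b - a) = 0 := by linarith
      exact (mul_eq_zero.1 this).resolve_left (by positivity)
    obtain ⟨hfy, hba⟩ := (Real.rpow_eq_zero_iff_of_nonneg (abs_nonneg _)).1 hf0
    have hab' : a < b := lt_of_le_of_ne hab (fun h => hba (by linarith))
    -- The majorant obtained by dropping `A` from the denominator and cancelling `|f|^(b - a)`.
    set R : Y → ℝ := fun y => (C0 y * ((q0 - 1) * |f y| ^ (q0 - 1 - b)) +
      C1 y * ((q1 - 1) * |f y| ^ (q1 - 1 - b))) / (B y * b) with hR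
    have hRc : ContinuousAt R y :=
      ContinuousAt.div (by fun_prop) (by fun_prop) (by positivity)
    have hR0 : R y = 0 := by
      simp [hR, hfy, hdeg y hAy, Real.zero_rpow (show q1 - 1 - b ≠ 0 by linarith)]
    unfold ContinuousAt
    simp only [hd, div_zero, mul_zero, add_zero]
    have hRt : Tendsto R (𝓝 y) (𝓝 0) := by rw [← hR0]; exact hRc
    have hq0 : 0 ≤ q0 - 1 := by linarith
    have hq1 : 0 ≤ q1 - 1 := by linarith
    refine tendsto_of_tendsto_of_tendsto_of_le_of_le' tendsto_const_nhds hRt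
      (Eventually.of_forall fun x => ?_) ?_
    · have := hA0 x; have := hB0 x; have := hC0' x; have := hC1' x
      positivity
    · filter_upwards [hB.continuousAt.eventually (lt_mem_nhds hBy)] with x hx
      have hAx := hA0 x; have h0x := hC0' x; have h1x := hC1' x
      by_cases hfx : f x = 0
      · have e1 : |f x| ^ (q0 - 1 - a) = 0 := by
          rw [hfx, abs_zero, Real.zero_rpow (by linarith)]
        have e2 : |f x| ^ (q1 - 1 - a) = 0 := by
          rw [hfx, abs_zero, Real.zero_rpow (by linarith)]
        simp only [e1, e2, mul_zero, zero_div, add_zero, hR]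
        positivity
      · have hp : 0 < |f x| := abs_pos.2 hfx
        have e1 : |f x| ^ (q0 - 1 - a) = |f x| ^ (q0 - 1 - b) * |f x| ^ (b - a) := by
          rw [← Real.rpow_add hp]; ring_nf
        have e2 : |f x| ^ (q1 - 1 - a) = |f x| ^ (q1 - 1 - b) * |f x| ^ (b - a) := by
          rw [← Real.rpow_add hp]; ring_nf
        have e3 : C0 x * ((q0 - 1) * |f x| ^ (q0 - 1 - a) /
              (A x * a + B x * b * |f x| ^ (b - a))) +
            C1 x * ((q1 - 1) * |f x| ^ (q1 - 1 - a) / (A x * a + B x * b * |f x| ^ (b - a))) =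
            (C0 x * ((q0 - 1) * |f x| ^ (q0 - 1 - b)) +
              C1 x * ((q1 - 1) * |f x| ^ (q1 - 1 - b))) * |f x| ^ (b - a) /
              (A x * a + B x * b * |f x| ^ (b - a)) := by
          rw [e1, e2]; ring
        simp only [hR]
        rw [e3, div_le_div_iff₀ (by positivity) (by positivity), mul_assoc]
        refine mul_le_mul_of_nonneg_left ?_ (by positivity)
        have : 0 ≤ A x * a := by positivity
        nlinarith
  · exact ContinuousAt.add
      (hC0.continuousAt.mul (ContinuousAt.div (c1.const_mul _).continuousAt hden.continuousAt hd))
      (hC1.continuousAt.mul (ContinuousAt.div (c2.const_mul _).continuousAt hden.continuousAt hd))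

/-- The exponents of a system of the family. -/
structure Exps where
  a : ℕ → ℝ
  b : ℕ → ℝ
  q0 : ℕ → ℝ
  q1 : ℕ → ℝ

/-- The coefficients of a system of the family. -/
structure Coef where
  A : ℕ → ℝ
  B : ℕ → ℝ
  C0 : ℕ → ℝ
  C1 : ℕ → ℝ
  Dl : ℝ

/-- `a n = 0` is allowed: it is the discontinuous case of the last injection term. The bound `b_le`
makes the slopes of `⌈ξ⌋^{q-1}` nonsingular at `0`, also when `A` vanishes. -/
structure Exps.Good (e : Exps) (n : ℕ) : Prop where
  two_le : 2 ≤ n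
  a_pos : ∀ i, 1 ≤ i → i < n → 0 < e.a i
  a_nonneg : 0 ≤ e.a n
  a_le_b : ∀ i, 1 ≤ i → i ≤ n → e.a i ≤ e.b i
  b_le : ∀ i, 1 ≤ i → i ≤ n → e.b i ≤ e.q0 i - 1
  q_lt : ∀ i, 1 ≤ i → i ≤ n → e.q0 i < e.q1 i
  one_lt : 1 < e.q0 n

/-- Designed to survive both limits: in each pair one coefficient may vanish, but not both.
`C0_eq_zero` keeps the gradient continuous where `A` vanishes, and `Dl_le` says that the sign term
dominates the perturbation up to the factor `ρ`. -/
structure Coef.Good (c : Coef) (e : Exps) (n : ℕ) (ρ : ℝ) : Prop where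
  A_nonneg : ∀ i, 1 ≤ i → i ≤ n → 0 ≤ c.A i
  B_nonneg : ∀ i, 1 ≤ i → i ≤ n → 0 ≤ c.B i
  AB_pos : ∀ i, 1 ≤ i → i ≤ n → 0 < c.A i + c.B i
  C0_nonneg : ∀ i, 1 ≤ i → i ≤ n → 0 ≤ c.C0 i
  C1_nonneg : ∀ i, 1 ≤ i → i ≤ n → 0 ≤ c.C1 i
  C_pos : ∀ i, 1 ≤ i → i ≤ n → 0 < c.C0 i + c.C1 i
  C0_eq_zero : ∀ i, 1 ≤ i → i ≤ n → c.A i = 0 → c.C0 i = 0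
  Dl_nonneg : 0 ≤ c.Dl
  Dl_le : c.Dl = 0 ∨ e.a n = 0 ∧ c.Dl ≤ ρ * c.A n

theorem Exps.Good.b_pos {e : Exps} {n : ℕ} (he : e.Good n) (i : ℕ) (h1 : 1 ≤ i) (h2 : i < n) :
    0 < e.b i := (he.a_pos i h1 h2).trans_le (he.a_le_b i h1 h2.le)

theorem Exps.Good.q0_gt {e : Exps} {n : ℕ} (he : e.Good n) (i : ℕ) (h1 : 1 ≤ i) (h2 : i ≤ n) :
    1 < e.q0 i := by
  rcases h2.eq_or_lt with rfl | h
  · exact he.one_lt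
  · have := he.b_pos i h1 h
    have := he.b_le i h1 h2
    linarith

theorem Exps.Good.q1_gt {e : Exps} {n : ℕ} (he : e.Good n) (i : ℕ) (h1 : 1 ≤ i) (h2 : i ≤ n) :
    1 < e.q1 i := (he.q0_gt i h1 h2).trans (he.q_lt i h1 h2)

/-- `y ↦ ξ_i`, the inverse of the `i`-th stabilizing function. -/
def gInv (e : Exps) (c : Coef) (i : ℕ) : ℝ → ℝ := binInv (c.A i) (c.B i) (e.a i) (e.b i)

/-- The point `ξ_i` of the system with coefficients `c`. -/
def gXi (e : Exps) (c : Coef) {n : ℕ} (i : ℕ) (z : Fin n → ℝ) : ℝ :=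
  if i < n then gInv e c i (coord z (i + 1)) else 0

/-- `C₀ ⌈s⌋^{q₀-1} + C₁ ⌈s⌋^{q₁-1}`. -/
def gG (e : Exps) (c : Coef) (i : ℕ) (s : ℝ) : ℝ :=
  bin (c.C0 i) (c.C1 i) (e.q0 i - 1) (e.q1 i - 1) s

/-- The Young gap `|z|^q / q - z ⌈ξ⌋^{q-1} + (q-1)/q |ξ|^q`. -/
def gap (q z ξ : ℝ) : ℝ := 1 / q * |z| ^ q - z * spow ξ (q - 1) + (q - 1) / q * |ξ| ^ q

/-- The `i`-th term of the Lyapunov function. -/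
def gTerm (e : Exps) (c : Coef) (i : ℕ) (s ξ : ℝ) : ℝ :=
  c.C0 i * gap (e.q0 i) s ξ + c.C1 i * gap (e.q1 i) s ξ

/-- The Lyapunov function of the system with coefficients `c`. -/
def gV (e : Exps) (c : Coef) {n : ℕ} (z : Fin n → ℝ) : ℝ :=
  ∑ i ∈ Finset.Icc 1 n, gTerm e c i (coord z i) (gXi e c i z)

/-- The factor of `ξ_i - z_i` in the derivative of the `i`-th term with respect to `z_{i+1}`. -/
def gSlope (e : Exps) (c : Coef) (i : ℕ) (ξ : ℝ) : ℝ :=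
  c.C0 i * invSlope (c.A i) (c.B i) (e.a i) (e.b i) (e.q0 i) ξ +
    c.C1 i * invSlope (c.A i) (c.B i) (e.a i) (e.b i) (e.q1 i) ξ

/-- The derivative of the `i`-th term of the Lyapunov function with respect to `z_{i+1}`. -/
def gCross (e : Exps) (c : Coef) {n : ℕ} (i : ℕ) (z : Fin n → ℝ) : ℝ :=
  if 1 ≤ i ∧ i < n then gSlope e c i (gXi e c i z) * (gXi e c i z - coord z i) else 0

/-- The partial derivative of the Lyapunov function with respect to `z_i`. -/
def gGrad (e : Exps) (c : Coef) {n : ℕ} (i : ℕ) (z : Fin n → ℝ) : ℝ :=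
  gG e c i (coord z i) - gG e c i (gXi e c i z) + gCross e c (i - 1) z

/-- The composition of the first `i` stabilizing functions. -/
def gPhi (e : Exps) (c : Coef) : ℕ → ℝ → ℝ
  | 0 => id
  | i + 1 => fun s => bin (c.A (i + 1)) (c.B (i + 1)) (e.a (i + 1)) (e.b (i + 1)) (gPhi e c i s)

/-- `A |s|^a + B |s|^b`. -/
def gAbs (e : Exps) (c : Coef) (i : ℕ) (s : ℝ) : ℝ := c.A i * |s| ^ e.a i + c.B i * |s| ^ e.b i

/-- The contribution of `ż_i`, without its gain, to `-V̇`. -/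
def gT (e : Exps) (c : Coef) {n : ℕ} (i : ℕ) (z : Fin n → ℝ) : ℝ :=
  gGrad e c i z * (gPhi e c i (coord z 1) - coord z (i + 1))

/-- A continuous upper bound of the contribution of `ż_n` to `V̇`. -/
def gLast (e : Exps) (c : Coef) (K : ℝ) {n : ℕ} (z : Fin n → ℝ) : ℝ :=
  K * ((|gGrad e c n z - gG e c n (gPhi e c (n - 1) (coord z 1))| -
    |gG e c n (gPhi e c (n - 1) (coord z 1))|) * gAbs e c n (gPhi e c (n - 1) (coord z 1))) +
  c.Dl * |gGrad e c n z|

/-- A continuous upper bound of `V̇`. -/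
def gRate (e : Exps) (c : Coef) (k : ℕ → ℝ) {n : ℕ} (z : Fin n → ℝ) : ℝ :=
  gLast e c (k n) z - ∑ i ∈ Finset.Ico 1 n, k i * gT e c i z

/-! ### Continuity in the coefficients and the state -/

structure ContCoef {X : Type*} [TopologicalSpace X] (c : X → Coef) : Prop where
  A : ∀ i, Continuous fun x => (c x).A i
  B : ∀ i, Continuous fun x => (c x).B i
  C0 : ∀ i, Continuous fun x => (c x).C0 i
  C1 : ∀ i, Continuous fun x => (c x).C1 i
  Dl : Continuous fun x => (c x).Dl

theorem continuous_coord {n : ℕ} (i : ℕ) : Continuous fun z : Fin n → ℝ => coord z i := by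
  unfold coord
  split_ifs
  · exact continuous_apply _
  · exact continuous_const

section Continuity

variable {X : Type*} [TopologicalSpace X] {c : X → Coef} {e : Exps} {n : ℕ} {ρ : ℝ}

theorem ContCoef.comp {Y : Type*} [TopologicalSpace Y] (hc : ContCoef c) {f : Y → X}
    (hf : Continuous f) : ContCoef fun y => c (f y) where
  A i := (hc.A i).comp hf
  B i := (hc.B i).comp hf
  C0 i := (hc.C0 i).comp hf
  C1 i := (hc.C1 i).comp hf
  Dl := hc.Dl.comp hf

variable (hc : ContCoef c) (he : e.Good n) (hg : ∀ x, (c x).Good e n ρ)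

include hc he hg

theorem continuous_gXi {z : X → Fin n → ℝ} (hz : Continuous z) {i : ℕ} (hi : 1 ≤ i) :
    Continuous fun x => gXi e (c x) i (z x) := by
  unfold gXi
  split_ifs with h
  · exact continuous_binInv (hc.A i) (hc.B i) ((continuous_coord _).comp hz)
      (fun x => (hg x).A_nonneg i hi h.le) (fun x => (hg x).B_nonneg i hi h.le)
      (fun x => (hg x).AB_pos i hi h.le) (he.a_pos i hi h) (he.b_pos i hi h)
  · exact continuous_const

omit hg in
theorem continuous_gG {f : X → ℝ} (hf : Continuous f) {i : ℕ} (hi : 1 ≤ i) (hin : i ≤ n) :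
    Continuous fun x => gG e (c x) i (f x) := by
  have h0 := he.q0_gt i hi hin
  have h1 := he.q1_gt i hi hin
  exact continuous_bin (hc.C0 i) (hc.C1 i) hf (by linarith) (by linarith)

omit hc he hg in
theorem continuous_gap {q : ℝ} (hq : 1 < q) {f g : X → ℝ} (hf : Continuous f)
    (hg : Continuous g) : Continuous fun x => gap q (f x) (g x) := by
  have h1 := (continuous_abs_rpow (p := q) (by linarith)).comp hf
  have h2 := (continuous_abs_rpow (p := q) (by linarith)).comp hg
  have h3 := (continuous_spow (p := q - 1) (by linarith)).comp hg
  simp only [Function.comp_def] at h1 h2 h3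
  unfold gap
  fun_prop

theorem continuous_gV {z : X → Fin n → ℝ} (hz : Continuous z) :
    Continuous fun x => gV e (c x) (z x) := by
  unfold gV gTerm
  refine continuous_finsetSum _ fun i hi => ?_
  obtain ⟨h1, h2⟩ := Finset.mem_Icc.1 hi
  have hx := continuous_gXi hc he hg hz h1
  have hcz := (continuous_coord i).comp hz
  exact ((hc.C0 i).mul (continuous_gap (he.q0_gt i h1 h2) hcz hx)).add
    ((hc.C1 i).mul (continuous_gap (he.q1_gt i h1 h2) hcz hx))

theorem continuous_gCross {z : X → Fin n → ℝ} (hz : Continuous z) (i : ℕ) :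
    Continuous fun x => gCross e (c x) i (z x) := by
  unfold gCross
  split_ifs with h
  · obtain ⟨h1, h2⟩ := h
    have hx := continuous_gXi hc he hg hz h1
    refine Continuous.mul ?_ (hx.sub ((continuous_coord i).comp hz))
    exact continuous_add_invSlope (hc.A i) (hc.B i) (hc.C0 i) (hc.C1 i) hx
      (fun x => (hg x).A_nonneg i h1 h2.le) (fun x => (hg x).B_nonneg i h1 h2.le)
      (fun x => (hg x).AB_pos i h1 h2.le) (fun x => (hg x).C0_nonneg i h1 h2.le)
      (fun x => (hg x).C1_nonneg i h1 h2.le) (fun x => (hg x).C0_eq_zero i h1 h2.le)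
      (he.a_pos i h1 h2) (he.a_le_b i h1 h2.le) (he.b_le i h1 h2.le) (he.q_lt i h1 h2.le)
  · exact continuous_const

theorem continuous_gGrad {z : X → Fin n → ℝ} (hz : Continuous z) {i : ℕ} (hi : 1 ≤ i)
    (hin : i ≤ n) : Continuous fun x => gGrad e (c x) i (z x) :=
  ((continuous_gG hc he ((continuous_coord i).comp hz) hi hin).sub
    (continuous_gG hc he (continuous_gXi hc he hg hz hi) hi hin)).add
    (continuous_gCross hc he hg hz _)

omit hg in
theorem continuous_gPhi {f : X → ℝ} (hf : Continuous f) {i : ℕ} (hin : i < n) :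
    Continuous fun x => gPhi e (c x) i (f x) := by
  induction i with
  | zero => exact hf
  | succ i ih =>
    exact continuous_bin (hc.A _) (hc.B _) (ih (by omega)) (he.a_pos _ (by omega) hin)
      (he.b_pos _ (by omega) hin)

theorem continuous_gT {z : X → Fin n → ℝ} (hz : Continuous z) {i : ℕ} (hi : 1 ≤ i)
    (hin : i < n) : Continuous fun x => gT e (c x) i (z x) :=
  (continuous_gGrad hc he hg hz hi hin.le).mul
    ((continuous_gPhi hc he ((continuous_coord 1).comp hz) hin).sub
      ((continuous_coord (i + 1)).comp hz))

theorem continuous_gLast {z : X → Fin n → ℝ} (hz : Continuous z) (K : ℝ) :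
    Continuous fun x => gLast e (c x) K (z x) := by
  have hn := he.two_le
  have h1 := continuous_gGrad hc he hg hz (i := n) (by omega) le_rfl
  have h2 := continuous_gPhi hc he ((continuous_coord 1).comp hz) (i := n - 1) (by omega)
  have h3 := continuous_gG hc he h2 (i := n) (by omega) le_rfl
  have hb : 0 ≤ e.b n := he.a_nonneg.trans (he.a_le_b n (by omega) le_rfl)
  have h4 : Continuous fun x => gAbs e (c x) n (gPhi e (c x) (n - 1) (coord (z x) 1)) :=
    ((hc.A n).mul ((continuous_abs_rpow he.a_nonneg).comp h2)).add
      ((hc.B n).mul ((continuous_abs_rpow hb).comp h2))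
  have h5 := hc.Dl
  simp only [Function.comp_def] at h3
  unfold gLast
  fun_prop

theorem continuous_gRate {z : X → Fin n → ℝ} (hz : Continuous z) (k : ℕ → ℝ) :
    Continuous fun x => gRate e (c x) k (z x) := by
  refine (continuous_gLast hc he hg hz _).sub (continuous_finsetSum _ fun i hi => ?_)
  obtain ⟨h1, h2⟩ := Finset.mem_Ico.1 hi
  exact (continuous_gT hc he hg hz h1 h2).const_mul _

end Continuity

/-! ### Sign properties -/

theorem hasDerivAt_gap_left {q : ℝ} (hq : 1 < q) (s ξ : ℝ) :
    HasDerivAt (fun s => gap q s ξ) (spow s (q - 1) - spow ξ (q - 1)) s := by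
  have h := ((((hasDerivAt_abs_rpow_spow s hq).const_mul (1 / q)).sub
    ((hasDerivAt_id s).mul_const (spow ξ (q - 1)))).add_const ((q - 1) / q * |ξ| ^ q))
  refine h.congr_deriv ?_
  have : q ≠ 0 := by linarith
  field_simp

theorem gap_self {q : ℝ} (hq : 1 < q) (ξ : ℝ) : gap q ξ ξ = 0 := by
  have h : ξ * spow ξ (q - 1) = |ξ| ^ q := by
    rw [mul_comm, spow_mul_self]
    rcases eq_or_ne ξ 0 with rfl | hξ
    · simp [Real.zero_rpow (show q ≠ 0 by linarith)]
    · rw [← Real.rpow_add_one (abs_ne_zero.2 hξ)]; ring_nf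
  have : q ≠ 0 := by linarith
  rw [gap, h]
  field_simp
  ring

theorem gap_neg (q s ξ : ℝ) : gap q (-s) (-ξ) = gap q s ξ := by
  simp [gap, spow_neg_left]

/-- The gap vanishes at `s = ξ` and has positive `s`-derivative to the right of `ξ`; oddness of the
signed power gives the other side. -/
theorem gap_pos {q : ℝ} (hq : 1 < q) {s ξ : ℝ} (h : s ≠ ξ) : 0 < gap q s ξ := by
  have key : ∀ s ξ : ℝ, ξ < s → 0 < gap q s ξ := by
    intro s ξ h
    rw [← gap_self hq ξ]
    refine strictMonoOn_of_deriv_pos (convex_Ici ξ) (f := fun s => gap q s ξ) ?_ ?_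
      self_mem_Ici h.le h
    · exact fun x _ => (hasDerivAt_gap_left hq x ξ).continuousAt.continuousWithinAt
    · intro x hx
      rw [interior_Ici] at hx
      rw [(hasDerivAt_gap_left hq x ξ).deriv, sub_pos]
      exact spow_strictMono (by linarith) hx
  rcases lt_or_gt_of_ne h with h | h
  · rw [← gap_neg]; exact key _ _ (neg_lt_neg h)
  · exact key _ _ h

theorem gap_nonneg {q : ℝ} (hq : 1 < q) (s ξ : ℝ) : 0 ≤ gap q s ξ := by
  rcases eq_or_ne s ξ with rfl | h
  · rw [gap_self hq]
  · exact (gap_pos hq h).le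

theorem coord_succ {n : ℕ} (z : Fin n → ℝ) (j : Fin n) : coord z (j + 1) = z j := by
  have : 1 ≤ (j : ℕ) + 1 ∧ (j : ℕ) + 1 ≤ n := ⟨by omega, j.2⟩
  simp [coord, this]

theorem eq_zero_of_coord {n : ℕ} {z : Fin n → ℝ} (h : ∀ i, 1 ≤ i → i ≤ n → coord z i = 0) :
    z = 0 := by
  funext j
  rw [← coord_succ z j]
  exact h _ (by omega) j.2

section Sign

variable {e : Exps} {c : Coef} {n : ℕ} {ρ : ℝ}

theorem gInv_zero (he : e.Good n) (hg : c.Good e n ρ) {i : ℕ} (h1 : 1 ≤ i) (h2 : i < n) :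
    gInv e c i 0 = 0 :=
  binInv_zero (hg.A_nonneg i h1 h2.le) (hg.B_nonneg i h1 h2.le) (hg.AB_pos i h1 h2.le)
    (he.a_pos i h1 h2) (he.b_pos i h1 h2)

theorem bin_gXi (he : e.Good n) (hg : c.Good e n ρ) {i : ℕ} (h1 : 1 ≤ i) (h2 : i < n)
    (z : Fin n → ℝ) : bin (c.A i) (c.B i) (e.a i) (e.b i) (gXi e c i z) = coord z (i + 1) := by
  rw [gXi, if_pos h2]
  exact bin_binInv (hg.A_nonneg i h1 h2.le) (hg.B_nonneg i h1 h2.le) (hg.AB_pos i h1 h2.le)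
    (he.a_pos i h1 h2) (he.b_pos i h1 h2) _

/-- A state with `z_i = ξ_i` for `i < n` and `z_n = 0` is the origin. -/
theorem eq_zero_of_eq_gXi (he : e.Good n) (hg : c.Good e n ρ) {z : Fin n → ℝ}
    (h : ∀ i, 1 ≤ i → i < n → coord z i = gXi e c i z) (hn : coord z n = 0) : z = 0 := by
  have key : ∀ m, m < n → coord z (n - m) = 0 := by
    intro m
    induction m with
    | zero => intro _; simpa using hn
    | succ m ih =>
      intro hm
      have h0 := ih (by omega)
      rw [h _ (by omega) (by omega), gXi, if_pos (by omega),
        show n - (m + 1) + 1 = n - m by omega, h0]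
      exact gInv_zero he hg (by omega) (by omega)
  refine eq_zero_of_coord fun i h1 h2 => ?_
  have := key (n - i) (by omega)
  rwa [show n - (n - i) = i by omega] at this

theorem gTerm_nonneg (he : e.Good n) (hg : c.Good e n ρ) {i : ℕ} (h1 : 1 ≤ i) (h2 : i ≤ n)
    (s ξ : ℝ) : 0 ≤ gTerm e c i s ξ :=
  add_nonneg (mul_nonneg (hg.C0_nonneg i h1 h2) (gap_nonneg (he.q0_gt i h1 h2) _ _))
    (mul_nonneg (hg.C1_nonneg i h1 h2) (gap_nonneg (he.q1_gt i h1 h2) _ _))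

theorem gTerm_pos (he : e.Good n) (hg : c.Good e n ρ) {i : ℕ} (h1 : 1 ≤ i) (h2 : i ≤ n)
    {s ξ : ℝ} (h : s ≠ ξ) : 0 < gTerm e c i s ξ := by
  have p0 := gap_pos (he.q0_gt i h1 h2) h
  have p1 := gap_pos (he.q1_gt i h1 h2) h
  have c0 := hg.C0_nonneg i h1 h2
  have c1 := hg.C1_nonneg i h1 h2
  have c2 := hg.C_pos i h1 h2
  unfold gTerm
  rcases c0.eq_or_lt with h0 | h0
  · have : 0 < c.C1 i := by linarith
    rw [← h0]
    nlinarith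
  · have := mul_pos h0 p0
    have := mul_nonneg c1 p1.le
    linarith

/-- If every term vanished, then `z_n = ξ_n = 0`, and going down `ξ_{n-1} = 0 = z_{n-1}`, and so on
to `z = 0`. -/
theorem gV_pos (he : e.Good n) (hg : c.Good e n ρ) {z : Fin n → ℝ} (hz : z ≠ 0) :
    0 < gV e c z := by
  have hn := he.two_le
  have : ∃ i, 1 ≤ i ∧ i ≤ n ∧ coord z i ≠ gXi e c i z := by
    by_contra! hcon
    refine hz (eq_zero_of_eq_gXi he hg (fun i h1 h2 => hcon i h1 h2.le) ?_)
    rw [hcon n (by omega) le_rfl, gXi, if_neg (lt_irrefl _)]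
  obtain ⟨i, h1, h2, h3⟩ := this
  exact Finset.sum_pos' (fun j hj => gTerm_nonneg he hg (Finset.mem_Icc.1 hj).1
    (Finset.mem_Icc.1 hj).2 _ _) ⟨i, Finset.mem_Icc.2 ⟨h1, h2⟩, gTerm_pos he hg h1 h2 h3⟩

theorem gPhi_eq_coord (he : e.Good n) (hg : c.Good e n ρ) {z : Fin n → ℝ} {i : ℕ} (h2 : i < n)
    (h : ∀ j, 1 ≤ j → j < i + 1 → coord z j = gXi e c j z) :
    gPhi e c i (coord z 1) = coord z (i + 1) := by
  induction i with
  | zero => rfl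
  | succ i ih =>
    simp only [gPhi]
    rw [ih (by omega) (fun j hj hj' => h j hj (by omega)), h _ (by omega) (by omega)]
    exact bin_gXi he hg (by omega) h2 z

theorem gCross_eq_zero {z : Fin n → ℝ} {i : ℕ} (h : 1 ≤ i → coord z i = gXi e c i z) :
    gCross e c i z = 0 := by
  unfold gCross
  split_ifs with hi
  · rw [h hi.1, sub_self, mul_zero]
  · rfl

theorem gG_strictMono (he : e.Good n) (hg : c.Good e n ρ) {i : ℕ} (h1 : 1 ≤ i) (h2 : i ≤ n) :
    StrictMono (gG e c i) :=
  bin_strictMono (hg.C0_nonneg i h1 h2) (hg.C1_nonneg i h1 h2) (hg.C_pos i h1 h2)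
    (by linarith [he.q0_gt i h1 h2]) (by linarith [he.q1_gt i h1 h2])

theorem mul_sub_nonneg_of_strictMono {f g : ℝ → ℝ} (hf : StrictMono f) (hg : StrictMono g)
    (x y : ℝ) : 0 ≤ (f x - f y) * (g x - g y) ∧ ((f x - f y) * (g x - g y) = 0 → x = y) := by
  rcases lt_trichotomy x y with h | h | h
  · have := mul_pos_of_neg_of_neg (sub_neg.2 (hf h)) (sub_neg.2 (hg h))
    exact ⟨this.le, fun h' => absurd h' this.ne'⟩
  · simp [h]
  · have := mul_pos (sub_pos.2 (hf h)) (sub_pos.2 (hg h))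
    exact ⟨this.le, fun h' => absurd h' this.ne'⟩

/-- Under `h` the cross term from `i - 1` is zero and the composition at `z_1` reduces to the `i`-th
function at `z_i`. What remains is a product of increments between `ξ_i` and `z_i` of two increasing
functions. -/
theorem gT_sign (he : e.Good n) (hg : c.Good e n ρ) {z : Fin n → ℝ} {i : ℕ} (h1 : 1 ≤ i)
    (h2 : i < n) (h : ∀ j, 1 ≤ j → j < i → coord z j = gXi e c j z) :
    0 ≤ gT e c i z ∧ (gT e c i z = 0 → coord z i = gXi e c i z) := by
  obtain ⟨m, rfl⟩ : ∃ m, i = m + 1 := ⟨i - 1, by omega⟩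
  have hT : gT e c (m + 1) z = (gG e c (m + 1) (coord z (m + 1)) -
      gG e c (m + 1) (gXi e c (m + 1) z)) *
      (bin (c.A (m + 1)) (c.B (m + 1)) (e.a (m + 1)) (e.b (m + 1)) (coord z (m + 1)) -
        bin (c.A (m + 1)) (c.B (m + 1)) (e.a (m + 1)) (e.b (m + 1)) (gXi e c (m + 1) z)) := by
    rw [gT, gGrad, bin_gXi he hg h1 h2, Nat.add_sub_cancel,
      gCross_eq_zero (fun hm => h m hm (by omega)), add_zero]
    simp only [gPhi]
    rw [gPhi_eq_coord he hg (by omega) h]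
  rw [hT]
  exact mul_sub_nonneg_of_strictMono (gG_strictMono he hg h1 h2.le)
    (bin_strictMono (hg.A_nonneg _ h1 h2.le) (hg.B_nonneg _ h1 h2.le) (hg.AB_pos _ h1 h2.le)
      (he.a_pos _ h1 h2) (he.b_pos _ h1 h2)) _ _

theorem gAbs_pos (hn : 1 ≤ n) (hg : c.Good e n ρ) {s : ℝ} (hs : s ≠ 0) : 0 < gAbs e c n s := by
  have h := abs_pos.2 hs
  have p0 : 0 < |s| ^ e.a n := by positivity
  have p1 : 0 < |s| ^ e.b n := by positivity
  have c0 := hg.A_nonneg n hn le_rfl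
  have c1 := hg.B_nonneg n hn le_rfl
  have c2 := hg.AB_pos n hn le_rfl
  unfold gAbs
  rcases c0.eq_or_lt with h0 | h0
  · rw [← h0] at c2 ⊢
    nlinarith
  · have := mul_pos h0 p0
    have := mul_nonneg c1 p1.le
    linarith

/-- If the perturbation is present then `a n = 0`, so `|s|^0 = 1` and `gAbs` is at least `A n`. The
summand `ρ` absorbs the perturbation and `1` makes the inequality strict. -/
theorem Dl_lt (hn : 1 ≤ n) (hg : c.Good e n ρ) (hρ : 0 ≤ ρ) {s : ℝ} (hs : s ≠ 0) :
    c.Dl < (ρ + 1) * gAbs e c n s := by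
  have h := gAbs_pos hn hg hs
  rcases hg.Dl_le with h0 | ⟨h0, h1⟩
  · rw [h0]; positivity
  · have hB : 0 ≤ c.B n * |s| ^ e.b n := mul_nonneg (hg.B_nonneg n hn le_rfl) (by positivity)
    have : c.A n ≤ gAbs e c n s := by
      unfold gAbs; rw [h0, Real.rpow_zero]; linarith
    nlinarith

/-- Here the gradient component equals `G(z_n)`, with `G = gG e c n`, and the bound becomes
`|G(z_n)| (Dl - (ρ + 1) gAbs)`. -/
theorem gLast_neg (he : e.Good n) (hg : c.Good e n ρ) (hρ : 0 ≤ ρ) {z : Fin n → ℝ} (hz : z ≠ 0)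
    (h : ∀ j, 1 ≤ j → j < n → coord z j = gXi e c j z) : gLast e c (ρ + 1) z < 0 := by
  have hn := he.two_le
  have hzn : coord z n ≠ 0 := fun h0 => hz (eq_zero_of_eq_gXi he hg h h0)
  have hs : gPhi e c (n - 1) (coord z 1) = coord z n := by
    rw [gPhi_eq_coord he hg (by omega) (fun j hj hj' => h j hj (by omega)),
      show n - 1 + 1 = n by omega]
  have hG0 : gG e c n 0 = 0 := bin_zero _ _ _ _
  have hgr : gGrad e c n z = gG e c n (coord z n) := by
    rw [gGrad, gCross_eq_zero (fun h' => h _ h' (by omega)), gXi, if_neg (lt_irrefl _), hG0]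
    ring
  have hG : gG e c n (coord z n) ≠ 0 := fun h' =>
    hzn ((gG_strictMono he hg (by omega) le_rfl).injective (h'.trans hG0.symm))
  rw [gLast, hgr, hs, sub_self, abs_zero]
  have := mul_pos (abs_pos.2 hG) (sub_pos.2 (Dl_lt (by omega) hg hρ hzn))
  linarith

end Sign

/-! ### Choice of the gains by compactness -/

/-- On the compact part of `K` where `B ≥ 0`, `T` is positive, so `B / T` is bounded there by some
`C` and any gain above `C` suffices. Elsewhere `B < 0` and the term `-k T` does no harm. -/
theorem exists_gain {Y : Type*} [TopologicalSpace Y] {K : Set Y} (hK : IsCompact K) {B T : Y → ℝ}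
    (hB : Continuous B) (hT : Continuous T) (hT0 : ∀ y ∈ K, 0 ≤ T y)
    (h : ∀ y ∈ K, T y = 0 → B y < 0) : ∃ k : ℝ, 1 ≤ k ∧ ∀ y ∈ K, B y - k * T y < 0 := by
  have hN : IsCompact (K ∩ {y | 0 ≤ B y}) := hK.inter_right (isClosed_le continuous_const hB)
  have hpos : ∀ y ∈ K ∩ {y | 0 ≤ B y}, 0 < T y := fun y hy =>
    lt_of_le_of_ne (hT0 y hy.1) fun h' => absurd (h y hy.1 h'.symm) (not_lt.2 hy.2)
  obtain ⟨C, hC⟩ := hN.exists_bound_of_continuousOn (f := fun y => B y / T y)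
    (hB.continuousOn.div hT.continuousOn fun y hy => (hpos y hy).ne')
  refine ⟨max 1 (C + 1), le_max_left _ _, fun y hy => ?_⟩
  have hk1 : 1 ≤ max 1 (C + 1) := le_max_left _ _
  have hk2 : C + 1 ≤ max 1 (C + 1) := le_max_right _ _
  by_cases hy' : 0 ≤ B y
  · have h1 := hpos y ⟨hy, hy'⟩
    have h2 := (le_abs_self _).trans (hC y ⟨hy, hy'⟩)
    rw [div_le_iff₀ h1] at h2
    nlinarith
  · have := hT0 y hy
    push Not at hy'
    nlinarith

/-- Induction from the last gain to the first. When `k i` is chosen, negativity is already known on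
`E 1 ∩ ⋯ ∩ E i` with the later gains; on `E 1 ∩ ⋯ ∩ E (i-1)` the function `T i` is nonnegative and
vanishes only in `E i`, so `exists_gain` removes the constraint `E i`. -/
theorem exists_gains {Y : Type*} [TopologicalSpace Y] {K : Set Y} (hK : IsCompact K) {n : ℕ}
    {B : Y → ℝ} {T : ℕ → Y → ℝ} {E : ℕ → Set Y} (hB : Continuous B)
    (hT : ∀ i, 1 ≤ i → i < n → Continuous (T i)) (hE : ∀ i, 1 ≤ i → i < n → IsClosed (E i))
    (hTE : ∀ i, 1 ≤ i → i < n → ∀ y ∈ K, (∀ j, 1 ≤ j → j < i → y ∈ E j) →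
      0 ≤ T i y ∧ (T i y = 0 → y ∈ E i))
    (hBE : ∀ y ∈ K, (∀ j, 1 ≤ j → j < n → y ∈ E j) → B y < 0) :
    ∃ k : ℕ → ℝ, (∀ i, 1 ≤ k i) ∧ ∀ y ∈ K, B y - ∑ i ∈ Finset.Ico 1 n, k i * T i y < 0 := by
  have key : ∀ m, m < n → ∃ k : ℕ → ℝ, (∀ i, 1 ≤ k i) ∧ ∀ y ∈ K,
      (∀ j, 1 ≤ j → j < n - m → y ∈ E j) →
        B y - ∑ i ∈ Finset.Ico (n - m) n, k i * T i y < 0 := by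
    intro m
    induction m with
    | zero => exact fun _ => ⟨fun _ => 1, fun _ => le_rfl, fun y hy h => by simpa using hBE y hy h⟩
    | succ m ih =>
      intro hm
      obtain ⟨k, hk1, hk⟩ := ih (by omega)
      obtain ⟨i, hi⟩ : ∃ i, i = n - (m + 1) := ⟨_, rfl⟩
      have hi1 : 1 ≤ i := by omega
      have hin : i < n := by omega
      have him : n - m = i + 1 := by omega
      rw [him] at hk
      set M := K ∩ ⋂ j ∈ Finset.Ico 1 i, E j with hM
      have hMc : IsCompact M := hK.inter_right
        (isClosed_biInter fun j hj => hE j (Finset.mem_Ico.1 hj).1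
          ((Finset.mem_Ico.1 hj).2.trans hin))
      have hmem : ∀ y, y ∈ M ↔ y ∈ K ∧ ∀ j, 1 ≤ j → j < i → y ∈ E j := fun y => by
        simp [hM]
      have hsum : Continuous fun y => B y - ∑ j ∈ Finset.Ico (i + 1) n, k j * T j y :=
        hB.sub (continuous_finsetSum _ fun j hj => (hT j
          (by have := (Finset.mem_Ico.1 hj).1; omega) (Finset.mem_Ico.1 hj).2).const_mul _)
      obtain ⟨κ, hκ1, hκ⟩ := exists_gain hMc hsum (hT i hi1 hin)
        (fun y hy => (hTE i hi1 hin y ((hmem y).1 hy).1 ((hmem y).1 hy).2).1)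
        (fun y hy h0 => by
          obtain ⟨h1, h2⟩ := (hmem y).1 hy
          refine hk y h1 fun j hj hj' => ?_
          rcases (Nat.lt_succ_iff.1 hj').eq_or_lt with rfl | h3
          · exact (hTE j hi1 hin y h1 h2).2 h0
          · exact h2 j hj h3)
      refine ⟨Function.update k i κ, fun j => ?_, fun y hy h => ?_⟩
      · rcases eq_or_ne j i with rfl | hj
        · simpa using hκ1
        · simpa [hj] using hk1 j
      · rw [← hi] at h ⊢
        have h1 := hκ y ((hmem y).2 ⟨hy, h⟩)
        rw [Finset.sum_eq_sum_Ico_succ_bot hin, Function.update_self]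
        have h2 : ∑ j ∈ Finset.Ico (i + 1) n, Function.update k i κ j * T j y =
            ∑ j ∈ Finset.Ico (i + 1) n, k j * T j y := by
          refine Finset.sum_congr rfl fun j hj => ?_
          have := (Finset.mem_Ico.1 hj).1
          rw [Function.update_of_ne (by omega)]
        rw [h2]
        linarith
  rcases Nat.eq_zero_or_pos n with rfl | hn
  · exact ⟨fun _ => 1, fun _ => le_rfl, fun y hy => by simpa using hBE y hy (by omega)⟩
  · obtain ⟨k, hk1, hk⟩ := key (n - 1) (by omega)
    rw [show n - (n - 1) = 1 by omega] at hk
    exact ⟨k, hk1, fun y hy => hk y hy (by omega)⟩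

/-- Gains for which `V̇` is uniformly negative on the unit sphere, for a compact set of
coefficients. -/
theorem exists_gains_gRate {X : Type*} [TopologicalSpace X] {c : X → Coef} {e : Exps} {n : ℕ}
    {ρ : ℝ} (hρ : 0 ≤ ρ) (hc : ContCoef c) (he : e.Good n) (hg : ∀ x, (c x).Good e n ρ)
    {P : Set X} (hP : IsCompact P) :
    ∃ k : ℕ → ℝ, (∀ i, 1 ≤ k i) ∧ k n = ρ + 1 ∧ ∃ η > 0, ∀ x ∈ P, ∀ u : Fin n → ℝ, ‖u‖ = 1 →
      gRate e (c x) k u ≤ -η := by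
  have hc' : ContCoef fun p : X × (Fin n → ℝ) => c p.1 := hc.comp continuous_fst
  have hg' : ∀ p : X × (Fin n → ℝ), (c p.1).Good e n ρ := fun p => hg _
  have hz : Continuous fun p : X × (Fin n → ℝ) => p.2 := continuous_snd
  have hK : IsCompact (P ×ˢ Metric.sphere (0 : Fin n → ℝ) 1) := hP.prod (isCompact_sphere _ _)
  have hne : ∀ p ∈ P ×ˢ Metric.sphere (0 : Fin n → ℝ) 1, p.2 ≠ 0 := fun p hp h0 => by
    have := hp.2
    rw [h0, mem_sphere_zero_iff_norm, norm_zero] at this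
    exact zero_ne_one this
  obtain ⟨k, hk1, hk⟩ := exists_gains hK (n := n)
    (B := fun p => gLast e (c p.1) (ρ + 1) p.2) (T := fun i p => gT e (c p.1) i p.2)
    (E := fun i => {p | coord p.2 i = gXi e (c p.1) i p.2})
    (continuous_gLast hc' he hg' hz _) (fun i h1 h2 => continuous_gT hc' he hg' hz h1 h2)
    (fun i h1 _ => isClosed_eq ((continuous_coord i).comp hz) (continuous_gXi hc' he hg' hz h1))
    (fun i h1 h2 p _ h => gT_sign (z := p.2) he (hg p.1) h1 h2 h)
    (fun p hp h => gLast_neg (z := p.2) he (hg p.1) hρ (hne p hp) h)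
  have hrate : ∀ p : X × (Fin n → ℝ), gRate e (c p.1) (Function.update k n (ρ + 1)) p.2 =
      gLast e (c p.1) (ρ + 1) p.2 - ∑ i ∈ Finset.Ico 1 n, k i * gT e (c p.1) i p.2 := by
    intro p
    rw [gRate, Function.update_self]
    congr 1
    refine Finset.sum_congr rfl fun i hi => ?_
    have := (Finset.mem_Ico.1 hi).2
    rw [Function.update_of_ne (by omega)]
  refine ⟨Function.update k n (ρ + 1), fun i => ?_, by simp, ?_⟩
  · rcases eq_or_ne i n with rfl | hi
    · simpa using hρ
    · simpa [hi] using hk1 i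
  · have hcont := continuous_gRate hc' he hg' hz (Function.update k n (ρ + 1))
    rcases (P ×ˢ Metric.sphere (0 : Fin n → ℝ) 1).eq_empty_or_nonempty with h0 | h0
    · refine ⟨1, one_pos, fun x hx u hu => ?_⟩
      have : (x, u) ∈ P ×ˢ Metric.sphere (0 : Fin n → ℝ) 1 := ⟨hx, by simpa using hu⟩
      rw [h0] at this
      exact this.elim
    · have hneg : ∀ p ∈ P ×ˢ Metric.sphere (0 : Fin n → ℝ) 1,
          gRate e (c p.1) (Function.update k n (ρ + 1)) p.2 < 0 := fun p hp => by
        rw [hrate]; exact hk p hp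
      generalize Function.update k n (ρ + 1) = k' at hcont hneg
      obtain ⟨p, hp, hmax⟩ := hK.exists_isMaxOn h0 hcont.continuousOn
      refine ⟨-gRate e (c p.1) k' p.2, neg_pos.2 (hneg p hp), fun x hx u hu => ?_⟩
      have hmem : (x, u) ∈ P ×ˢ Metric.sphere (0 : Fin n → ℝ) 1 := ⟨hx, by simpa using hu⟩
      have := isMaxOn_iff.1 hmax _ hmem
      rw [neg_neg]
      exact this

/-! ### Dilations -/

/-- The dilation with factors `l_i` takes the system with coefficients `c'` to the system with
coefficients `c`; it multiplies the Lyapunov function by `L` and the vector field by `D`. -/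
structure Rescale (e : Exps) (n : ℕ) (c c' : Coef) (l : ℕ → ℝ) (L D : ℝ) : Prop where
  l_pos : ∀ i, 0 < l i
  A : ∀ i, 1 ≤ i → i ≤ n → c.A i * l i ^ e.a i = l (i + 1) * c'.A i
  B : ∀ i, 1 ≤ i → i ≤ n → c.B i * l i ^ e.b i = l (i + 1) * c'.B i
  C0 : ∀ i, 1 ≤ i → i ≤ n → c.C0 i * l i ^ e.q0 i = L * c'.C0 i
  C1 : ∀ i, 1 ≤ i → i ≤ n → c.C1 i * l i ^ e.q1 i = L * c'.C1 i
  Dl : c.Dl = l (n + 1) * c'.Dl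
  step : ∀ i, 1 ≤ i → i ≤ n → l (i + 1) = D * l i

theorem gap_mul {l : ℝ} (hl : 0 < l) (q s ξ : ℝ) : gap q (l * s) (l * ξ) = l ^ q * gap q s ξ := by
  have h : l * l ^ (q - 1) = l ^ q := by
    rw [mul_comm, ← Real.rpow_add_one hl.ne']; ring_nf
  simp only [gap, spow_mul_left hl, abs_mul, abs_of_pos hl, Real.mul_rpow hl.le (abs_nonneg _)]
  rw [← h]
  ring

/-- The slope is the derivative of a quantity of scale `L / l` with respect to a variable of scale
`l'`. -/
theorem mul_invSlope_mul {A A' B B' C C' a b q l l' L : ℝ} (hl : 0 < l) (hl' : 0 < l')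
    (hA : A * l ^ a = l' * A') (hB : B * l ^ b = l' * B') (hC : C * l ^ q = L * C') (ξ : ℝ) :
    C * invSlope A B a b q (l * ξ) = L / (l * l') * (C' * invSlope A' B' a b q ξ) := by
  have e0 : l ^ (q - 1 - a) = l ^ q / (l * l ^ a) := by
    rw [Real.rpow_sub hl, Real.rpow_sub hl, Real.rpow_one, div_div]
  have e1 : l ^ (b - a) = l ^ b / l ^ a := Real.rpow_sub hl _ _
  have hla : l ^ a ≠ 0 := (Real.rpow_pos_of_pos hl a).ne'
  have hl0 := hl.ne'
  have hl0' := hl'.ne'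
  have num : C * ((q - 1) * |l * ξ| ^ (q - 1 - a)) =
      L / (l * l ^ a) * (C' * ((q - 1) * |ξ| ^ (q - 1 - a))) := by
    rw [abs_mul, abs_of_pos hl, Real.mul_rpow hl.le (abs_nonneg _), e0]
    calc _ = (C * l ^ q) / (l * l ^ a) * ((q - 1) * |ξ| ^ (q - 1 - a)) := by ring
      _ = _ := by rw [hC]; ring
  have den : A * a + B * b * |l * ξ| ^ (b - a) =
      l' / l ^ a * (A' * a + B' * b * |ξ| ^ (b - a)) := by
    rw [abs_mul, abs_of_pos hl, Real.mul_rpow hl.le (abs_nonneg _), e1]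
    calc _ = (A * l ^ a * a + B * l ^ b * b * |ξ| ^ (b - a)) / l ^ a := by field_simp
      _ = _ := by rw [hA, hB]; ring
  rw [invSlope, invSlope, ← mul_div_assoc, ← mul_div_assoc, num, den, mul_div_mul_comm]
  congr 1
  field_simp

section Rescale

variable {e : Exps} {c c' : Coef} {n : ℕ} {ρ L D : ℝ} {l : ℕ → ℝ}

theorem Rescale.bin_mul (h : Rescale e n c c' l L D) {i : ℕ} (h1 : 1 ≤ i) (h2 : i ≤ n) (s : ℝ) :
    bin (c.A i) (c.B i) (e.a i) (e.b i) (l i * s) =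
      l (i + 1) * bin (c'.A i) (c'.B i) (e.a i) (e.b i) s := by
  rw [bin, spow_mul_left (h.l_pos i), spow_mul_left (h.l_pos i), ← mul_assoc, ← mul_assoc,
    h.A i h1 h2, h.B i h1 h2, bin]
  ring

theorem Rescale.gXi_mul (h : Rescale e n c c' l L D) (he : e.Good n) (hg : c.Good e n ρ)
    (hg' : c'.Good e n ρ) {z u : Fin n → ℝ} (hz : ∀ i, coord z i = l i * coord u i) {i : ℕ}
    (h1 : 1 ≤ i) : gXi e c i z = l i * gXi e c' i u := by
  by_cases h2 : i < n
  · apply (bin_strictMono (hg.A_nonneg i h1 h2.le) (hg.B_nonneg i h1 h2.le)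
      (hg.AB_pos i h1 h2.le) (he.a_pos i h1 h2) (he.b_pos i h1 h2)).injective
    rw [bin_gXi he hg h1 h2, h.bin_mul h1 h2.le, bin_gXi he hg' h1 h2, hz]
  · simp [gXi, h2]

theorem Rescale.gG_mul (h : Rescale e n c c' l L D) {i : ℕ} (h1 : 1 ≤ i) (h2 : i ≤ n) (s : ℝ) :
    gG e c i (l i * s) = L / l i * gG e c' i s := by
  have hl := h.l_pos i
  have h0 := h.C0 i h1 h2
  have h3 := h.C1 i h1 h2
  rw [gG, bin, spow_mul_left hl, spow_mul_left hl, Real.rpow_sub_one hl.ne',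
    Real.rpow_sub_one hl.ne', gG, bin]
  calc _ = (c.C0 i * l i ^ e.q0 i * spow s (e.q0 i - 1) +
        c.C1 i * l i ^ e.q1 i * spow s (e.q1 i - 1)) / l i := by ring
    _ = _ := by rw [h0, h3]; ring

theorem Rescale.gV_mul (h : Rescale e n c c' l L D) (he : e.Good n) (hg : c.Good e n ρ)
    (hg' : c'.Good e n ρ) {z u : Fin n → ℝ} (hz : ∀ i, coord z i = l i * coord u i) :
    gV e c z = L * gV e c' u := by
  rw [gV, gV, Finset.mul_sum]
  refine Finset.sum_congr rfl fun i hi => ?_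
  obtain ⟨h1, h2⟩ := Finset.mem_Icc.1 hi
  rw [h.gXi_mul he hg hg' hz h1, hz, gTerm, gap_mul (h.l_pos i), gap_mul (h.l_pos i), ← mul_assoc,
    ← mul_assoc, h.C0 i h1 h2, h.C1 i h1 h2, gTerm]
  ring

theorem Rescale.gCross_mul (h : Rescale e n c c' l L D) (he : e.Good n) (hg : c.Good e n ρ)
    (hg' : c'.Good e n ρ) {z u : Fin n → ℝ} (hz : ∀ i, coord z i = l i * coord u i) (i : ℕ) :
    gCross e c i z = L / l (i + 1) * gCross e c' i u := by
  unfold gCross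
  split_ifs with hi
  · obtain ⟨h1, h2⟩ := hi
    have hl := (h.l_pos i).ne'
    have hl' := (h.l_pos (i + 1)).ne'
    rw [h.gXi_mul he hg hg' hz h1, hz, gSlope,
      mul_invSlope_mul (h.l_pos i) (h.l_pos (i + 1)) (h.A i h1 h2.le) (h.B i h1 h2.le)
        (h.C0 i h1 h2.le),
      mul_invSlope_mul (h.l_pos i) (h.l_pos (i + 1)) (h.A i h1 h2.le) (h.B i h1 h2.le)
        (h.C1 i h1 h2.le), gSlope]
    field_simp
  · rw [mul_zero]

theorem Rescale.gGrad_mul (h : Rescale e n c c' l L D) (he : e.Good n) (hg : c.Good e n ρ)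
    (hg' : c'.Good e n ρ) {z u : Fin n → ℝ} (hz : ∀ i, coord z i = l i * coord u i) {i : ℕ}
    (h1 : 1 ≤ i) (h2 : i ≤ n) : gGrad e c i z = L / l i * gGrad e c' i u := by
  rw [gGrad, h.gXi_mul he hg hg' hz h1, hz, h.gG_mul h1 h2, h.gG_mul h1 h2,
    h.gCross_mul he hg hg' hz, Nat.sub_add_cancel h1, gGrad]
  ring

theorem Rescale.gPhi_mul (h : Rescale e n c c' l L D) {i : ℕ} (h2 : i ≤ n) (s : ℝ) :
    gPhi e c i (l 1 * s) = l (i + 1) * gPhi e c' i s := by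
  induction i with
  | zero => rfl
  | succ i ih => simp only [gPhi]; rw [ih (by omega), h.bin_mul (by omega) h2]

theorem Rescale.gAbs_mul (h : Rescale e n c c' l L D) {i : ℕ} (h1 : 1 ≤ i) (h2 : i ≤ n) (s : ℝ) :
    gAbs e c i (l i * s) = l (i + 1) * gAbs e c' i s := by
  rw [gAbs, abs_mul, abs_of_pos (h.l_pos i), Real.mul_rpow (h.l_pos i).le (abs_nonneg _),
    Real.mul_rpow (h.l_pos i).le (abs_nonneg _), ← mul_assoc, ← mul_assoc, h.A i h1 h2,
    h.B i h1 h2, gAbs]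
  ring

/-- The partial derivative in `z_i` scales by `L / l i` and the velocity by `l (i + 1) = D * l i`,
so every contribution scales by the same factor `L * D`. -/
theorem Rescale.gRate_mul (h : Rescale e n c c' l L D) (hL : 0 < L) (he : e.Good n)
    (hg : c.Good e n ρ) (hg' : c'.Good e n ρ) {z u : Fin n → ℝ}
    (hz : ∀ i, coord z i = l i * coord u i) (k : ℕ → ℝ) :
    gRate e c k z = L * D * gRate e c' k u := by
  have hn := he.two_le
  have hnn : n - 1 + 1 = n := by omega
  have hl := h.l_pos n
  have hstep : l (n + 1) = D * l n := h.step n (by omega) le_rfl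
  have hφ : gPhi e c (n - 1) (coord z 1) = l n * gPhi e c' (n - 1) (coord u 1) := by
    rw [hz, h.gPhi_mul (by omega), hnn]
  have hlast : gLast e c (k n) z = L * D * gLast e c' (k n) u := by
    rw [gLast, hφ, h.gGrad_mul he hg hg' hz (by omega) le_rfl, h.gG_mul (by omega) le_rfl,
      h.gAbs_mul (by omega) le_rfl, h.Dl, ← mul_sub, abs_mul, abs_mul, abs_mul,
      abs_of_pos (div_pos hL hl), hstep, gLast]
    field_simp
  have hT : ∀ i ∈ Finset.Ico 1 n, k i * gT e c i z = L * D * (k i * gT e c' i u) := by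
    intro i hi
    obtain ⟨h1, h2⟩ := Finset.mem_Ico.1 hi
    have hli := h.l_pos i
    rw [gT, h.gGrad_mul he hg hg' hz h1 h2.le, hz 1, hz (i + 1), h.gPhi_mul h2.le,
      h.step i h1 h2.le, gT]
    field_simp
  rw [gRate, hlast, Finset.sum_congr rfl hT, ← Finset.mul_sum, ← mul_sub, gRate]

end Rescale

/-! ### Differentiability of the Lyapunov function -/

theorem contDiff_one_of_hasDerivAt {f g : ℝ → ℝ} (h : ∀ x, HasDerivAt f (g x) x)
    (hg : Continuous g) : ContDiff ℝ 1 f := by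
  refine contDiff_one_iff_deriv.2 ⟨fun x => (h x).differentiableAt, ?_⟩
  rwa [show deriv f = g from funext fun x => (h x).deriv]

theorem contDiff_coord {n : ℕ} (i : ℕ) {m : WithTop ℕ∞} :
    ContDiff ℝ m fun z : Fin n → ℝ => coord z i := by
  unfold coord
  split_ifs
  · exact contDiff_apply ℝ ℝ _
  · exact contDiff_const

theorem contDiff_abs_rpow {q : ℝ} (hq : 1 < q) : ContDiff ℝ 1 fun s : ℝ => |s| ^ q :=
  contDiff_one_of_hasDerivAt (fun s => hasDerivAt_abs_rpow_spow s hq)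
    ((continuous_spow (by linarith)).const_mul q)

section Deriv

variable {e : Exps} {c : Coef} {n : ℕ} {ρ : ℝ}

theorem continuous_gInv (he : e.Good n) (hg : c.Good e n ρ) {i : ℕ} (h1 : 1 ≤ i) (h2 : i < n) :
    Continuous (gInv e c i) :=
  continuous_binInv (X := ℝ) (A := fun _ => c.A i) (B := fun _ => c.B i) continuous_const
    continuous_const continuous_id (fun _ => hg.A_nonneg i h1 h2.le)
    (fun _ => hg.B_nonneg i h1 h2.le) (fun _ => hg.AB_pos i h1 h2.le)
    (he.a_pos i h1 h2) (he.b_pos i h1 h2)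

/-- The exponent conditions that make the gap differentiable in its second variable. -/
theorem gap_exponents (he : e.Good n) {i : ℕ} (h1 : 1 ≤ i) (h2 : i < n) {q : ℝ}
    (hq : q = e.q0 i ∨ q = e.q1 i) : 1 < q ∧ e.a i ≤ q - 1 := by
  have p0 := he.q0_gt i h1 h2.le
  have p1 := he.q_lt i h1 h2.le
  have p2 := he.b_le i h1 h2.le
  have p3 := he.a_le_b i h1 h2.le
  rcases hq with rfl | rfl <;> constructor <;> linarith

theorem contDiff_gap_gXi (he : e.Good n) (hg : c.Good e n ρ) (hA : ∀ i, 1 ≤ i → i ≤ n → 0 < c.A i)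
    {i : ℕ} (h1 : 1 ≤ i) (h2 : i ≤ n) {q : ℝ} (hq : q = e.q0 i ∨ q = e.q1 i) :
    ContDiff ℝ 1 fun z : Fin n → ℝ => gap q (coord z i) (gXi e c i z) := by
  have hq1 : 1 < q := by
    rcases hq with rfl | rfl
    · exact he.q0_gt i h1 h2
    · exact he.q1_gt i h1 h2
  have c0 : ContDiff ℝ 1 fun z : Fin n → ℝ => 1 / q * |coord z i| ^ q :=
    contDiff_const.mul ((contDiff_abs_rpow hq1).comp (contDiff_coord i))
  rcases h2.eq_or_lt with rfl | h2'
  · have : ∀ z : Fin i → ℝ, gap q (coord z i) (gXi e c i z) = 1 / q * |coord z i| ^ q := by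
      intro z
      simp [gap, gXi, Real.zero_rpow (show q ≠ 0 by linarith)]
    simp_rw [this]
    exact c0
  · obtain ⟨-, hqa⟩ := gap_exponents he h1 h2' hq
    have hA0 := hA i h1 h2
    have hB0 := hg.B_nonneg i h1 h2
    have ha := he.a_pos i h1 h2'
    have hab := he.a_le_b i h1 h2
    have hs := (continuous_invSlope hA0 hB0 ha hab hqa).comp (continuous_gInv he hg h1 h2')
    have d1 : ContDiff ℝ 1 fun y => spow (gInv e c i y) (q - 1) :=
      contDiff_one_of_hasDerivAt (hasDerivAt_spow_binInv hA0 hB0 ha hab hqa) hs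
    have d2 : ContDiff ℝ 1 fun y => (q - 1) / q * |gInv e c i y| ^ q :=
      contDiff_one_of_hasDerivAt (hasDerivAt_abs_binInv_rpow hA0 hB0 ha hab hqa)
        ((continuous_gInv he hg h1 h2').mul hs)
    have e1 := d1.comp (contDiff_coord (n := n) (i + 1))
    have e2 := d2.comp (contDiff_coord (n := n) (i + 1))
    simp only [gap, gXi, if_pos h2']
    exact (c0.sub ((contDiff_coord i).mul e1)).add e2

theorem contDiff_gV (he : e.Good n) (hg : c.Good e n ρ)
    (hA : ∀ i, 1 ≤ i → i ≤ n → 0 < c.A i) : ContDiff ℝ 1 fun z : Fin n → ℝ => gV e c z := by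
  refine ContDiff.sum fun i hi => ?_
  obtain ⟨h1, h2⟩ := Finset.mem_Icc.1 hi
  exact (contDiff_const.mul (contDiff_gap_gXi he hg hA h1 h2 (Or.inl rfl))).add
    (contDiff_const.mul (contDiff_gap_gXi he hg hA h1 h2 (Or.inr rfl)))

/-- The derivative of the gap along a line. -/
theorem hasDerivAt_gap_gInv (he : e.Good n) (hg : c.Good e n ρ)
    (hA : ∀ i, 1 ≤ i → i ≤ n → 0 < c.A i) {i : ℕ} (h1 : 1 ≤ i) (h2 : i < n) {q : ℝ}
    (hq : q = e.q0 i ∨ q = e.q1 i) (x y v w : ℝ) :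
    HasDerivAt (fun t => gap q (x + t * v) (gInv e c i (y + t * w)))
      ((spow x (q - 1) - spow (gInv e c i y) (q - 1)) * v +
        invSlope (c.A i) (c.B i) (e.a i) (e.b i) q (gInv e c i y) * (gInv e c i y - x) * w) 0 := by
  obtain ⟨hq1, hqa⟩ := gap_exponents he h1 h2 hq
  have hA0 := hA i h1 h2.le
  have hB0 := hg.B_nonneg i h1 h2.le
  have ha := he.a_pos i h1 h2
  have hab := he.a_le_b i h1 h2.le
  have line : ∀ x v : ℝ, HasDerivAt (fun t : ℝ => x + t * v) v 0 := fun x v => by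
    simpa using ((hasDerivAt_id (0 : ℝ)).mul_const v).const_add x
  have hx := line x v
  have hy := line y w
  have h3 := (hasDerivAt_abs_rpow_spow x hq1).const_mul (1 / q)
  have h4 := hasDerivAt_spow_binInv hA0 hB0 ha hab hqa y
  have h5 := hasDerivAt_abs_binInv_rpow hA0 hB0 ha hab hqa y
  have ex : x = x + 0 * v := by ring
  have ey : y = y + 0 * w := by ring
  have g3 := HasDerivAt.comp_of_eq (0 : ℝ) h3 hx (by simp)
  have g4 := HasDerivAt.comp_of_eq (0 : ℝ) h4 hy (by simp)
  have g5 := HasDerivAt.comp_of_eq (0 : ℝ) h5 hy (by simp)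
  refine ((g3.sub (hx.mul g4)).add g5).congr_deriv ?_
  have hq0 : q ≠ 0 := by linarith
  simp only [Function.comp_apply, zero_mul, add_zero, gInv]
  field_simp
  ring

theorem coord_add_smul (z v : Fin n → ℝ) (t : ℝ) (i : ℕ) :
    coord (z + t • v) i = coord z i + t * coord v i := by
  unfold coord
  split_ifs <;> simp

theorem fderiv_gV (he : e.Good n) (hg : c.Good e n ρ)
    (hA : ∀ i, 1 ≤ i → i ≤ n → 0 < c.A i) (z v : Fin n → ℝ) :
    fderiv ℝ (fun z : Fin n → ℝ => gV e c z) z v =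
      ∑ i ∈ Finset.Icc 1 n, gGrad e c i z * coord v i := by
  have hn := he.two_le
  have hd : HasDerivAt (fun t : ℝ => gV e c (z + t • v))
      (fderiv ℝ (fun z : Fin n → ℝ => gV e c z) z v) 0 := by
    have h1 : HasDerivAt (fun t : ℝ => z + t • v) v 0 := by
      simpa using ((hasDerivAt_id (0 : ℝ)).smul_const v).const_add z
    have h2 := ((contDiff_gV he hg hA).differentiable one_ne_zero z).hasFDerivAt
    exact HasFDerivAt.comp_hasDerivAt_of_eq (0 : ℝ) h2 h1 (by simp)
  have hterm : ∀ i ∈ Finset.Icc 1 n, HasDerivAt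
      (fun t : ℝ => gTerm e c i (coord (z + t • v) i) (gXi e c i (z + t • v)))
      ((gG e c i (coord z i) - gG e c i (gXi e c i z)) * coord v i +
        gCross e c i z * coord v (i + 1)) 0 := by
    intro i hi
    obtain ⟨h1, h2⟩ := Finset.mem_Icc.1 hi
    rcases h2.eq_or_lt with rfl | h2'
    · have line : HasDerivAt (fun t : ℝ => coord z i + t * coord v i) (coord v i) 0 := by
        simpa using ((hasDerivAt_id (0 : ℝ)).mul_const (coord v i)).const_add (coord z i)
      have g0 := HasDerivAt.comp_of_eq (0 : ℝ)
        (hasDerivAt_gap_left (he.q0_gt i h1 h2) (coord z i) 0) line (by simp)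
      have g1 := HasDerivAt.comp_of_eq (0 : ℝ)
        (hasDerivAt_gap_left (he.q1_gt i h1 h2) (coord z i) 0) line (by simp)
      have := (g0.const_mul (c.C0 i)).add (g1.const_mul (c.C1 i))
      simp only [gTerm, gXi, lt_irrefl, if_false, gCross, and_false, coord_add_smul]
      refine this.congr_deriv ?_
      simp [gG, bin]
      ring
    · have g0 := hasDerivAt_gap_gInv he hg hA h1 h2' (Or.inl rfl) (coord z i) (coord z (i + 1))
        (coord v i) (coord v (i + 1))
      have g1 := hasDerivAt_gap_gInv he hg hA h1 h2' (Or.inr rfl) (coord z i) (coord z (i + 1))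
        (coord v i) (coord v (i + 1))
      have := (g0.const_mul (c.C0 i)).add (g1.const_mul (c.C1 i))
      simp only [gTerm, gXi, h2', if_true, gCross, h1, and_self, coord_add_smul]
      refine this.congr_deriv ?_
      simp only [gG, bin, gSlope]
      ring
  rw [hd.unique (HasDerivAt.fun_sum hterm), Finset.sum_add_distrib]
  -- The shift of index loses nothing: `gCross` is zero at both ends `0` and `n`.
  have hshift : ∑ i ∈ Finset.Icc 1 n, gCross e c i z * coord v (i + 1) =
      ∑ i ∈ Finset.Icc 1 n, gCross e c (i - 1) z * coord v i := by
    obtain ⟨m, rfl⟩ : ∃ m, n = m + 1 := ⟨n - 1, by omega⟩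
    have e1 : gCross e c (m + 1) z = 0 := by simp [gCross]
    have e2 : gCross e c 0 z = 0 := by simp [gCross]
    have hl : ∑ i ∈ Finset.Icc 1 (m + 1), gCross e c i z * coord v (i + 1) =
        ∑ i ∈ Finset.range m, gCross e c (i + 1) z * coord v (i + 1 + 1) := by
      rw [← Finset.Ico_add_one_right_eq_Icc, Finset.sum_Ico_eq_sum_range, Nat.add_sub_cancel,
        Finset.sum_range_succ, add_comm 1 m, e1, zero_mul, add_zero]
      exact Finset.sum_congr rfl fun i _ => by rw [add_comm 1 i]
    have hr : ∑ i ∈ Finset.Icc 1 (m + 1), gCross e c (i - 1) z * coord v i =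
        ∑ i ∈ Finset.range m, gCross e c (i + 1) z * coord v (i + 1 + 1) := by
      rw [← Finset.Ico_add_one_right_eq_Icc, Finset.sum_Ico_eq_sum_range, Nat.add_sub_cancel,
        Finset.sum_range_succ', add_zero, Nat.sub_self, e2, zero_mul, add_zero]
      exact Finset.sum_congr rfl fun i _ => by rw [Nat.add_sub_cancel_left, add_comm 1]
    rw [hl, hr]
  rw [hshift, ← Finset.sum_add_distrib]
  refine Finset.sum_congr rfl fun i _ => ?_
  rw [gGrad]
  ring

end Deriv

/-! ### Lyapunov functions along the solutions of a differential inclusion -/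

theorem _root_.AbsolutelyContinuousOnInterval.lipschitzOnWith_comp {E E' : Type*}
    [PseudoMetricSpace E] [PseudoMetricSpace E'] {f : ℝ → E} {g : E → E'} {a b : ℝ} {S : Set E}
    {K : NNReal} (hf : AbsolutelyContinuousOnInterval f a b) (hg : LipschitzOnWith K g S)
    (hS : ∀ t ∈ uIcc a b, f t ∈ S) : AbsolutelyContinuousOnInterval (fun t => g (f t)) a b := by
  rw [absolutelyContinuousOnInterval_iff] at hf ⊢
  intro ε hε
  -- `K + 1` instead of `K` also covers `K = 0`.
  obtain ⟨δ, hδ, h⟩ := hf (ε / (K + 1)) (by positivity)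
  refine ⟨δ, hδ, fun I hI hI' => ?_⟩
  have h1 := h I hI hI'
  rw [lt_div_iff₀ (by positivity)] at h1
  refine lt_of_le_of_lt ?_ h1
  rw [Finset.sum_mul]
  refine Finset.sum_le_sum fun i hi => ?_
  have h2 := hg.dist_le_mul _ (hS _ (hI.1 i hi).1) _ (hS _ (hI.1 i hi).2)
  have h3 : 0 ≤ dist (f (I.2 i).1) (f (I.2 i).2) := dist_nonneg
  nlinarith

theorem le_sub_of_ae_deriv_le {f f' : ℝ → ℝ} {s τ C : ℝ} (hst : s ≤ τ)
    (hf : AbsolutelyContinuousOnInterval f s τ)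
    (h : ∀ᵐ t ∂(volume.restrict (Icc s τ)), HasDerivAt f (f' t) t ∧ f' t ≤ -C) :
    f τ ≤ f s - C * (τ - s) := by
  have h1 := hf.integral_deriv_eq_sub
  have h2 : ∫ t in s..τ, deriv f t ≤ ∫ _ in s..τ, -C := by
    refine intervalIntegral.integral_mono_ae_restrict hst hf.intervalIntegrable_deriv
      intervalIntegrable_const ?_
    filter_upwards [h] with t ht
    rw [ht.1.deriv]
    exact ht.2
  rw [h1, intervalIntegral.integral_const, smul_eq_mul] at h2
  linarith

section Solutions

variable {n : ℕ} {F : ℝ → (Fin n → ℝ) → Set (Fin n → ℝ)} {Δ T : ℝ} {δ : ℝ → ℝ}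
  {z : ℝ → Fin n → ℝ} {V : (Fin n → ℝ) → ℝ}

theorem absolutelyContinuous_comp_contDiff (hV : ContDiff ℝ 1 V)
    (hz : AbsolutelyContinuousOnInterval z 0 T) :
    AbsolutelyContinuousOnInterval (fun t => V (z t)) 0 T := by
  obtain ⟨C, hC⟩ := hz.exists_bound
  obtain ⟨K, hK⟩ := (hV.contDiffOn (s := Metric.closedBall 0 C)).exists_lipschitzOnWith
    one_ne_zero (convex_closedBall _ _) (isCompact_closedBall _ _)
  exact hz.lipschitzOnWith_comp hK fun t ht => by simpa using hC t ht

/-- The function `g ∘ V ∘ z` is absolutely continuous because `C¹` functions are Lipschitz on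
compact convex sets, so an almost everywhere bound on its derivative can be integrated. The choices
`g = id`, `r ^ x` and `-r ^ (-y)` give all the estimates below. -/
theorem decrease_along (hV : ContDiff ℝ 1 V) (hδ : Admissible Δ δ) (hz : IsSolutionOn F δ T z)
    {s τ C : ℝ} (hs : 0 ≤ s) (hst : s ≤ τ) (hτ : τ ≤ T) {g g' : ℝ → ℝ}
    (hg : ∀ t ∈ Icc s τ, ContDiffAt ℝ 1 g (V (z t)))
    (hg' : ∀ t ∈ Icc s τ, HasDerivAt g (g' (V (z t))) (V (z t)))
    (h : ∀ t ∈ Icc s τ, ∀ d, |d| ≤ Δ → ∀ v ∈ F d (z t),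
      g' (V (z t)) * fderiv ℝ V (z t) v ≤ -C) :
    g (V (z τ)) ≤ g (V (z s)) - C * (τ - s) := by
  have hsub : uIcc s τ ⊆ uIcc 0 T := by
    rw [uIcc_of_le hst, uIcc_of_le (hs.trans (hst.trans hτ))]
    exact Icc_subset_Icc hs hτ
  have hac := (absolutelyContinuous_comp_contDiff hV hz.1).mono hsub
  have hcont : ContinuousOn (fun t => V (z t)) (Icc s τ) := by
    have := hac.continuousOn
    rwa [uIcc_of_le hst] at this
  set S := (fun t => V (z t)) '' Icc s τ
  have hSc : IsCompact S := isCompact_Icc.image_of_continuousOn hcont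
  have hSconv : Convex ℝ S := (isPreconnected_Icc.image _ hcont).ordConnected.convex
  have hgS : ContDiffOn ℝ 1 g S := by
    rintro _ ⟨t, ht, rfl⟩
    exact (hg t ht).contDiffWithinAt
  obtain ⟨K, hK⟩ := hgS.exists_lipschitzOnWith one_ne_zero hSconv hSc
  have hac' : AbsolutelyContinuousOnInterval (fun t => g (V (z t))) s τ :=
    hac.lipschitzOnWith_comp hK fun t ht => ⟨t, by rwa [uIcc_of_le hst] at ht, rfl⟩
  have hIcc : Icc s τ ⊆ Icc 0 T := Icc_subset_Icc hs hτ
  have hae1 := ae_mono (Measure.restrict_mono hIcc le_rfl) hz.2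
  have hae2 := ae_mono (Measure.restrict_mono (hIcc.trans Icc_subset_Ici_self) le_rfl) hδ
  refine le_sub_of_ae_deriv_le (f' := deriv fun t => g (V (z t))) hst hac' ?_
  filter_upwards [hae1, hae2, ae_restrict_mem measurableSet_Icc] with t ht1 ht2 ht
  obtain ⟨v, hv, hzv⟩ := ht1
  have hVt := ((hV.differentiable one_ne_zero (z t)).hasFDerivAt).comp_hasDerivAt t hzv
  have hgt := (hg' t ht).comp t hVt
  simp only [Function.comp_def] at hgt
  rw [hgt.deriv]
  exact ⟨hgt, h t ht _ ht2 v hv⟩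

/-- The decrease condition does not cover the origin; there `V` has its global minimum. -/
theorem IsLyapunov.fderiv_zero (hL : IsLyapunov F Δ V) : fderiv ℝ V 0 = 0 := by
  apply IsLocalMin.fderiv_eq_zero
  refine Eventually.of_forall fun x => ?_
  rcases eq_or_ne x 0 with rfl | hx
  · exact le_rfl
  · rw [hL.zero]; exact (hL.pos x hx).le

theorem IsLyapunov.fderiv_nonpos (hL : IsLyapunov F Δ V) {d : ℝ} (hd : |d| ≤ Δ) {x v : Fin n → ℝ}
    (hv : v ∈ F d x) : fderiv ℝ V x v ≤ 0 := by
  rcases eq_or_ne x 0 with rfl | hx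
  · simp [hL.fderiv_zero]
  · exact (hL.decreasing d hd x hx v hv).le

theorem IsLyapunov.antitone_along (hL : IsLyapunov F Δ V) (hδ : Admissible Δ δ)
    (hz : IsSolutionOn F δ T z) {s τ : ℝ} (hs : 0 ≤ s) (hst : s ≤ τ) (hτ : τ ≤ T) :
    V (z τ) ≤ V (z s) := by
  have := decrease_along (C := 0) (g := id) (g' := fun _ => 1) hL.contDiff hδ hz hs hst hτ
    (fun _ _ => contDiffAt_id) (fun _ _ => hasDerivAt_id _)
    (fun t _ d hd v hv => by simpa using hL.fderiv_nonpos hd hv)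
  simpa using this

/-- Outside a ball around the origin, a Lyapunov function is bounded below. -/
theorem IsLyapunov.exists_level (hL : IsLyapunov F Δ V) {ε : ℝ} (hε : 0 < ε) :
    ∃ m > 0, ∀ x, V x < m → ‖x‖ < ε := by
  have hcl : IsClosed {x : Fin n → ℝ | ε ≤ ‖x‖} := isClosed_le continuous_const continuous_norm
  rcases {x : Fin n → ℝ | ε ≤ ‖x‖}.eq_empty_or_nonempty with h0 | h0
  · refine ⟨1, one_pos, fun x _ => ?_⟩
    by_contra hx
    push Not at hx
    have : x ∈ {x : Fin n → ℝ | ε ≤ ‖x‖} := hx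
    rw [h0] at this
    exact this
  · obtain ⟨x₀, hx₀⟩ := h0
    obtain ⟨x, hx, hmin⟩ := ContinuousOn.exists_isMinOn' (f := V) hL.contDiff.continuous.continuousOn
      hcl hx₀ ((hL.radiallyUnbounded.eventually_ge_atTop _).filter_mono inf_le_left)
    have hx0 : x ≠ 0 := by
      rintro rfl
      have : ε ≤ ‖(0 : Fin n → ℝ)‖ := hx
      rw [norm_zero] at this
      linarith
    refine ⟨V x, hL.pos x hx0, fun y hy => ?_⟩
    by_contra hcon
    push Not at hcon
    exact absurd (isMinOn_iff.1 hmin y hcon) (not_le.2 hy)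

theorem IsLyapunov.exists_bound (hL : IsLyapunov F Δ V) (M : ℝ) : ∃ R, ∀ x, V x ≤ M → ‖x‖ ≤ R := by
  have h := hL.radiallyUnbounded.eventually_gt_atTop M
  obtain ⟨K, hK, hKs⟩ := mem_cocompact.1 h
  obtain ⟨R, hR⟩ := hK.isBounded.exists_norm_le
  refine ⟨R, fun x hx => hR x ?_⟩
  by_contra hxK
  exact absurd (hKs hxK) (not_lt.2 hx)

theorem IsLyapunov.exists_le_on_ball (hL : IsLyapunov F Δ V) (R : ℝ) :
    ∃ M, ∀ x, ‖x‖ ≤ R → V x ≤ M := by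
  obtain ⟨M, hM⟩ := (isCompact_closedBall (0 : Fin n → ℝ) R).exists_bound_of_continuousOn
    hL.contDiff.continuous.continuousOn
  exact ⟨M, fun x hx => (le_abs_self _).trans (hM x (by simpa using hx))⟩

/-- Global asymptotic stability from a strict Lyapunov function with a continuous decay rate. -/
theorem IsLyapunov.isGAS (hL : IsLyapunov F Δ V) (heq : ∀ d : ℝ, |d| ≤ Δ → (0 : Fin n → ℝ) ∈ F d 0)
    {W : (Fin n → ℝ) → ℝ} (hW : Continuous W) (hW0 : ∀ x, x ≠ 0 → 0 < W x)
    (hVW : ∀ d, |d| ≤ Δ → ∀ x, x ≠ 0 → ∀ v ∈ F d x, fderiv ℝ V x v ≤ -W x) : IsGAS F Δ where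
  equilibrium := heq
  stable ε hε := by
    obtain ⟨m, hm, hmε⟩ := hL.exists_level hε
    have hV0 : ∀ᶠ x in 𝓝 (0 : Fin n → ℝ), V x < m :=
      hL.contDiff.continuous.continuousAt.eventually (gt_mem_nhds (by rwa [hL.zero]))
    obtain ⟨ρ, hρ, hρm⟩ := Metric.eventually_nhds_iff.1 hV0
    refine ⟨ρ, hρ, fun δ T z hδ _ hz h0 t ht => hmε _ ?_⟩
    exact (hL.antitone_along hδ hz le_rfl ht.1 ht.2).trans_lt (hρm (by simpa using h0))
  bounded R := by
    obtain ⟨M, hM⟩ := hL.exists_le_on_ball R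
    obtain ⟨R', hR'⟩ := hL.exists_bound M
    exact ⟨R', fun δ T z hδ _ hz h0 t ht => hR' _
      ((hL.antitone_along hδ hz le_rfl ht.1 ht.2).trans (hM _ h0))⟩
  attractive R ε hε := by
    obtain ⟨m, hm, hmε⟩ := hL.exists_level hε
    obtain ⟨M, hM⟩ := hL.exists_le_on_ball R
    obtain ⟨R', hR'⟩ := hL.exists_bound M
    have hVc := hL.contDiff.continuous
    have hK : IsCompact (Metric.closedBall (0 : Fin n → ℝ) R' ∩ {x | m ≤ V x}) :=
      (isCompact_closedBall _ _).inter_right (isClosed_le continuous_const hVc)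
    have hne : ∀ x, m ≤ V x → x ≠ 0 := by
      rintro x hx rfl
      rw [hL.zero] at hx
      linarith
    obtain ⟨η, hη, hWη⟩ : ∃ η > 0, ∀ x ∈ Metric.closedBall (0 : Fin n → ℝ) R' ∩ {x | m ≤ V x},
        η ≤ W x := by
      rcases (Metric.closedBall (0 : Fin n → ℝ) R' ∩ {x | m ≤ V x}).eq_empty_or_nonempty with h | h
      · exact ⟨1, one_pos, fun x hx => by rw [h] at hx; exact hx.elim⟩
      · obtain ⟨x, hx, hmin⟩ := hK.exists_isMinOn h hW.continuousOn
        exact ⟨W x, hW0 x (hne x hx.2), fun y hy => isMinOn_iff.1 hmin y hy⟩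
    -- As long as `V ≥ m` it decreases at rate at least `η` from a value at most `M`, which is
    -- impossible for longer than `(M - m) / η`.
    refine ⟨max 0 ((M - m) / η + 1), le_max_left _ _, fun δ T z hδ _ hz h0 t ht hSt => hmε _ ?_⟩
    by_contra hcon
    push Not at hcon
    have hstay : ∀ s ∈ Icc 0 t, m ≤ V (z s) ∧ V (z s) ≤ M := fun s hs =>
      ⟨hcon.trans (hL.antitone_along hδ hz hs.1 hs.2 ht.2),
        (hL.antitone_along hδ hz le_rfl hs.1 (hs.2.trans ht.2)).trans (hM _ h0)⟩
    have h1 := decrease_along (C := η) (g := id) (g' := fun _ => 1) hL.contDiff hδ hz le_rfl ht.1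
      ht.2 (fun _ _ => contDiffAt_id) (fun _ _ => hasDerivAt_id _)
      (fun s hs d hd v hv => by
        obtain ⟨h1, h2⟩ := hstay s hs
        rw [one_mul]
        exact (hVW d hd _ (hne _ h1) v hv).trans
          (neg_le_neg (hWη _ ⟨by simpa using hR' _ h2, h1⟩)))
    have h2 : (M - m) / η + 1 ≤ t := (le_max_right _ _).trans hSt
    have h3 : M - m < η * t := by
      have : (M - m) / η < t := by linarith
      rw [div_lt_iff₀ hη] at this
      linarith
    have h4 := (hstay 0 ⟨le_rfl, ht.1⟩).2
    simp only [id, sub_zero] at h1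
    linarith

/-! ### Settling times -/

theorem settlingTime_le {z₀ : Fin n → ℝ} {τ : ℝ}
    (h : ∀ (δ : ℝ → ℝ) (z : ℝ → Fin n → ℝ), Admissible Δ δ →
      (∀ T : ℝ, 0 ≤ T → IsSolutionOn F δ T z) → z 0 = z₀ → ∀ t, 0 ≤ t → τ ≤ t → z t = 0) :
    settlingTime F Δ z₀ ≤ ENNReal.ofReal τ := by
  refine sSup_le ?_
  rintro _ ⟨δ, z, hδ, hz, h0, rfl⟩
  exact sInf_le fun t ht hτ => h δ z hδ hz h0 t ht ((ENNReal.ofReal_le_ofReal_iff ht).1 hτ)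

/-- `V ^ x` decreases at rate at least `x * η`, so it reaches zero in finite time. -/
theorem decay_low (hL : IsLyapunov F Δ V) {x η : ℝ} (hx : 0 < x)
    (hdec : ∀ d, |d| ≤ Δ → ∀ y, y ≠ 0 → ∀ v ∈ F d y, fderiv ℝ V y v ≤ -η * V y ^ (1 - x))
    (hδ : Admissible Δ δ) (hz : IsSolutionOn F δ T z) {s τ : ℝ} (hs : 0 ≤ s) (hst : s ≤ τ)
    (hτ : τ ≤ T) (hpos : 0 < V (z τ)) : x * η * (τ - s) < V (z s) ^ x := by
  have hp : ∀ t ∈ Icc s τ, 0 < V (z t) := fun t ht =>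
    hpos.trans_le (hL.antitone_along hδ hz (hs.trans ht.1) ht.2 hτ)
  have h1 := decrease_along (C := x * η) (g := fun r => r ^ x) (g' := fun r => x * r ^ (x - 1))
    hL.contDiff hδ hz hs hst hτ (fun t ht => Real.contDiffAt_rpow_const_of_ne (hp t ht).ne')
    (fun t ht => Real.hasDerivAt_rpow_const (Or.inl (hp t ht).ne')) (fun t ht d hd v hv => by
      have hV := hp t ht
      have hne : z t ≠ 0 := fun h => by rw [h, hL.zero] at hV; exact lt_irrefl _ hV
      have h2 := hdec d hd _ hne v hv
      have h3 : V (z t) ^ (x - 1) * V (z t) ^ (1 - x) = 1 := by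
        rw [← Real.rpow_add hV]; simp
      have h4 : 0 < x * V (z t) ^ (x - 1) := by positivity
      calc _ ≤ x * V (z t) ^ (x - 1) * (-η * V (z t) ^ (1 - x)) :=
            mul_le_mul_of_nonneg_left h2 h4.le
        _ = -(x * η) * (V (z t) ^ (x - 1) * V (z t) ^ (1 - x)) := by ring
        _ = -(x * η) := by rw [h3, mul_one])
  have h2 : 0 < V (z τ) ^ x := by positivity
  linarith

/-- `V ^ (-y)` grows at rate at least `y * η`. The resulting bound on `V` at time `τ` does not
depend on the initial value. -/
theorem decay_high (hL : IsLyapunov F Δ V) {y η : ℝ} (hy : 0 < y)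
    (hdec : ∀ d, |d| ≤ Δ → ∀ x, x ≠ 0 → ∀ v ∈ F d x, fderiv ℝ V x v ≤ -η * V x ^ (1 + y))
    (hδ : Admissible Δ δ) (hz : IsSolutionOn F δ T z) {s τ : ℝ} (hs : 0 ≤ s) (hst : s ≤ τ)
    (hτ : τ ≤ T) (hpos : 0 < V (z τ)) : y * η * (τ - s) < V (z τ) ^ (-y) := by
  have hp : ∀ t ∈ Icc s τ, 0 < V (z t) := fun t ht =>
    hpos.trans_le (hL.antitone_along hδ hz (hs.trans ht.1) ht.2 hτ)
  have h1 := decrease_along (C := y * η) (g := fun r => -r ^ (-y))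
    (g' := fun r => -(-y * r ^ (-y - 1)))
    hL.contDiff hδ hz hs hst hτ (fun t ht => (Real.contDiffAt_rpow_const_of_ne (hp t ht).ne').neg)
    (fun t ht => (Real.hasDerivAt_rpow_const (Or.inl (hp t ht).ne')).fun_neg)
    (fun t ht d hd v hv => by
      have hV := hp t ht
      have hne : z t ≠ 0 := fun h => by rw [h, hL.zero] at hV; exact lt_irrefl _ hV
      have h2 := hdec d hd _ hne v hv
      have h3 : V (z t) ^ (-y - 1) * V (z t) ^ (1 + y) = 1 := by
        rw [← Real.rpow_add hV, show -y - 1 + (1 + y) = 0 by ring, Real.rpow_zero]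
      have h4 : 0 < y * V (z t) ^ (-y - 1) := by positivity
      calc _ = y * V (z t) ^ (-y - 1) * fderiv ℝ V (z t) v := by ring
        _ ≤ y * V (z t) ^ (-y - 1) * (-η * V (z t) ^ (1 + y)) :=
            mul_le_mul_of_nonneg_left h2 h4.le
        _ = -(y * η) * (V (z t) ^ (-y - 1) * V (z t) ^ (1 + y)) := by ring
        _ = -(y * η) := by rw [h3, mul_one])
  have h2 : 0 < V (z s) ^ (-y) := by have := hp s ⟨le_rfl, hst⟩; positivity
  linarith

theorem IsLyapunov.eq_zero_of_not_pos (hL : IsLyapunov F Δ V) {x : Fin n → ℝ} (h : ¬0 < V x) :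
    x = 0 := by
  by_contra hx
  exact h (hL.pos x hx)

theorem settlingTime_le_low (hL : IsLyapunov F Δ V) {x η : ℝ} (hx : 0 < x) (hη : 0 < η)
    (hdec : ∀ d, |d| ≤ Δ → ∀ y, y ≠ 0 → ∀ v ∈ F d y, fderiv ℝ V y v ≤ -η * V y ^ (1 - x))
    (z₀ : Fin n → ℝ) : settlingTime F Δ z₀ ≤ ENNReal.ofReal (V z₀ ^ x / (x * η)) := by
  refine settlingTime_le fun δ z hδ hz h0 t ht hτ => hL.eq_zero_of_not_pos fun hpos => ?_
  have h1 := decay_low hL hx hdec hδ (hz t ht) le_rfl ht le_rfl hpos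
  rw [h0, sub_zero] at h1
  rw [div_le_iff₀ (by positivity)] at hτ
  linarith

/-- The level `r` is free: the first summand bounds the time to get below `V = r` from any state,
the second the time from there to the origin. -/
theorem settlingTime_le_uniform (hL : IsLyapunov F Δ V) {x y η η' r : ℝ} (hx : 0 < x) (hy : 0 < y)
    (hη : 0 < η) (hη' : 0 < η') (hr : 0 < r)
    (hdec : ∀ d, |d| ≤ Δ → ∀ w, w ≠ 0 → ∀ v ∈ F d w, fderiv ℝ V w v ≤ -η * V w ^ (1 - x))
    (hdec' : ∀ d, |d| ≤ Δ → ∀ w, w ≠ 0 → ∀ v ∈ F d w, fderiv ℝ V w v ≤ -η' * V w ^ (1 + y))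
    (z₀ : Fin n → ℝ) :
    settlingTime F Δ z₀ ≤ ENNReal.ofReal (r ^ (-y) / (y * η') + r ^ x / (x * η)) := by
  refine settlingTime_le fun δ z hδ hz h0 t ht hτ => hL.eq_zero_of_not_pos fun hpos => ?_
  set s := r ^ (-y) / (y * η') with hs
  have hs0 : 0 < s := by positivity
  have hst : s ≤ t := by
    have : 0 < r ^ x / (x * η) := by positivity
    linarith
  have hVs : 0 < V (z s) := hpos.trans_le (hL.antitone_along hδ (hz t ht) hs0.le hst le_rfl)
  have h1 := decay_high hL hy hdec' hδ (hz t ht) le_rfl hs0.le hst hVs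
  have h2 := decay_low hL hx hdec hδ (hz t ht) hs0.le hst le_rfl hpos
  have h3 : r ^ (-y) < V (z s) ^ (-y) := by
    refine lt_of_le_of_lt (le_of_eq ?_) h1
    rw [hs]
    field_simp
    ring
  have h4 : V (z s) < r := (Real.rpow_lt_rpow_iff_of_neg hr hVs (by linarith)).1 h3
  have h5 : V (z s) ^ x < r ^ x := Real.rpow_lt_rpow hVs.le h4 hx
  have h6 : r ^ x / (x * η) ≤ t - s := by linarith
  rw [div_le_iff₀ (by positivity)] at h6
  linarith

end Solutions

/-! ### The family associated with the differentiator -/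

/-- The standing assumptions on the parameters of the differentiator. -/
structure Hyp (n : ℕ) (d0 dinf : ℝ) (κ θ : ℕ → ℝ) (Δ p0 pinf : ℝ) (β0 βinf : ℕ → ℝ) : Prop where
  two_le : 2 ≤ n
  neg_one_le : -1 ≤ d0
  d_le : d0 ≤ dinf
  d_lt : dinf < 1 / ((n : ℝ) - 1)
  κ_pos : ∀ i ∈ Finset.Icc 1 n, 0 < κ i
  θ_pos : ∀ i ∈ Finset.Icc 1 n, 0 < θ i
  Δ_nonneg : 0 ≤ Δ
  Δ_eq_zero : d0 ≠ -1 → Δ = 0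
  p0_pos : 0 < p0
  pinf_pos : 0 < pinf
  p0_ge : ∀ i ∈ Finset.Icc 1 n, wt n d0 i / wt n dinf i * (2 * wt n dinf i + dinf) ≤ p0
  p_lt : ∀ i ∈ Finset.Icc 1 n, p0 / wt n d0 i < pinf / wt n dinf i
  β0_pos : ∀ i ∈ Finset.Icc 1 n, 0 < β0 i
  βinf_pos : ∀ i ∈ Finset.Icc 1 n, 0 < βinf i

/-- The exponents of the differentiator. -/
def diffExps (n : ℕ) (d0 dinf p0 pinf : ℝ) : Exps where
  a i := wt n d0 (i + 1) / wt n d0 i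
  b i := wt n dinf (i + 1) / wt n dinf i
  q0 i := p0 / wt n d0 i
  q1 i := pinf / wt n dinf i

/-- The dilation parameter of the `0`-limit. -/
def lo (t : ℝ) : ℝ := max 0 (min 1 t)

/-- The inverse of the dilation parameter of the `∞`-limit. -/
def hi (t : ℝ) : ℝ := max 0 (min 1 (2 - t))

/-- The coefficients of the dilated systems: `t = 1` is the differentiator itself, `t = 0` its
`0`-limit and `t = 2` its `∞`-limit. -/
def diffCoef (n : ℕ) (d0 dinf : ℝ) (κ θ : ℕ → ℝ) (Δ p0 pinf : ℝ) (β0 βinf : ℕ → ℝ) (t : ℝ) :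
    Coef where
  A i := κ i * hi t ^ |wt n dinf i * (wt n dinf (i + 1) / wt n dinf i - wt n d0 (i + 1) / wt n d0 i)|
  B i := θ i * lo t ^ |wt n d0 i * (wt n dinf (i + 1) / wt n dinf i - wt n d0 (i + 1) / wt n d0 i)|
  C0 i := β0 i * hi t ^ |wt n dinf i * (pinf / wt n dinf i - p0 / wt n d0 i)|
  C1 i := βinf i * lo t ^ |wt n d0 i * (pinf / wt n dinf i - p0 / wt n d0 i)|
  Dl := Δ * hi t ^ |1 + dinf|

theorem lo_nonneg (t : ℝ) : 0 ≤ lo t := le_max_left _ _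

theorem hi_nonneg (t : ℝ) : 0 ≤ hi t := le_max_left _ _

theorem lo_of_mem {t : ℝ} (h0 : 0 ≤ t) (h1 : t ≤ 1) : lo t = t := by
  rw [lo, min_eq_right h1, max_eq_right h0]

theorem lo_of_one_le {t : ℝ} (h1 : 1 ≤ t) : lo t = 1 := by
  rw [lo, min_eq_left h1, max_eq_right zero_le_one]

theorem hi_of_mem {t : ℝ} (h0 : 1 ≤ t) (h1 : t ≤ 2) : hi t = 2 - t := by
  rw [hi, min_eq_right (by linarith), max_eq_right (by linarith)]

theorem hi_of_le_one {t : ℝ} (h1 : t ≤ 1) : hi t = 1 := by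
  rw [hi, min_eq_left (by linarith), max_eq_right zero_le_one]

theorem hi_or_lo (t : ℝ) : hi t = 1 ∨ lo t = 1 :=
  (le_total t 1).imp hi_of_le_one lo_of_one_le

theorem wt_succ (n : ℕ) (d : ℝ) (i : ℕ) : wt n d (i + 1) = wt n d i + d := by
  unfold wt; push_cast; ring

theorem wt_self (n : ℕ) (d : ℝ) : wt n d n = 1 := by simp [wt]

theorem wt_pos {n : ℕ} {d : ℝ} (hn : 2 ≤ n) (hd : d < 1 / ((n : ℝ) - 1)) {i : ℕ} (h1 : 1 ≤ i)
    (h2 : i ≤ n) : 0 < wt n d i := by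
  have hn' : (2 : ℝ) ≤ n := by exact_mod_cast hn
  have h1' : (1 : ℝ) ≤ i := by exact_mod_cast h1
  have h2' : (i : ℝ) ≤ n := by exact_mod_cast h2
  rw [lt_div_iff₀ (by linarith)] at hd
  unfold wt
  rcases le_total d 0 with h | h
  · nlinarith
  · nlinarith

theorem continuous_lo : Continuous lo := by unfold lo; fun_prop

theorem continuous_hi : Continuous hi := by unfold hi; fun_prop

section Diff

variable {n : ℕ} {d0 dinf : ℝ} {κ θ : ℕ → ℝ} {Δ p0 pinf : ℝ} {β0 βinf : ℕ → ℝ}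

/-- The absolute values in the exponents of `diffCoef` make this true without hypotheses; under
`Hyp` the quantities inside them are nonnegative. -/
theorem contCoef_diffCoef : ContCoef (diffCoef n d0 dinf κ θ Δ p0 pinf β0 βinf) := by
  have key : ∀ (f : ℝ → ℝ) (_ : Continuous f) (x y : ℝ), Continuous fun t => x * f t ^ |y| :=
    fun f hf x y => ((Real.continuous_rpow_const (abs_nonneg y)).comp hf).const_mul x
  exact ⟨fun i => key hi continuous_hi _ _, fun i => key lo continuous_lo _ _,
    fun i => key hi continuous_hi _ _, fun i => key lo continuous_lo _ _,
    key hi continuous_hi _ _⟩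

variable (H : Hyp n d0 dinf κ θ Δ p0 pinf β0 βinf)

include H

theorem Hyp.wt0_pos {i : ℕ} (h1 : 1 ≤ i) (h2 : i ≤ n) : 0 < wt n d0 i :=
  wt_pos H.two_le (H.d_le.trans_lt H.d_lt) h1 h2

theorem Hyp.wtinf_pos {i : ℕ} (h1 : 1 ≤ i) (h2 : i ≤ n) : 0 < wt n dinf i :=
  wt_pos H.two_le H.d_lt h1 h2

/-- After clearing denominators the terms `(n - i) * d0 * dinf` cancel and `d0 ≤ dinf` remains. -/
theorem Hyp.a_le_b {i : ℕ} (h1 : 1 ≤ i) (h2 : i ≤ n) :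
    wt n d0 (i + 1) / wt n d0 i ≤ wt n dinf (i + 1) / wt n dinf i := by
  have h3 := H.wt0_pos h1 h2
  have h4 := H.wtinf_pos h1 h2
  rw [wt_succ, wt_succ, div_le_div_iff₀ h3 h4]
  have h5 := H.d_le
  unfold wt
  nlinarith

/-- The bound on `p0` at index `n - 1`, where `2 r_∞ + d_∞ = r_∞ + 1`, reads `p0 ≥ r_0 + r_0 / r_∞`.
Here `r_0 = 1 - d0`, and `r_0 ≥ r_∞` by `Hyp.a_le_b`. -/
theorem Hyp.two_sub_le : 2 - d0 ≤ p0 := by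
  have hn := H.two_le
  have h1 := H.wt0_pos (i := n - 1) (by omega) (by omega)
  have h2 := H.wtinf_pos (i := n - 1) (by omega) (by omega)
  have h3 := H.p0_ge (n - 1) (Finset.mem_Icc.2 ⟨by omega, by omega⟩)
  have h4 := H.a_le_b (i := n - 1) (by omega) (by omega)
  have e1 := wt_succ n d0 (n - 1)
  have e2 := wt_succ n dinf (n - 1)
  rw [show n - 1 + 1 = n by omega] at h4 e1 e2
  rw [wt_self] at e1 e2
  rw [wt_self, wt_self, div_le_div_iff₀ h1 h2] at h4
  rw [div_mul_eq_mul_div, div_le_iff₀ h2] at h3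
  have e3 : 2 * wt n dinf (n - 1) + dinf = wt n dinf (n - 1) + 1 := by linarith
  rw [e3] at h3
  refine le_of_mul_le_mul_right (le_trans (le_of_eq ?_) (le_trans (?_ : (wt n d0 (n - 1) + 1) *
    wt n dinf (n - 1) ≤ _) h3)) h2
  · rw [show 2 - d0 = wt n d0 (n - 1) + 1 by linarith]
  · linarith

theorem Hyp.p0_lt_pinf : p0 < pinf := by
  have hn := H.two_le
  have := H.p_lt n (Finset.mem_Icc.2 ⟨by omega, le_rfl⟩)
  simpa [wt_self] using this

theorem Hyp.d0_lt_one : d0 < 1 := by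
  have hn' : (2 : ℝ) ≤ n := by exact_mod_cast H.two_le
  have h := H.d_le.trans_lt H.d_lt
  rw [lt_div_iff₀ (by linarith)] at h
  by_contra hcon
  push Not at hcon
  nlinarith

theorem Hyp.one_lt_p0 : 1 < p0 := by
  have := H.two_sub_le
  have := H.d0_lt_one
  linarith

theorem Hyp.p0_add_pos : 0 < p0 + d0 := by
  have := H.one_lt_p0
  have := H.neg_one_le
  linarith

theorem Hyp.pinf_add_pos : 0 < pinf + dinf := by
  have := H.one_lt_p0
  have := H.neg_one_le
  have := H.p0_lt_pinf
  have := H.d_le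
  linarith

theorem Hyp.goodExps : (diffExps n d0 dinf p0 pinf).Good n where
  two_le := H.two_le
  a_pos i h1 h2 := div_pos (H.wt0_pos (by omega) (by omega)) (H.wt0_pos h1 h2.le)
  a_nonneg := by
    simp only [diffExps]
    rw [wt_succ, wt_self]
    have := H.neg_one_le
    rw [div_one]
    linarith
  a_le_b i h1 h2 := H.a_le_b h1 h2
  -- Divided by `r_{0,i}`, the lower bound on `p0` is exactly `1 + b i ≤ q0 i`.
  b_le i h1 h2 := by
    have h3 := H.wt0_pos h1 h2
    have h4 := H.wtinf_pos h1 h2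
    have h5 := H.p0_ge i (Finset.mem_Icc.2 ⟨h1, h2⟩)
    simp only [diffExps]
    rw [wt_succ, le_sub_iff_add_le, le_div_iff₀ h3]
    refine le_trans (le_of_eq ?_) h5
    field_simp
    ring
  q_lt i h1 h2 := H.p_lt i (Finset.mem_Icc.2 ⟨h1, h2⟩)
  one_lt := by
    simp only [diffExps]
    rw [wt_self, div_one]
    exact H.one_lt_p0

theorem Hyp.exponent_nonneg {i : ℕ} (h1 : 1 ≤ i) (h2 : i ≤ n) {r : ℝ} (hr : 0 < r) :
    0 ≤ r * (wt n dinf (i + 1) / wt n dinf i - wt n d0 (i + 1) / wt n d0 i) :=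
  mul_nonneg hr.le (sub_nonneg.2 (H.a_le_b h1 h2))

theorem Hyp.exponent_pos {i : ℕ} (h1 : 1 ≤ i) (h2 : i ≤ n) {r : ℝ} (hr : 0 < r) :
    0 < r * (pinf / wt n dinf i - p0 / wt n d0 i) :=
  mul_pos hr (sub_pos.2 (H.p_lt i (Finset.mem_Icc.2 ⟨h1, h2⟩)))

theorem Hyp.one_add_dinf_nonneg : 0 ≤ 1 + dinf := by
  have := H.neg_one_le
  have := H.d_le
  linarith

/-- At every `t` one of `hi t`, `lo t` equals `1`, so no pair of coefficients degenerates
completely. -/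
theorem Hyp.goodCoef (t : ℝ) : (diffCoef n d0 dinf κ θ Δ p0 pinf β0 βinf t).Good
    (diffExps n d0 dinf p0 pinf) n (Δ / κ n) := by
  have hn := H.two_le
  have hκ : ∀ i, 1 ≤ i → i ≤ n → 0 < κ i := fun i h1 h2 => H.κ_pos i (Finset.mem_Icc.2 ⟨h1, h2⟩)
  have hθ : ∀ i, 1 ≤ i → i ≤ n → 0 < θ i := fun i h1 h2 => H.θ_pos i (Finset.mem_Icc.2 ⟨h1, h2⟩)
  have hβ0 : ∀ i, 1 ≤ i → i ≤ n → 0 < β0 i :=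
    fun i h1 h2 => H.β0_pos i (Finset.mem_Icc.2 ⟨h1, h2⟩)
  have hβ1 : ∀ i, 1 ≤ i → i ≤ n → 0 < βinf i :=
    fun i h1 h2 => H.βinf_pos i (Finset.mem_Icc.2 ⟨h1, h2⟩)
  have hhi := hi_nonneg t
  have hlo := lo_nonneg t
  have sum_pos : ∀ x y : ℝ, 0 < x → 0 < y → ∀ u v : ℝ, 0 < x * hi t ^ |u| + y * lo t ^ |v| := by
    intro x y hx hy u v
    rcases hi_or_lo t with h | h <;> rw [h, Real.one_rpow, mul_one]
    · have : 0 ≤ y * lo t ^ |v| := by positivity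
      linarith
    · have : 0 ≤ x * hi t ^ |u| := by positivity
      linarith
  refine ⟨fun i h1 h2 => ?_, fun i h1 h2 => ?_, fun i h1 h2 => ?_, fun i h1 h2 => ?_,
    fun i h1 h2 => ?_, fun i h1 h2 => ?_, fun i h1 h2 h => ?_, ?_, ?_⟩
  · exact mul_nonneg (hκ i h1 h2).le (Real.rpow_nonneg hhi _)
  · exact mul_nonneg (hθ i h1 h2).le (Real.rpow_nonneg hlo _)
  · exact sum_pos _ _ (hκ i h1 h2) (hθ i h1 h2) _ _
  · exact mul_nonneg (hβ0 i h1 h2).le (Real.rpow_nonneg hhi _)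
  · exact mul_nonneg (hβ1 i h1 h2).le (Real.rpow_nonneg hlo _)
  · exact sum_pos _ _ (hβ0 i h1 h2) (hβ1 i h1 h2) _ _
  -- `A i` can vanish only if `hi t = 0`; the exponent of `hi t` in `C0 i` is strictly positive, so
  -- `C0 i` vanishes as well.
  · have h0 : hi t = 0 :=
      ((Real.rpow_eq_zero_iff_of_nonneg hhi).1
        ((mul_eq_zero.1 h).resolve_left (hκ i h1 h2).ne')).1
    have := H.exponent_pos h1 h2 (H.wtinf_pos h1 h2)
    simp only [diffCoef]
    rw [h0, Real.zero_rpow (abs_pos.2 this.ne').ne', mul_zero]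
  · exact mul_nonneg H.Δ_nonneg (Real.rpow_nonneg hhi _)
  · by_cases hd : d0 = -1
    -- For `d0 = -1` the factors of `Dl` and `A n` are the same power `|1 + dinf|` of `hi t`, so the
    -- ratio is always `Δ / κ n`.
    · right
      have ha : wt n d0 (n + 1) / wt n d0 n = 0 := by rw [wt_succ, wt_self, hd]; simp
      refine ⟨ha, le_of_eq ?_⟩
      simp only [diffCoef]
      rw [ha, wt_succ, wt_self, div_one, one_mul, sub_zero, ← mul_assoc,
        div_mul_cancel₀ _ (hκ n (by omega) le_rfl).ne']
    · left
      simp [diffCoef, H.Δ_eq_zero hd]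

/-- The dilations of the `0`-limit. -/
theorem Hyp.rescale_zero {t t' r : ℝ} (hr : 0 < r) (ht : hi t = 1) (ht' : hi t' = 1)
    (hlo : lo t' = r * lo t) :
    Rescale (diffExps n d0 dinf p0 pinf) n (diffCoef n d0 dinf κ θ Δ p0 pinf β0 βinf t)
      (diffCoef n d0 dinf κ θ Δ p0 pinf β0 βinf t') (fun i => r ^ wt n d0 i) (r ^ p0) (r ^ d0) where
  l_pos i := Real.rpow_pos_of_pos hr _
  A i h1 h2 := by
    have := (H.wt0_pos h1 h2).ne'
    simp only [diffCoef, diffExps]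
    rw [ht, ht', Real.one_rpow, mul_one, ← Real.rpow_mul hr.le, mul_div_cancel₀ _ this, mul_comm]
  B i h1 h2 := by
    have h3 := (H.wt0_pos h1 h2).ne'
    simp only [diffCoef, diffExps]
    rw [hlo, Real.mul_rpow hr.le (lo_nonneg t),
      abs_of_nonneg (H.exponent_nonneg h1 h2 (H.wt0_pos h1 h2)), ← Real.rpow_mul hr.le,
      mul_sub, mul_div_cancel₀ _ h3, Real.rpow_sub hr]
    have := (Real.rpow_pos_of_pos hr (wt n d0 (i + 1))).ne'
    field_simp
  C0 i h1 h2 := by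
    have := (H.wt0_pos h1 h2).ne'
    simp only [diffCoef, diffExps]
    rw [ht, ht', Real.one_rpow, mul_one, ← Real.rpow_mul hr.le, mul_div_cancel₀ _ this, mul_comm]
  C1 i h1 h2 := by
    have h3 := (H.wt0_pos h1 h2).ne'
    simp only [diffCoef, diffExps]
    rw [hlo, Real.mul_rpow hr.le (lo_nonneg t),
      abs_of_pos (H.exponent_pos h1 h2 (H.wt0_pos h1 h2)), ← Real.rpow_mul hr.le,
      mul_sub, mul_div_cancel₀ _ h3, Real.rpow_sub hr]
    have := (Real.rpow_pos_of_pos hr p0).ne'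
    field_simp
  Dl := by
    simp only [diffCoef]
    rw [ht, ht', Real.one_rpow, mul_one]
    -- For `d0 = -1` the weight of index `n + 1` is `1 + d0 = 0`: the dilation leaves the
    -- perturbation bound unchanged.
    by_cases hd : d0 = -1
    · rw [wt_succ, wt_self, hd]; simp
    · rw [H.Δ_eq_zero hd, mul_zero]
  step i _ _ := by
    rw [wt_succ, Real.rpow_add hr, mul_comm]

/-- The dilations of the `∞`-limit. -/
theorem Hyp.rescale_infty {t t' r : ℝ} (hr : 0 < r) (ht : lo t = 1) (ht' : lo t' = 1)
    (hhi : hi t = r * hi t') :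
    Rescale (diffExps n d0 dinf p0 pinf) n (diffCoef n d0 dinf κ θ Δ p0 pinf β0 βinf t)
      (diffCoef n d0 dinf κ θ Δ p0 pinf β0 βinf t') (fun i => r ^ wt n dinf i) (r ^ pinf)
      (r ^ dinf) where
  l_pos i := Real.rpow_pos_of_pos hr _
  A i h1 h2 := by
    have h3 := (H.wtinf_pos h1 h2).ne'
    simp only [diffCoef, diffExps]
    rw [hhi, Real.mul_rpow hr.le (hi_nonneg t'),
      abs_of_nonneg (H.exponent_nonneg h1 h2 (H.wtinf_pos h1 h2)), ← Real.rpow_mul hr.le,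
      mul_sub, mul_div_cancel₀ _ h3, Real.rpow_sub hr]
    have := (Real.rpow_pos_of_pos hr (wt n dinf i * (wt n d0 (i + 1) / wt n d0 i))).ne'
    field_simp
  B i h1 h2 := by
    have := (H.wtinf_pos h1 h2).ne'
    simp only [diffCoef, diffExps]
    rw [ht, ht', Real.one_rpow, mul_one, ← Real.rpow_mul hr.le, mul_div_cancel₀ _ this, mul_comm]
  C0 i h1 h2 := by
    have h3 := (H.wtinf_pos h1 h2).ne'
    simp only [diffCoef, diffExps]
    rw [hhi, Real.mul_rpow hr.le (hi_nonneg t'),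
      abs_of_pos (H.exponent_pos h1 h2 (H.wtinf_pos h1 h2)), ← Real.rpow_mul hr.le,
      mul_sub, mul_div_cancel₀ _ h3, Real.rpow_sub hr]
    have := (Real.rpow_pos_of_pos hr (wt n dinf i * (p0 / wt n d0 i))).ne'
    field_simp
  C1 i h1 h2 := by
    have := (H.wtinf_pos h1 h2).ne'
    simp only [diffCoef, diffExps]
    rw [ht, ht', Real.one_rpow, mul_one, ← Real.rpow_mul hr.le, mul_div_cancel₀ _ this, mul_comm]
  Dl := by
    simp only [diffCoef]
    rw [hhi, Real.mul_rpow hr.le (hi_nonneg t'), abs_of_nonneg H.one_add_dinf_nonneg, wt_succ,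
      wt_self]
    ring
  step i _ _ := by
    rw [wt_succ, Real.rpow_add hr, mul_comm]

end Diff

/-! ### Polar coordinates for dilations -/

theorem coord_dilation {n : ℕ} (d r : ℝ) (z : Fin n → ℝ) (i : ℕ) :
    coord (dilation (wtVec n d) r z) i = r ^ wt n d i * coord z i := by
  unfold coord
  split_ifs with h
  · simp only [dilation, wtVec]
    rw [Nat.sub_add_cancel h.1]
  · simp

/-- Every nonzero state is a dilation of a state of norm one. -/
theorem exists_dilation {n : ℕ} {d : ℝ} (hw : ∀ i, 1 ≤ i → i ≤ n → 0 < wt n d i) {z : Fin n → ℝ}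
    (hz : z ≠ 0) : ∃ (r : ℝ) (u : Fin n → ℝ), 0 < r ∧ ‖u‖ = 1 ∧
      (∀ i, coord z i = r ^ wt n d i * coord u i) ∧ (‖z‖ ≤ 1 → r ≤ 1) ∧ (1 ≤ ‖z‖ → 1 ≤ r) := by
  have hw' : ∀ j : Fin n, 0 < wtVec n d j := fun j => by
    have := hw (j + 1) (by omega) j.2
    simpa [wtVec] using this
  obtain ⟨j₁, hj₁⟩ := Function.ne_iff.1 hz
  have : Nonempty (Fin n) := ⟨j₁⟩
  -- The dilation factor is the homogeneous norm `max_j |z_j|^(1/r_j)`; its maximizing index makes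
  -- the sup norm of the dilated vector equal to one.
  obtain ⟨j₀, hj₀⟩ := Finite.exists_max fun j : Fin n => |z j| ^ (1 / wtVec n d j)
  set r := |z j₀| ^ (1 / wtVec n d j₀) with hr
  have hrpos : 0 < r := lt_of_lt_of_le (Real.rpow_pos_of_pos (abs_pos.2 hj₁) _) (hj₀ j₁)
  have hle : ∀ j, |z j| ≤ r ^ wtVec n d j := fun j => by
    have h1 := Real.rpow_le_rpow (by positivity) (hj₀ j) (hw' j).le
    rwa [← Real.rpow_mul (abs_nonneg _), one_div_mul_cancel (hw' j).ne', Real.rpow_one] at h1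
  have heq : |z j₀| = r ^ wtVec n d j₀ := by
    rw [hr, ← Real.rpow_mul (abs_nonneg _), one_div_mul_cancel (hw' j₀).ne', Real.rpow_one]
  have hzd : z = dilation (wtVec n d) r fun j => z j / r ^ wtVec n d j := by
    funext j
    have := (Real.rpow_pos_of_pos hrpos (wtVec n d j)).ne'
    simp only [dilation]
    field_simp
  refine ⟨r, fun j => z j / r ^ wtVec n d j, hrpos, ?_, fun i => ?_, fun h => ?_, fun h => ?_⟩
  · refine le_antisymm ((pi_norm_le_iff_of_nonneg zero_le_one).2 fun j => ?_) ?_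
    · have hp := Real.rpow_pos_of_pos hrpos (wtVec n d j)
      rw [Real.norm_eq_abs, abs_div, abs_of_pos hp, div_le_one hp]
      exact hle j
    · refine le_trans (le_of_eq ?_) (norm_le_pi_norm _ j₀)
      have hp := Real.rpow_pos_of_pos hrpos (wtVec n d j₀)
      rw [Real.norm_eq_abs, abs_div, abs_of_pos hp, heq, div_self hp.ne']
  · conv_lhs => rw [hzd]
    exact coord_dilation d r _ i
  · have h1 : |z j₀| ≤ 1 := (norm_le_pi_norm z j₀).trans h
    exact Real.rpow_le_one (abs_nonneg _) h1 (one_div_pos.2 (hw' j₀)).le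
  · by_contra hcon
    push Not at hcon
    have : ‖z‖ < 1 := (pi_norm_lt_iff one_pos).2 fun j =>
      (hle j).trans_lt (Real.rpow_lt_one hrpos.le hcon (hw' j))
    linarith

/-! ### The differentiator as a member of the family -/

section Bridge

variable {n : ℕ} {d0 dinf : ℝ} {κ θ : ℕ → ℝ} {Δ p0 pinf : ℝ} {β0 βinf : ℕ → ℝ}

theorem lo_one : lo 1 = 1 := lo_of_one_le le_rfl

theorem hi_one : hi 1 = 1 := hi_of_le_one le_rfl

theorem diffCoef_one : diffCoef n d0 dinf κ θ Δ p0 pinf β0 βinf 1 = ⟨κ, θ, β0, βinf, Δ⟩ := by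
  simp [diffCoef, lo_one, hi_one]

theorem phi_eq_gPhi (i : ℕ) (s : ℝ) : phi n d0 dinf κ θ i s =
    gPhi (diffExps n d0 dinf p0 pinf) ⟨κ, θ, β0, βinf, Δ⟩ i s := by
  induction i with
  | zero => rfl
  | succ i ih => simp only [phi, gPhi, Function.comp_apply, ih]; rfl

theorem xi_eq_gXi (i : ℕ) (z : Fin n → ℝ) : xi n d0 dinf κ θ i z =
    gXi (diffExps n d0 dinf p0 pinf) ⟨κ, θ, β0, βinf, Δ⟩ i z := rfl

theorem youngTerm_eq_gap (β : ℝ) {r p : ℝ} (hr : r ≠ 0) (hp : p ≠ 0) (s ξ : ℝ) :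
    youngTerm β r p s ξ = β * gap (p / r) s ξ := by
  have h1 : (p - r) / r = p / r - 1 := by field_simp
  have h2 : (p - r) / p = (p / r - 1) / (p / r) := by field_simp
  rw [youngTerm, gap, h1, h2, one_div_div]

theorem spowSet_of_ne {p : ℝ} (hp : p ≠ 0) (s : ℝ) : spowSet s p = {spow s p} := by
  simp [spowSet, hp]

/-- Size and sign are all that is used of a selection. At the jump (`p = 0`, `s = 0`) the bound
holds because `|0| ^ 0 = 1`. -/
theorem spowSet_spec {s p w : ℝ} (hw : w ∈ spowSet s p) :
    |w| ≤ |s| ^ p ∧ w * s = |s| ^ p * |s| := by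
  unfold spowSet at hw
  split_ifs at hw with h
  · obtain ⟨rfl, rfl⟩ := h
    simpa [abs_le] using hw
  · rw [mem_singleton_iff] at hw
    rw [hw]
    exact ⟨abs_spow_le s p, spow_mul_self s p⟩

variable (H : Hyp n d0 dinf κ θ Δ p0 pinf β0 βinf)

include H

theorem Hyp.lyapV_eq (z : Fin n → ℝ) : lyapV n d0 dinf κ θ p0 pinf β0 βinf z =
    gV (diffExps n d0 dinf p0 pinf) ⟨κ, θ, β0, βinf, Δ⟩ z := by
  refine Finset.sum_congr rfl fun i hi => ?_
  obtain ⟨h1, h2⟩ := Finset.mem_Icc.1 hi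
  rw [youngTerm_eq_gap _ (H.wt0_pos h1 h2).ne' H.p0_pos.ne',
    youngTerm_eq_gap _ (H.wtinf_pos h1 h2).ne' H.pinf_pos.ne',
    xi_eq_gXi (Δ := Δ) (p0 := p0) (pinf := pinf) (β0 := β0) (βinf := βinf)]
  rfl

theorem Hyp.goodCoef_one : Coef.Good ⟨κ, θ, β0, βinf, Δ⟩ (diffExps n d0 dinf p0 pinf) n
    (Δ / κ n) := by
  have := H.goodCoef 1
  rwa [diffCoef_one] at this

theorem Hyp.phiSet_lt {i : ℕ} (h1 : 1 ≤ i) (h2 : i < n) {s w : ℝ}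
    (hw : w ∈ phiSet n d0 dinf κ θ i s) :
    w = gPhi (diffExps n d0 dinf p0 pinf) ⟨κ, θ, β0, βinf, Δ⟩ i s := by
  obtain ⟨x, hx, y, hy, rfl⟩ := hw
  have ha : wt n d0 (i + 1) / wt n d0 i ≠ 0 := (H.goodExps.a_pos i h1 h2).ne'
  have hb : wt n dinf (i + 1) / wt n dinf i ≠ 0 := (H.goodExps.b_pos i h1 h2).ne'
  rw [spowSet_of_ne ha, mem_singleton_iff] at hx
  rw [spowSet_of_ne hb, mem_singleton_iff] at hy
  obtain ⟨m, rfl⟩ : ∃ m, i = m + 1 := ⟨i - 1, by omega⟩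
  rw [Nat.add_sub_cancel, phi_eq_gPhi (Δ := Δ) (p0 := p0) (pinf := pinf) (β0 := β0)
    (βinf := βinf)] at hx hy
  rw [hx, hy]
  rfl

theorem Hyp.phiSet_last {s w : ℝ} (hw : w ∈ phiSet n d0 dinf κ θ n s) :
    |w| ≤ gAbs (diffExps n d0 dinf p0 pinf) ⟨κ, θ, β0, βinf, Δ⟩ n
        (gPhi (diffExps n d0 dinf p0 pinf) ⟨κ, θ, β0, βinf, Δ⟩ (n - 1) s) ∧
      w * gPhi (diffExps n d0 dinf p0 pinf) ⟨κ, θ, β0, βinf, Δ⟩ (n - 1) s =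
        gAbs (diffExps n d0 dinf p0 pinf) ⟨κ, θ, β0, βinf, Δ⟩ n
          (gPhi (diffExps n d0 dinf p0 pinf) ⟨κ, θ, β0, βinf, Δ⟩ (n - 1) s) *
          |gPhi (diffExps n d0 dinf p0 pinf) ⟨κ, θ, β0, βinf, Δ⟩ (n - 1) s| := by
  obtain ⟨x, hx, y, hy, rfl⟩ := hw
  have hn := H.two_le
  rw [phi_eq_gPhi (Δ := Δ) (p0 := p0) (pinf := pinf) (β0 := β0) (βinf := βinf)] at hx hy
  obtain ⟨hx1, hx2⟩ := spowSet_spec hx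
  obtain ⟨hy1, hy2⟩ := spowSet_spec hy
  have hκ := H.κ_pos n (Finset.mem_Icc.2 ⟨by omega, le_rfl⟩)
  have hθ := H.θ_pos n (Finset.mem_Icc.2 ⟨by omega, le_rfl⟩)
  simp only [gAbs, diffExps] at *
  constructor
  · refine (abs_add_le _ _).trans ?_
    rw [abs_mul, abs_mul, abs_of_pos hκ, abs_of_pos hθ]
    gcongr
  · rw [add_mul, mul_assoc, mul_assoc, hx2, hy2]
    ring

end Bridge

/-! ### Gains, the continuous bound of `V̇`, and global properties of `V` -/

theorem exists_pos_bounds {Y : Type*} [TopologicalSpace Y] {K : Set Y} (hK : IsCompact K)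
    {f : Y → ℝ} (hf : Continuous f) (hpos : ∀ y ∈ K, 0 < f y) :
    ∃ c C : ℝ, 0 < c ∧ 0 < C ∧ ∀ y ∈ K, c ≤ f y ∧ f y ≤ C := by
  rcases K.eq_empty_or_nonempty with rfl | hne
  · exact ⟨1, 1, one_pos, one_pos, fun y hy => hy.elim⟩
  · obtain ⟨p, hp, hmin⟩ := hK.exists_isMinOn hne hf.continuousOn
    obtain ⟨q, hq, hmax⟩ := hK.exists_isMaxOn hne hf.continuousOn
    exact ⟨f p, f q, hpos p hp, hpos q hq,
      fun y hy => ⟨isMinOn_iff.1 hmin y hy, isMaxOn_iff.1 hmax y hy⟩⟩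

/-- The gains `k_i = k̃_1 ⋯ k̃_i`. -/
def gains (κt : ℕ → ℝ) (i : ℕ) : ℝ := ∏ j ∈ Finset.Icc 1 i, κt j

theorem one_le_gains {κt : ℕ → ℝ} (h : ∀ i, 1 ≤ κt i) (i : ℕ) : 1 ≤ gains κt i := by
  induction i with
  | zero => simp [gains]
  | succ i ih =>
    rw [gains, Finset.prod_Icc_succ_top (by omega)]
    exact one_le_mul_of_one_le_of_one_le ih (h _)

theorem gains_succ (κt : ℕ → ℝ) (i : ℕ) : gains κt (i + 1) = gains κt i * κt (i + 1) :=
  Finset.prod_Icc_succ_top (by omega) _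

theorem ktilde_gains {κt : ℕ → ℝ} (h : ∀ i, 1 ≤ κt i) {i : ℕ} (hi : 1 ≤ i) :
    ktilde (gains κt) i = κt i := by
  obtain ⟨m, rfl⟩ : ∃ m, i = m + 1 := ⟨i - 1, by omega⟩
  have hpos : gains κt m ≠ 0 := (zero_lt_one.trans_le (one_le_gains h m)).ne'
  rw [ktilde, gains_succ, Nat.add_sub_cancel]
  split_ifs with hm
  · have : m = 0 := by omega
    simp [this, gains]
  · field_simp

/-- The contribution of the discontinuous component to `V̇`. -/
theorem neg_mul_le_of_sign {g G w s Φ K δ Δ k : ℝ} (hK : 0 ≤ K) (hw : |w| ≤ Φ) (hws : w * s = Φ * |s|)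
    (hG : 0 < s → 0 ≤ G) (hG' : s < 0 → G ≤ 0) (hG0 : s = 0 → G = 0) (hk : 1 ≤ k) (hδ : |δ| ≤ Δ) :
    g * (-K * w + δ / k) ≤ K * ((|g - G| - |G|) * Φ) + Δ * |g| := by
  -- For `s ≠ 0` the selection is `±Φ` with the sign of `s`, like `G`; for `s = 0` the factor `G`
  -- vanishes, so the value of the selection is irrelevant.
  have h1 : G * w = |G| * Φ := by
    rcases lt_trichotomy s 0 with h | h | h
    · have : w = -Φ := by
        rw [abs_of_neg h] at hws
        exact mul_right_cancel₀ h.ne (by linarith)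
      rw [this, abs_of_nonpos (hG' h)]; ring
    · simp [hG0 h]
    · have : w = Φ := by
        rw [abs_of_pos h] at hws
        exact mul_right_cancel₀ h.ne' hws
      rw [this, abs_of_nonneg (hG h)]
  have h2 : -((g - G) * w) ≤ |g - G| * Φ :=
    (neg_le_abs _).trans (by rw [abs_mul]; exact mul_le_mul_of_nonneg_left hw (abs_nonneg _))
  have h3 : g * (δ / k) ≤ Δ * |g| := by
    have h4 : |δ / k| ≤ Δ := by
      rw [abs_div, abs_of_pos (by linarith : 0 < k)]
      exact (div_le_self (abs_nonneg _) hk).trans hδ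
    refine (le_abs_self _).trans ?_
    rw [abs_mul, mul_comm]
    exact mul_le_mul_of_nonneg_right h4 (abs_nonneg _)
  have h5 : -(g * w) ≤ (|g - G| - |G|) * Φ := by nlinarith
  have h6 := mul_le_mul_of_nonneg_left h5 hK
  nlinarith

section Bridge

variable {n : ℕ} {d0 dinf : ℝ} {κ θ : ℕ → ℝ} {Δ p0 pinf : ℝ} {β0 βinf : ℕ → ℝ}
variable (H : Hyp n d0 dinf κ θ Δ p0 pinf β0 βinf)

include H

theorem Hyp.lyapV_eq' : lyapV n d0 dinf κ θ p0 pinf β0 βinf =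
    fun z => gV (diffExps n d0 dinf p0 pinf) ⟨κ, θ, β0, βinf, Δ⟩ z := funext H.lyapV_eq

theorem Hyp.contDiff_lyapV : ContDiff ℝ 1 (lyapV n d0 dinf κ θ p0 pinf β0 βinf) := by
  rw [H.lyapV_eq']
  exact contDiff_gV H.goodExps H.goodCoef_one
    fun i h1 h2 => H.κ_pos i (Finset.mem_Icc.2 ⟨h1, h2⟩)

theorem Hyp.fderiv_le_gRate {κt : ℕ → ℝ} (hκt : ∀ i, 1 ≤ κt i) {δ : ℝ} (hδ : |δ| ≤ Δ)
    {z v : Fin n → ℝ} (hv : v ∈ errorField n d0 dinf κ θ (gains κt) δ z) :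
    fderiv ℝ (lyapV n d0 dinf κ θ p0 pinf β0 βinf) z v ≤
      gRate (diffExps n d0 dinf p0 pinf) ⟨κ, θ, β0, βinf, Δ⟩ κt z := by
  have hn := H.two_le
  rw [H.lyapV_eq', fderiv_gV H.goodExps H.goodCoef_one
    (fun i h1 h2 => H.κ_pos i (Finset.mem_Icc.2 ⟨h1, h2⟩)),
    ← Finset.Ico_add_one_right_eq_Icc, Finset.sum_Ico_succ_top (by omega), add_comm, gRate,
    sub_eq_add_neg, ← Finset.sum_neg_distrib]
  refine add_le_add ?_ (Finset.sum_le_sum fun i hi => ?_)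
  · obtain ⟨w, hw, hvw⟩ := hv n (Finset.mem_Icc.2 ⟨by omega, le_rfl⟩)
    obtain ⟨hw1, hw2⟩ := H.phiSet_last hw
    rw [ktilde_gains hκt (by omega), if_pos rfl] at hvw
    have hgn : gains κt n = gains κt (n - 1) * κt n := by
      have := gains_succ κt (n - 1)
      rwa [show n - 1 + 1 = n by omega] at this
    have hκn := hκt n
    have hg1 := one_le_gains hκt (n - 1)
    -- The gain turns `δ / k_n` into `δ / k_{n-1}`, which is still bounded by `Δ` because all gains
    -- are at least `1`.
    have hcv : coord v n = -κt n * w + δ / gains κt (n - 1) := by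
      rw [hvw, hgn]
      field_simp
      ring
    have hG := gG_strictMono H.goodExps H.goodCoef_one (i := n) (by omega) le_rfl
    have hG0 : gG (diffExps n d0 dinf p0 pinf) ⟨κ, θ, β0, βinf, Δ⟩ n 0 = 0 := bin_zero _ _ _ _
    rw [hcv, gLast]
    exact neg_mul_le_of_sign (by linarith) hw1 hw2 (fun h => hG0 ▸ (hG h).le)
      (fun h => hG0 ▸ (hG h).le) (fun h => by rw [h, hG0]) hg1 hδ
  · obtain ⟨h1, h2⟩ := Finset.mem_Ico.1 hi
    obtain ⟨w, hw, hvw⟩ := hv i (Finset.mem_Icc.2 ⟨h1, h2.le⟩)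
    rw [H.phiSet_lt h1 h2 hw, ktilde_gains hκt h1, if_neg h2.ne] at hvw
    rw [hvw, gT]
    exact le_of_eq (by ring)

theorem Hyp.zero_mem_errorField {κt : ℕ → ℝ} (hκt : ∀ i, 1 ≤ κt i) (hκn : κt n = Δ / κ n + 1)
    {δ : ℝ} (hδ : |δ| ≤ Δ) :
    (0 : Fin n → ℝ) ∈ errorField n d0 dinf κ θ (gains κt) δ 0 := by
  have hn := H.two_le
  have hc : ∀ i, coord (0 : Fin n → ℝ) i = 0 := fun i => by simp [coord]
  have hφ : ∀ i, phi n d0 dinf κ θ i 0 = 0 := fun i => by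
    induction i with
    | zero => rfl
    | succ i ih => simp [phi, ih, varphi]
  have hmem : ∀ p, (0 : ℝ) ∈ spowSet 0 p := fun p => by
    unfold spowSet
    split_ifs <;> simp
  intro i hi
  obtain ⟨h1, h2⟩ := Finset.mem_Icc.1 hi
  rw [hc, hc]
  rcases h2.eq_or_lt with rfl | h2'
  · have hκ := H.κ_pos i hi
    have hkpos : 0 < gains κt i := zero_lt_one.trans_le (one_le_gains hκt i)
    -- At the origin the sign term must cancel `δ / k_n` by itself. Its value `δ / (k_n κ_n)` lies
    -- in `[-1, 1]` since `κ_n k_n ≥ κ_n k̃_n = Δ + κ_n`.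
    refine ⟨δ / gains κt i, ⟨δ / gains κt i / κ i, ?_, 0, ?_, ?_⟩, ?_⟩
    · rw [hφ]
      by_cases hd : d0 = -1
      · have ha : wt i d0 (i + 1) / wt i d0 i = 0 := by rw [wt_succ, wt_self, hd]; simp
        have hg : gains κt i = gains κt (i - 1) * κt i := by
          have := gains_succ κt (i - 1)
          rwa [show i - 1 + 1 = i by omega] at this
        have hle : κt i ≤ gains κt i := by
          rw [hg]
          exact le_mul_of_one_le_left (by linarith [hκt i]) (one_le_gains hκt _)
        have hle2 : |δ| ≤ κ i * gains κt i := by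
          refine hδ.trans (le_trans ?_ (mul_le_mul_of_nonneg_left hle hκ.le))
          rw [hκn, mul_add, mul_div_cancel₀ _ hκ.ne']
          linarith
        rw [spowSet, if_pos ⟨ha, rfl⟩, mem_Icc, ← abs_le, abs_div, abs_div, abs_of_pos hkpos,
          abs_of_pos hκ, div_div, div_le_one (by positivity)]
        linarith
      · have : δ = 0 := by
          rw [H.Δ_eq_zero hd] at hδ
          exact abs_eq_zero.1 (le_antisymm hδ (abs_nonneg _))
        rw [this, zero_div, zero_div]
        exact hmem _
    · rw [hφ]; exact hmem _
    · field_simp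
      simp
    · simp
  · refine ⟨0, ⟨0, by rw [hφ]; exact hmem _, 0, by rw [hφ]; exact hmem _, by simp⟩, ?_⟩
    rw [if_neg h2'.ne, hc]
    simp

/-- Every nonzero state is a dilation of a state on the unit sphere of one of the systems of the
family. -/
theorem Hyp.exists_rescale {z : Fin n → ℝ} (hz : z ≠ 0) :
    ∃ (r t : ℝ) (u : Fin n → ℝ), 0 < r ∧ t ∈ Icc (0 : ℝ) 2 ∧ ‖u‖ = 1 ∧
      ((r ≤ 1 ∧ (∀ i, coord z i = r ^ wt n d0 i * coord u i) ∧
        Rescale (diffExps n d0 dinf p0 pinf) n ⟨κ, θ, β0, βinf, Δ⟩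
          (diffCoef n d0 dinf κ θ Δ p0 pinf β0 βinf t) (fun i => r ^ wt n d0 i) (r ^ p0) (r ^ d0)) ∨
      (1 ≤ r ∧ (∀ i, coord z i = r ^ wt n dinf i * coord u i) ∧
        Rescale (diffExps n d0 dinf p0 pinf) n ⟨κ, θ, β0, βinf, Δ⟩
          (diffCoef n d0 dinf κ θ Δ p0 pinf β0 βinf t) (fun i => r ^ wt n dinf i) (r ^ pinf)
          (r ^ dinf))) := by
  rw [← diffCoef_one (n := n) (d0 := d0) (dinf := dinf) (p0 := p0) (pinf := pinf)]
  rcases le_total ‖z‖ 1 with h | h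
  · obtain ⟨r, u, hr, hu, hzu, hr1, -⟩ := exists_dilation (fun i => H.wt0_pos) hz
    have hr1 := hr1 h
    refine ⟨r, r, u, hr, ⟨hr.le, by linarith⟩, hu, Or.inl ⟨hr1, hzu, ?_⟩⟩
    exact H.rescale_zero hr hi_one (hi_of_le_one hr1) (by rw [lo_of_mem hr.le hr1, lo_one, mul_one])
  · obtain ⟨r, u, hr, hu, hzu, -, hr1⟩ := exists_dilation (fun i => H.wtinf_pos) hz
    have hr1 := hr1 h
    have hinv : 1 / r ≤ 1 := (div_le_one hr).2 hr1
    have hinv' : 0 < 1 / r := one_div_pos.2 hr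
    -- This parameter gives `hi t = 1 / r`; in the unit ball the parameter is `t = r`, with `lo t =
    -- r`.
    refine ⟨r, 2 - 1 / r, u, hr, ⟨by linarith, by linarith⟩, hu, Or.inr ⟨hr1, hzu, ?_⟩⟩
    refine H.rescale_infty hr lo_one (lo_of_one_le (by linarith)) ?_
    rw [hi_one, hi_of_mem (by linarith) (by linarith)]
    field_simp
    ring

theorem Hyp.exists_bounds_gV : ∃ c C : ℝ, 0 < c ∧ 0 < C ∧ ∀ t ∈ Icc (0 : ℝ) 2,
    ∀ u : Fin n → ℝ, ‖u‖ = 1 →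
      c ≤ gV (diffExps n d0 dinf p0 pinf) (diffCoef n d0 dinf κ θ Δ p0 pinf β0 βinf t) u ∧
      gV (diffExps n d0 dinf p0 pinf) (diffCoef n d0 dinf κ θ Δ p0 pinf β0 βinf t) u ≤ C := by
  have hcont : Continuous fun p : ℝ × (Fin n → ℝ) => gV (diffExps n d0 dinf p0 pinf)
      (diffCoef n d0 dinf κ θ Δ p0 pinf β0 βinf p.1) p.2 :=
    continuous_gV (contCoef_diffCoef.comp continuous_fst) H.goodExps (fun p => H.goodCoef p.1)
      continuous_snd
  have hK : IsCompact (Icc (0 : ℝ) 2 ×ˢ Metric.sphere (0 : Fin n → ℝ) 1) :=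
    isCompact_Icc.prod (isCompact_sphere _ _)
  obtain ⟨c, C, hc, hC, h⟩ := exists_pos_bounds hK hcont fun p hp =>
    gV_pos H.goodExps (H.goodCoef p.1) (by
      intro h0
      have := hp.2
      rw [h0, mem_sphere_zero_iff_norm, norm_zero] at this
      exact zero_ne_one this)
  exact ⟨c, C, hc, hC, fun t ht u hu => h (t, u) ⟨ht, by simpa using hu⟩⟩

theorem Hyp.lyapV_zero : lyapV n d0 dinf κ θ p0 pinf β0 βinf 0 = 0 := by
  rw [H.lyapV_eq]
  refine Finset.sum_eq_zero fun i hi => ?_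
  obtain ⟨h1, h2⟩ := Finset.mem_Icc.1 hi
  have hc : ∀ i, coord (0 : Fin n → ℝ) i = 0 := fun i => by simp [coord]
  have hx : gXi (diffExps n d0 dinf p0 pinf) ⟨κ, θ, β0, βinf, Δ⟩ i (0 : Fin n → ℝ) = 0 := by
    unfold gXi
    split_ifs with h
    · rw [hc]; exact gInv_zero H.goodExps H.goodCoef_one h1 h
    · rfl
  rw [hc, hx, gTerm, gap_self (H.goodExps.q0_gt i h1 h2), gap_self (H.goodExps.q1_gt i h1 h2)]
  simp

theorem Hyp.lyapV_pos {z : Fin n → ℝ} (hz : z ≠ 0) :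
    0 < lyapV n d0 dinf κ θ p0 pinf β0 βinf z := by
  rw [H.lyapV_eq]
  exact gV_pos H.goodExps H.goodCoef_one hz

/-- Outside the unit ball `V z ≥ c * r ^ pinf` for the homogeneous radius `r` of `z`, so bounded
values of `V` bound `r`, hence every coordinate. -/
theorem Hyp.tendsto_lyapV :
    Tendsto (lyapV n d0 dinf κ θ p0 pinf β0 βinf) (cocompact (Fin n → ℝ)) atTop := by
  obtain ⟨c, C, hc, -, hcC⟩ := H.exists_bounds_gV
  refine tendsto_atTop.2 fun M => ?_
  set Λ := max 1 ((max M 0 / c) ^ (1 / pinf)) with hΛ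
  have hΛ1 : 1 ≤ Λ := le_max_left _ _
  have hsum : ∀ i : Fin n, Λ ^ wtVec n dinf i ≤ ∑ j : Fin n, Λ ^ wtVec n dinf j := fun i =>
    Finset.single_le_sum (f := fun j : Fin n => Λ ^ wtVec n dinf j)
      (fun j _ => by positivity) (Finset.mem_univ i)
  have hS0 : 0 ≤ ∑ j : Fin n, Λ ^ wtVec n dinf j := Finset.sum_nonneg fun j _ => by positivity
  refine mem_cocompact.2 ⟨Metric.closedBall 0 (1 + ∑ j : Fin n, Λ ^ wtVec n dinf j),
    isCompact_closedBall _ _, fun z hz => ?_⟩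
  by_contra hcon
  have hcon : lyapV n d0 dinf κ θ p0 pinf β0 βinf z < M := not_le.1 hcon
  refine hz (mem_closedBall_zero_iff.2 ?_)
  rcases eq_or_ne z 0 with rfl | hz0
  · rw [norm_zero]; linarith
  obtain ⟨r, t, u, hr, ht, hu, h | h⟩ := H.exists_rescale hz0
  · obtain ⟨hr1, hzu, -⟩ := h
    refine (pi_norm_le_iff_of_nonneg (by linarith)).2 fun j => ?_
    have hw := H.wt0_pos (i := j + 1) (by omega) j.2
    rw [Real.norm_eq_abs, ← coord_succ z j, hzu, abs_mul, coord_succ,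
      abs_of_pos (Real.rpow_pos_of_pos hr _)]
    have h1 : r ^ wt n d0 (j + 1) ≤ 1 := Real.rpow_le_one hr.le hr1 hw.le
    have h2 : |u j| ≤ 1 := by rw [← hu]; exact norm_le_pi_norm u j
    have h3 : 0 < r ^ wt n d0 (j + 1) := Real.rpow_pos_of_pos hr _
    nlinarith [abs_nonneg (u j)]
  · obtain ⟨hr1, hzu, hres⟩ := h
    have hV := hres.gV_mul H.goodExps H.goodCoef_one (H.goodCoef t) hzu
    rw [← H.lyapV_eq] at hV
    have hcV := (hcC t ht u hu).1
    have hrp : 0 < r ^ pinf := Real.rpow_pos_of_pos hr _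
    have hle : r ^ pinf ≤ max M 0 / c := by
      rw [le_div_iff₀ hc]
      have := le_max_left M 0
      nlinarith
    have hrΛ : r ≤ Λ := by
      refine le_trans ?_ (le_max_right _ _)
      have := Real.rpow_le_rpow hrp.le hle (one_div_pos.2 H.pinf_pos).le
      rwa [← Real.rpow_mul hr.le, mul_one_div_cancel H.pinf_pos.ne', Real.rpow_one] at this
    refine (pi_norm_le_iff_of_nonneg (by linarith)).2 fun j => ?_
    have hw := H.wtinf_pos (i := j + 1) (by omega) j.2
    rw [Real.norm_eq_abs, ← coord_succ z j, hzu, abs_mul, coord_succ,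
      abs_of_pos (Real.rpow_pos_of_pos hr _)]
    have h1 : r ^ wt n dinf (j + 1) ≤ Λ ^ wt n dinf (j + 1) := Real.rpow_le_rpow hr.le hrΛ hw.le
    have h2 : |u j| ≤ 1 := by rw [← hu]; exact norm_le_pi_norm u j
    have h3 : 0 < r ^ wt n dinf (j + 1) := Real.rpow_pos_of_pos hr _
    have h4 := hsum j
    simp only [wtVec] at h4 ⊢
    nlinarith [abs_nonneg (u j)]

end Bridge

/-! ### Fixed-time stability from the differential inequality -/

theorem settling_bound_eq {d0 dinf p0 pinf η0 ηinf : ℝ} (hd0 : d0 < 0) (hdinf : 0 < dinf)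
    (hp0 : 0 < p0) (hpinf : 0 < pinf) (h0 : 0 < η0) (hinf : 0 < ηinf) :
    ∃ r : ℝ, 0 < r ∧ r ^ (-(dinf / pinf)) / (dinf / pinf * ηinf) +
        r ^ (-d0 / p0) / (-d0 / p0 * η0) =
      p0 / (d0 * ηinf) * (pinf * d0 / (p0 * dinf) - 1) *
        (η0 / ηinf) ^ (1 / (pinf * d0 / (p0 * dinf) - 1)) := by
  obtain ⟨x, hx⟩ : ∃ x, x = -d0 / p0 := ⟨_, rfl⟩
  obtain ⟨y, hy⟩ : ∃ y, y = dinf / pinf := ⟨_, rfl⟩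
  have hx0 : 0 < x := by rw [hx]; exact div_pos (by linarith) hp0
  have hy0 : 0 < y := by rw [hy]; positivity
  have hd0x : d0 = -(x * p0) := by rw [hx]; field_simp
  have hdy : dinf = y * pinf := by rw [hy]; field_simp
  have hq : 0 < η0 / ηinf := by positivity
  have hxy : x + y ≠ 0 := by positivity
  -- The level at which the two decay rates `η0 r^(1-x)` and `ηinf r^(1+y)` agree; it also minimizes
  -- the sum of the two times.
  refine ⟨(η0 / ηinf) ^ (1 / (x + y)), by positivity, ?_⟩
  rw [← hx, ← hy]
  have e1 : pinf * d0 / (p0 * dinf) - 1 = -((x + y) / y) := by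
    rw [hd0x, hdy]; field_simp; ring
  have e2 : (1 : ℝ) / (-((x + y) / y)) = 1 / (x + y) * (-y) := by field_simp
  have e3 : ((η0 / ηinf) ^ (1 / (x + y))) ^ x =
      η0 / ηinf * ((η0 / ηinf) ^ (1 / (x + y))) ^ (-y) := by
    rw [← Real.rpow_mul hq.le, ← Real.rpow_mul hq.le]
    nth_rewrite 2 [← Real.rpow_one (η0 / ηinf)]
    rw [← Real.rpow_add hq]
    congr 1
    field_simp
    ring
  rw [e1, e2, Real.rpow_mul hq.le, e3, hd0x]
  generalize ((η0 / ηinf) ^ (1 / (x + y))) ^ (-y) = w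
  field_simp

section FixedTime

variable {n : ℕ} {F : ℝ → (Fin n → ℝ) → Set (Fin n → ℝ)} {Δ : ℝ} {V : (Fin n → ℝ) → ℝ}
  {d0 dinf p0 pinf η0 ηinf : ℝ}

theorem DecayIneq.low (hL : IsLyapunov F Δ V) (hp0 : 0 < p0) (hinf : 0 < ηinf)
    (h : DecayIneq F Δ V d0 dinf p0 pinf η0 ηinf) (d : ℝ) (hd : |d| ≤ Δ) (w : Fin n → ℝ)
    (hw : w ≠ 0) (v : Fin n → ℝ) (hv : v ∈ F d w) :
    fderiv ℝ V w v ≤ -η0 * V w ^ (1 - -d0 / p0) := by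
  have h1 := h d hd w v hv
  have hV := hL.pos w hw
  have h2 : 0 < ηinf * V w ^ ((pinf + dinf) / pinf) := by positivity
  rw [show 1 - -d0 / p0 = (p0 + d0) / p0 by field_simp; ring]
  linarith

theorem DecayIneq.high (hL : IsLyapunov F Δ V) (hpinf : 0 < pinf) (h0 : 0 < η0)
    (h : DecayIneq F Δ V d0 dinf p0 pinf η0 ηinf) (d : ℝ) (hd : |d| ≤ Δ) (w : Fin n → ℝ)
    (hw : w ≠ 0) (v : Fin n → ℝ) (hv : v ∈ F d w) :
    fderiv ℝ V w v ≤ -ηinf * V w ^ (1 + dinf / pinf) := by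
  have h1 := h d hd w v hv
  have hV := hL.pos w hw
  have h2 : 0 < η0 * V w ^ ((p0 + d0) / p0) := by positivity
  rw [show 1 + dinf / pinf = (pinf + dinf) / pinf by field_simp]
  linarith

theorem DecayIneq.settlingTime_le (hL : IsLyapunov F Δ V) (hd0 : d0 < 0) (hdinf : 0 < dinf)
    (hp0 : 0 < p0) (hpinf : 0 < pinf) (h0 : 0 < η0) (hinf : 0 < ηinf)
    (h : DecayIneq F Δ V d0 dinf p0 pinf η0 ηinf) (z₀ : Fin n → ℝ) :
    settlingTime F Δ z₀ ≤ ENNReal.ofReal (p0 / (d0 * ηinf) * (pinf * d0 / (p0 * dinf) - 1) *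
      (η0 / ηinf) ^ (1 / (pinf * d0 / (p0 * dinf) - 1))) := by
  obtain ⟨r, hr, hrT⟩ := settling_bound_eq hd0 hdinf hp0 hpinf h0 hinf
  rw [← hrT]
  exact settlingTime_le_uniform hL (div_pos (by linarith) hp0) (div_pos hdinf hpinf) h0 hinf hr
    (DecayIneq.low hL hp0 hinf h) (DecayIneq.high hL hpinf h0 h) z₀

/-- Settling times are squeezed between `0` and a multiple of `V ^ (-d0 / p0)`, which is continuous
and zero at the origin. -/
theorem DecayIneq.continuousAt_settlingTime (hL : IsLyapunov F Δ V) (hd0 : d0 < 0)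
    (hp0 : 0 < p0) (h0 : 0 < η0) (hinf : 0 < ηinf)
    (h : DecayIneq F Δ V d0 dinf p0 pinf η0 ηinf) : ContinuousAt (settlingTime F Δ) 0 := by
  have hx : 0 < -d0 / p0 := div_pos (by linarith) hp0
  have hle := settlingTime_le_low hL hx h0 (DecayIneq.low hL hp0 hinf h)
  have hcont : Continuous fun z => ENNReal.ofReal (V z ^ (-d0 / p0) / (-d0 / p0 * η0)) :=
    ENNReal.continuous_ofReal.comp
      (((Real.continuous_rpow_const hx.le).comp hL.contDiff.continuous).div_const _)
  have hz : ENNReal.ofReal (V 0 ^ (-d0 / p0) / (-d0 / p0 * η0)) = 0 := by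
    rw [hL.zero, Real.zero_rpow hx.ne', zero_div, ENNReal.ofReal_zero]
  have h00 : settlingTime F Δ 0 = 0 := le_antisymm ((hle 0).trans hz.le) zero_le
  have ht := hcont.tendsto 0
  rw [hz] at ht
  unfold ContinuousAt
  rw [h00]
  exact tendsto_of_tendsto_of_tendsto_of_le_of_le tendsto_const_nhds ht (fun _ => zero_le) hle

theorem DecayIneq.isFxTS (hL : IsLyapunov F Δ V) (hG : IsGAS F Δ) (hd0 : d0 < 0) (hdinf : 0 < dinf)
    (hp0 : 0 < p0) (hpinf : 0 < pinf) (h0 : 0 < η0) (hinf : 0 < ηinf)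
    (h : DecayIneq F Δ V d0 dinf p0 pinf η0 ηinf) : IsFxTS F Δ := by
  have hle := h.settlingTime_le hL hd0 hdinf hp0 hpinf h0 hinf
  refine ⟨⟨hG, fun z₀ => (hle z₀).trans_lt ENNReal.ofReal_lt_top⟩, max 1 _,
    lt_max_of_lt_left one_pos, fun z₀ => (hle z₀).trans (ENNReal.ofReal_le_ofReal (le_max_right _ _))⟩

end FixedTime

/-! ### Homogeneity in the bi-limit, choice of the gains, and decay of `V` -/

section Main

variable {n : ℕ} {d0 dinf : ℝ} {κ θ : ℕ → ℝ} {Δ p0 pinf : ℝ} {β0 βinf : ℕ → ℝ}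

theorem tendstoUniformlyOn_of_continuous {n : ℕ} {W : ℝ → (Fin n → ℝ) → ℝ}
    (hW : Continuous fun p : ℝ × (Fin n → ℝ) => W p.1 p.2) {F : Filter ℝ} {τ : ℝ → ℝ} {t₀ : ℝ}
    (hτ : Tendsto τ F (𝓝 t₀)) {f : ℝ → (Fin n → ℝ) → ℝ}
    (hf : ∀ᶠ ε in F, ∀ x, f ε x = W (τ ε) x) {K : Set (Fin n → ℝ)} (hK : IsCompact K) :
    TendstoUniformlyOn f (W t₀) F K := by
  intro u hu
  obtain ⟨v, hv, h⟩ := hK.mem_uniformity_of_prod (f := W) (s := univ) (q := t₀) hW.continuousOn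
    (mem_univ _) (UniformSpace.symm hu)
  rw [nhdsWithin_univ] at hv
  filter_upwards [hf, hτ hv] with ε hε hε' x hx
  rw [hε x]
  exact h _ hε' x hx

variable (H : Hyp n d0 dinf κ θ Δ p0 pinf β0 βinf)

include H

theorem Hyp.continuous_gV_diffCoef : Continuous fun p : ℝ × (Fin n → ℝ) =>
    gV (diffExps n d0 dinf p0 pinf) (diffCoef n d0 dinf κ θ Δ p0 pinf β0 βinf p.1) p.2 :=
  continuous_gV (contCoef_diffCoef.comp continuous_fst) H.goodExps (fun p => H.goodCoef p.1)
    continuous_snd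

theorem Hyp.lyapV_eq_one (z : Fin n → ℝ) : lyapV n d0 dinf κ θ p0 pinf β0 βinf z =
    gV (diffExps n d0 dinf p0 pinf) (diffCoef n d0 dinf κ θ Δ p0 pinf β0 βinf 1) z := by
  rw [H.lyapV_eq, diffCoef_one]

/-- The limit functions of `V` are `V` for the coefficients of the `0`-limit and the `∞`-limit. -/
def limitV (n : ℕ) (d0 dinf : ℝ) (κ θ : ℕ → ℝ) (Δ p0 pinf : ℝ) (β0 βinf : ℕ → ℝ) (t : ℝ)
    (z : Fin n → ℝ) : ℝ :=
  gV (diffExps n d0 dinf p0 pinf) (diffCoef n d0 dinf κ θ Δ p0 pinf β0 βinf t) z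

theorem Hyp.limitV_ne_zero (t : ℝ) :
    ∃ x, x ≠ 0 ∧ limitV n d0 dinf κ θ Δ p0 pinf β0 βinf t x ≠ 0 := by
  have hn := H.two_le
  have hx : (fun _ => 1 : Fin n → ℝ) ≠ 0 := fun h => one_ne_zero (congrFun h ⟨0, by omega⟩)
  exact ⟨_, hx, (gV_pos H.goodExps (H.goodCoef t) hx).ne'⟩

theorem Hyp.continuous_limitV (t : ℝ) :
    Continuous (limitV n d0 dinf κ θ Δ p0 pinf β0 βinf t) :=
  continuous_gV (contCoef_diffCoef.comp (f := fun _ : Fin n → ℝ => t) continuous_const) H.goodExps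
    (fun _ => H.goodCoef t) continuous_id

/-- For `r ≤ 1` the rescaled `V` is exactly the Lyapunov function of the member `t = r`, so the
limit is joint continuity in `(t, z)` at `t = 0`. That member is invariant under the dilations,
hence homogeneous. -/
theorem Hyp.isLimitHomogeneous_zero : IsLimitHomogeneous (𝓝[>] 0) (wtVec n d0) p0
    (lyapV n d0 dinf κ θ p0 pinf β0 βinf) (limitV n d0 dinf κ θ Δ p0 pinf β0 βinf 0) := by
  refine ⟨fun i => ?_, H.continuous_limitV 0, H.limitV_ne_zero 0, ?_, ?_⟩
  · simpa [wtVec] using H.wt0_pos (i := i + 1) (by omega) i.2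
  · intro r hr x _
    exact (H.rescale_zero (t := 0) (t' := 0) hr (hi_of_le_one zero_le_one)
      (hi_of_le_one zero_le_one) (by rw [lo_of_mem le_rfl zero_le_one, mul_zero])).gV_mul
      H.goodExps (H.goodCoef 0) (H.goodCoef 0) (coord_dilation d0 r x)
  · intro K hK _
    refine tendstoUniformlyOn_of_continuous H.continuous_gV_diffCoef (τ := id)
      (tendsto_id.mono_left nhdsWithin_le_nhds) ?_ hK
    filter_upwards [Ioc_mem_nhdsGT (zero_lt_one' ℝ)] with r hr x
    have hres := H.rescale_zero (t := 1) (t' := r) hr.1 hi_one (hi_of_le_one hr.2)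
      (by rw [lo_of_mem hr.1.le hr.2, lo_one, mul_one])
    rw [H.lyapV_eq_one, hres.gV_mul H.goodExps (H.goodCoef 1) (H.goodCoef r)
      (coord_dilation d0 r x), mul_div_cancel_left₀ _ (Real.rpow_pos_of_pos hr.1 p0).ne']
    rfl

theorem Hyp.isLimitHomogeneous_infty : IsLimitHomogeneous atTop (wtVec n dinf) pinf
    (lyapV n d0 dinf κ θ p0 pinf β0 βinf) (limitV n d0 dinf κ θ Δ p0 pinf β0 βinf 2) := by
  refine ⟨fun i => ?_, H.continuous_limitV 2, H.limitV_ne_zero 2, ?_, ?_⟩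
  · simpa [wtVec] using H.wtinf_pos (i := i + 1) (by omega) i.2
  · intro r hr x _
    exact (H.rescale_infty (t := 2) (t' := 2) hr (lo_of_one_le one_le_two)
      (lo_of_one_le one_le_two) (by rw [hi_of_mem one_le_two le_rfl, sub_self, mul_zero])).gV_mul
      H.goodExps (H.goodCoef 2) (H.goodCoef 2) (coord_dilation dinf r x)
  · intro K hK _
    have hτ : Tendsto (fun r : ℝ => 2 - r⁻¹) atTop (𝓝 2) := by
      simpa using tendsto_inv_atTop_zero.const_sub (2 : ℝ)
    refine tendstoUniformlyOn_of_continuous H.continuous_gV_diffCoef hτ ?_ hK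
    filter_upwards [eventually_ge_atTop 1] with r hr x
    have hr0 : 0 < r := by linarith
    have hinv : r⁻¹ ≤ 1 := inv_le_one_of_one_le₀ hr
    have hinv' : 0 < r⁻¹ := inv_pos.2 hr0
    have hres := H.rescale_infty (t := 1) (t' := 2 - r⁻¹) hr0 lo_one
      (lo_of_one_le (by linarith)) (by
        rw [hi_one, hi_of_mem (by linarith) (by linarith), sub_sub_cancel,
          mul_inv_cancel₀ hr0.ne'])
    rw [H.lyapV_eq_one, hres.gV_mul H.goodExps (H.goodCoef 1) (H.goodCoef _)
      (coord_dilation dinf r x), mul_div_cancel_left₀ _ (Real.rpow_pos_of_pos hr0 pinf).ne']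
    rfl

theorem Hyp.isBlHomogeneous : IsBlHomogeneous (wtVec n d0) p0 (wtVec n dinf) pinf
    (lyapV n d0 dinf κ θ p0 pinf β0 βinf) :=
  ⟨⟨_, H.isLimitHomogeneous_zero⟩, ⟨_, H.isLimitHomogeneous_infty⟩⟩

/-- Gains that make the continuous bound of `V̇` negative, uniformly on the unit sphere for all the
systems of the family. -/
theorem Hyp.exists_gains : ∃ κt : ℕ → ℝ, (∀ i, 1 ≤ κt i) ∧ κt n = Δ / κ n + 1 ∧
    ∃ η > 0, ∀ t ∈ Icc (0 : ℝ) 2, ∀ u : Fin n → ℝ, ‖u‖ = 1 →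
      gRate (diffExps n d0 dinf p0 pinf) (diffCoef n d0 dinf κ θ Δ p0 pinf β0 βinf t) κt u ≤ -η :=
  exists_gains_gRate (div_nonneg H.Δ_nonneg (H.κ_pos n (Finset.mem_Icc.2
    ⟨by have := H.two_le; omega, le_rfl⟩)).le) contCoef_diffCoef H.goodExps H.goodCoef isCompact_Icc

section Gains

variable {κt : ℕ → ℝ} {η : ℝ} (hη : 0 < η)
  (hrate : ∀ t ∈ Icc (0 : ℝ) 2, ∀ u : Fin n → ℝ, ‖u‖ = 1 →
    gRate (diffExps n d0 dinf p0 pinf) (diffCoef n d0 dinf κ θ Δ p0 pinf β0 βinf t) κt u ≤ -η)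

include hη hrate

theorem Hyp.gRate_neg {z : Fin n → ℝ} (hz : z ≠ 0) :
    gRate (diffExps n d0 dinf p0 pinf) ⟨κ, θ, β0, βinf, Δ⟩ κt z < 0 := by
  obtain ⟨r, t, u, hr, ht, hu, h | h⟩ := H.exists_rescale hz <;> obtain ⟨-, hzu, hres⟩ := h
  · rw [hres.gRate_mul (by positivity) H.goodExps H.goodCoef_one (H.goodCoef t) hzu]
    exact mul_neg_of_pos_of_neg (by positivity) (by linarith [hrate t ht u hu])
  · rw [hres.gRate_mul (by positivity) H.goodExps H.goodCoef_one (H.goodCoef t) hzu]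
    exact mul_neg_of_pos_of_neg (by positivity) (by linarith [hrate t ht u hu])

theorem Hyp.isLyapunov (hκt : ∀ i, 1 ≤ κt i) :
    IsLyapunov (errorField n d0 dinf κ θ (gains κt)) Δ
      (lyapV n d0 dinf κ θ p0 pinf β0 βinf) where
  contDiff := H.contDiff_lyapV
  zero := H.lyapV_zero
  pos _ hz := H.lyapV_pos hz
  radiallyUnbounded := H.tendsto_lyapV
  decreasing _ hd _ hz _ hv := (H.fderiv_le_gRate hκt hd hv).trans_lt (H.gRate_neg hη hrate hz)

theorem Hyp.isGAS (hκt : ∀ i, 1 ≤ κt i) (hκn : κt n = Δ / κ n + 1) :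
    IsGAS (errorField n d0 dinf κ θ (gains κt)) Δ := by
  have hcont : Continuous fun z : Fin n → ℝ =>
      gRate (diffExps n d0 dinf p0 pinf) ⟨κ, θ, β0, βinf, Δ⟩ κt z :=
    continuous_gRate (c := fun _ => ⟨κ, θ, β0, βinf, Δ⟩) ⟨fun _ => continuous_const,
      fun _ => continuous_const, fun _ => continuous_const, fun _ => continuous_const,
      continuous_const⟩ H.goodExps (fun _ => H.goodCoef_one) continuous_id κt
  refine (H.isLyapunov hη hrate hκt).isGAS (fun d hd => H.zero_mem_errorField hκt hκn hd)
    hcont.neg (fun z hz => neg_pos.2 (H.gRate_neg hη hrate hz)) (fun d hd z _ v hv => ?_)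
  rw [Pi.neg_apply, neg_neg]
  exact H.fderiv_le_gRate hκt hd hv

/-- The slope condition says `α ≤ γ` for the two exponents. For `r ≤ 1` the power `V ^ α` has the
size of the decay and `V ^ γ` is smaller; for `r ≥ 1` the roles are exchanged. -/
theorem Hyp.exists_decayIneq (hκt : ∀ i, 1 ≤ κt i) (hd : 0 < d0 → d0 / p0 ≤ dinf / pinf) :
    ∃ η0 ηinf : ℝ, 0 < η0 ∧ 0 < ηinf ∧ DecayIneq (errorField n d0 dinf κ θ (gains κt)) Δ
      (lyapV n d0 dinf κ θ p0 pinf β0 βinf) d0 dinf p0 pinf η0 ηinf := by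
  have hp0 := H.p0_pos
  have hpinf := H.pinf_pos
  have hslope : d0 / p0 ≤ dinf / pinf := by
    rcases lt_or_ge 0 d0 with h | h
    · exact hd h
    -- For `d0 ≤ 0` the condition is automatic: `d0 * pinf ≤ d0 * p0 ≤ dinf * p0`.
    · rw [div_le_div_iff₀ hp0 hpinf]
      have := H.p0_lt_pinf
      have := H.d_le
      nlinarith
  obtain ⟨c, C, -, hC, hcC⟩ := H.exists_bounds_gV
  set α := (p0 + d0) / p0 with hα
  set γ := (pinf + dinf) / pinf with hγ
  have hα0 : 0 < α := div_pos H.p0_add_pos hp0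
  have hγ0 : 0 < γ := div_pos H.pinf_add_pos hpinf
  have hαγ : α ≤ γ := by
    rw [hα, hγ, add_div, add_div, div_self hp0.ne', div_self hpinf.ne']
    linarith
  have hCα : 0 < C ^ α := by positivity
  have hCγ : 0 < C ^ γ := by positivity
  refine ⟨η / (2 * C ^ α), η / (2 * C ^ γ), by positivity, by positivity, fun d hd z v hv => ?_⟩
  rcases eq_or_ne z 0 with rfl | hz
  · have := (H.isLyapunov hη hrate hκt).fderiv_zero
    rw [this, H.lyapV_zero, Real.zero_rpow hα0.ne', Real.zero_rpow hγ0.ne']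
    simp
  refine (H.fderiv_le_gRate hκt hd hv).trans ?_
  -- `M` is the scale of the decay, `r ^ (p0 + d0)` or `r ^ (pinf + dinf)`; half of `η * M` pays for
  -- each of the two powers of `V`.
  suffices key : ∃ M : ℝ,
      gRate (diffExps n d0 dinf p0 pinf) ⟨κ, θ, β0, βinf, Δ⟩ κt z ≤ -η * M ∧
      lyapV n d0 dinf κ θ p0 pinf β0 βinf z ^ α ≤ C ^ α * M ∧
      lyapV n d0 dinf κ θ p0 pinf β0 βinf z ^ γ ≤ C ^ γ * M by
    obtain ⟨M, h1, h2, h3⟩ := key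
    have h4 : η / (2 * C ^ α) * lyapV n d0 dinf κ θ p0 pinf β0 βinf z ^ α ≤ η / 2 * M := by
      refine (mul_le_mul_of_nonneg_left h2 (by positivity)).trans (le_of_eq ?_)
      field_simp
    have h5 : η / (2 * C ^ γ) * lyapV n d0 dinf κ θ p0 pinf β0 βinf z ^ γ ≤ η / 2 * M := by
      refine (mul_le_mul_of_nonneg_left h3 (by positivity)).trans (le_of_eq ?_)
      field_simp
    linarith
  have hVpos := H.lyapV_pos hz
  have hpow : ∀ {r p e : ℝ} (_ : 0 < r) (_ : 0 < e),
      lyapV n d0 dinf κ θ p0 pinf β0 βinf z ≤ r ^ p * C →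
      lyapV n d0 dinf κ θ p0 pinf β0 βinf z ^ e ≤ C ^ e * r ^ (p * e) := by
    intro r p e hr he h
    refine (Real.rpow_le_rpow hVpos.le h he.le).trans (le_of_eq ?_)
    rw [Real.mul_rpow (by positivity) hC.le, ← Real.rpow_mul hr.le, mul_comm]
  obtain ⟨r, t, u, hr, ht, hu, h | h⟩ := H.exists_rescale hz <;> obtain ⟨hr1, hzu, hres⟩ := h
  · have hV := hres.gV_mul H.goodExps H.goodCoef_one (H.goodCoef t) hzu
    rw [← H.lyapV_eq] at hV
    have hVle : lyapV n d0 dinf κ θ p0 pinf β0 βinf z ≤ r ^ p0 * C := by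
      rw [hV]
      exact mul_le_mul_of_nonneg_left (hcC t ht u hu).2 (by positivity)
    have hM : r ^ p0 * r ^ d0 = r ^ (p0 * α) := by
      rw [← Real.rpow_add hr, hα, mul_div_cancel₀ _ hp0.ne']
    refine ⟨r ^ (p0 * α), ?_, hpow hr hα0 hVle, (hpow hr hγ0 hVle).trans ?_⟩
    · rw [hres.gRate_mul (by positivity) H.goodExps H.goodCoef_one (H.goodCoef t) hzu, hM,
        mul_comm (-η)]
      exact mul_le_mul_of_nonneg_left (hrate t ht u hu) (by positivity)
    · refine mul_le_mul_of_nonneg_left ?_ hCγ.le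
      exact Real.rpow_le_rpow_of_exponent_ge hr hr1 (mul_le_mul_of_nonneg_left hαγ hp0.le)
  · have hV := hres.gV_mul H.goodExps H.goodCoef_one (H.goodCoef t) hzu
    rw [← H.lyapV_eq] at hV
    have hVle : lyapV n d0 dinf κ θ p0 pinf β0 βinf z ≤ r ^ pinf * C := by
      rw [hV]
      exact mul_le_mul_of_nonneg_left (hcC t ht u hu).2 (by positivity)
    have hM : r ^ pinf * r ^ dinf = r ^ (pinf * γ) := by
      rw [← Real.rpow_add hr, hγ, mul_div_cancel₀ _ hpinf.ne']
    refine ⟨r ^ (pinf * γ), ?_, (hpow hr hα0 hVle).trans ?_, hpow hr hγ0 hVle⟩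
    · rw [hres.gRate_mul (by positivity) H.goodExps H.goodCoef_one (H.goodCoef t) hzu, hM,
        mul_comm (-η)]
      exact mul_le_mul_of_nonneg_left (hrate t ht u hu) (by positivity)
    · refine mul_le_mul_of_nonneg_left ?_ hCα.le
      exact Real.rpow_le_rpow_of_exponent_le hr1 (mul_le_mul_of_nonneg_left hαγ hpinf.le)

end Gains

end Main

end BlDiff

end
theorem proposition1 (n : ℕ) (hn : 2 ≤ n)
    (d0 dinf : ℝ) (hd0 : -1 ≤ d0) (hd : d0 ≤ dinf) (hdinf : dinf < 1 / ((n : ℝ) - 1))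
    (κ θ : ℕ → ℝ) (hκ : ∀ i ∈ Finset.Icc 1 n, 0 < κ i) (hθ : ∀ i ∈ Finset.Icc 1 n, 0 < θ i)
    (Δ : ℝ) (hΔ : 0 ≤ Δ) (hΔ0 : d0 ≠ -1 → Δ = 0)
    (p0 pinf : ℝ) (hp0 : 0 < p0) (hpinf : 0 < pinf)
    (hp0_ge : ∀ i ∈ Finset.Icc 1 n,
      BlDiff.wt n d0 i / BlDiff.wt n dinf i * (2 * BlDiff.wt n dinf i + dinf) ≤ p0)
    (hpinf_ge : ∀ i ∈ Finset.Icc 1 n, 2 * BlDiff.wt n dinf i + dinf ≤ pinf)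
    (hp_lt : ∀ i ∈ Finset.Icc 1 n, p0 / BlDiff.wt n d0 i < pinf / BlDiff.wt n dinf i)
    (β0 βinf : ℕ → ℝ) (hβ0 : ∀ i ∈ Finset.Icc 1 n, 0 < β0 i)
    (hβinf : ∀ i ∈ Finset.Icc 1 n, 0 < βinf i) :
    ∃ k : ℕ → ℝ, (∀ i ∈ Finset.Icc 1 n, 0 < k i) ∧
      -- `V` is a `C¹`, bl-homogeneous Lyapunov function for the error dynamics
      BlDiff.IsLyapunov (BlDiff.errorField n d0 dinf κ θ k) Δ
        (BlDiff.lyapV n d0 dinf κ θ p0 pinf β0 βinf) ∧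
      BlDiff.IsBlHomogeneous (BlDiff.wtVec n d0) p0 (BlDiff.wtVec n dinf) pinf
        (BlDiff.lyapV n d0 dinf κ θ p0 pinf β0 βinf) ∧
      -- the differential inequality
      ((0 < d0 → d0 / p0 ≤ dinf / pinf) → ∃ η0 ηinf : ℝ, 0 < η0 ∧ 0 < ηinf ∧
        BlDiff.DecayIneq (BlDiff.errorField n d0 dinf κ θ k) Δ
          (BlDiff.lyapV n d0 dinf κ θ p0 pinf β0 βinf) d0 dinf p0 pinf η0 ηinf) ∧
      -- global asymptotic stability
      BlDiff.IsGAS (BlDiff.errorField n d0 dinf κ θ k) Δ ∧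
      -- fixed-time stability and the estimate of the settling time
      (d0 < 0 → 0 < dinf →
        BlDiff.IsFxTS (BlDiff.errorField n d0 dinf κ θ k) Δ ∧
        ContinuousAt (BlDiff.settlingTime (BlDiff.errorField n d0 dinf κ θ k) Δ) 0 ∧
        (∀ z₀ : Fin n → ℝ, ∃ U ∈ 𝓝 z₀, ∃ M : ℝ, ∀ z ∈ U,
          BlDiff.settlingTime (BlDiff.errorField n d0 dinf κ θ k) Δ z ≤ ENNReal.ofReal M) ∧
        ∀ η0 ηinf : ℝ, 0 < η0 → 0 < ηinf →
          BlDiff.DecayIneq (BlDiff.errorField n d0 dinf κ θ k) Δ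
            (BlDiff.lyapV n d0 dinf κ θ p0 pinf β0 βinf) d0 dinf p0 pinf η0 ηinf →
          ∀ z₀ : Fin n → ℝ,
            BlDiff.settlingTime (BlDiff.errorField n d0 dinf κ θ k) Δ z₀ ≤
              ENNReal.ofReal (p0 / (d0 * ηinf) * (pinf * d0 / (p0 * dinf) - 1) *
                (η0 / ηinf) ^ (1 / (pinf * d0 / (p0 * dinf) - 1)))) := by
  have H : BlDiff.Hyp n d0 dinf κ θ Δ p0 pinf β0 βinf := ⟨hn, hd0, hd, hdinf, hκ, hθ, hΔ, hΔ0, hp0,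
    hpinf, hp0_ge, hp_lt, hβ0, hβinf⟩
  obtain ⟨κt, hκt, hκn, η, hη, hrate⟩ := H.exists_gains
  have hL := H.isLyapunov hη hrate hκt
  have hG := H.isGAS hη hrate hκt hκn
  refine ⟨BlDiff.gains κt, fun i _ => zero_lt_one.trans_le (BlDiff.one_le_gains hκt i), hL,
    H.isBlHomogeneous, H.exists_decayIneq hη hrate hκt, hG, fun hneg hpos => ?_⟩
  obtain ⟨η0, ηinf, h0, hinf, hdec⟩ := H.exists_decayIneq hη hrate hκt fun h => absurd h hneg.not_gt
  exact ⟨hdec.isFxTS hL hG hneg hpos hp0 hpinf h0 hinf,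
    hdec.continuousAt_settlingTime hL hneg hp0 h0 hinf,
    fun z₀ => ⟨univ, univ_mem, _, fun z _ => hdec.settlingTime_le hL hneg hpos hp0 hpinf h0 hinf z⟩,
    fun η0 ηinf h0 hinf hdec => hdec.settlingTime_le hL hneg hpos hp0 hpinf h0 hinf⟩
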